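/- **Setting.** Fix $\gamma\in\mathbb R$, $\mathtt p>0$ and a function $\rho$ on $\mathbb R_+=[0,\infty)$ such that $\rho>0$ a.e., $\rho$ and $1/\rho$ belong to $L^1_{\mathrm{loc}}(\mathbb R_+)$, and $\int_0^\infty \frac{dr}{\rho(r)}\int_0^r\rho(s)\,ds=\infty$. Put $m_+(dr)=\rho(r)\,dr$ on $\mathbb R_+$, $\psi_\gamma(x)=\frac{e^{-\gamma|x|}}{2\pi|x|}$ and $m_\gamma(dx)=\psi_\gamma(x)^2dx$ on $\mathbb R^3$. Consider the (real) Dirichlet forms $$\mathcal F^+=\{f\in L^2(\mathbb R_+,m_+): f'\in L^2(\mathbb R_+,m_+)\},\quad \mathcal E^+(f,g)=\tfrac12\int_{\mathbb R_+}f'g'\,dm_+,$$ $$\mathcal F^3=\{f\in L^2(\mathbb R^3,m_\gamma): \nabla f\in L^2(\mathbb R^3,m_\gamma)\},\quad \mathcal E^3(f,g)=\tfrac12\int_{\mathbb R^3}\nabla f\cdot\nabla g\,dm_\gamma,$$ with weak derivatives. Let $E=\mathfrak R_+\cup\mathfrak R^3\subset\mathbb R^4$ with $\mathfrak R_+=\{(0,0,0,r):r\ge0\}\simeq\mathbb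 R_+$ and $\mathfrak R^3=\{(x_1,x_2,x_3,0)\}\simeq\mathbb R^3$, and identify functions on $\mathfrak R_+$, $\mathfrak R^3$ with functions on $\mathbb R_+$, $\mathbb R^3$. Let $\mathfrak m_+$, $\mathfrak m_3$ be the images of $m_+$, $m_\gamma$ on $\mathfrak R_+$, $\mathfrak R^3$, and let $\mathfrak m$ be the measure on $E$ equal to $\mathtt p\,\mathfrak m_+$ on $\mathfrak R_+$ and to $\mathfrak m_3$ on $\mathfrak R^3$. Let $\mathscr F$ be the set of $f\in L^2(E,\mathfrak m)$ such that $f|_{\mathfrak R_+}\in\mathcal F^+$, $f|_{\mathfrak R^3}\in\mathcal F^3$, and the $\mathcal E^+$-quasi-continuous version of $f|_{\mathfrak R_+}$ and the $\mathcal E^3$-quasi-continuous version of $f|_{\mathfrak R^3}$ have the same value at the origin; put $$\mathscr E(f,g)=\mathtt p\,\mathcal E^+(f|_{\mathfrak R_+},g|_{\mathfrak R_+})+\mathcal E^3(f|_{\mathfrak R^3},g|_{\mathfrak R^3}),\qquad f,g\in\mathscr F.$$ The generator of a form $(\mathcal Q,D)$ with dense domain in a Hilbert space is the operator $A$ such that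 $f\in D(A)$ and $Af=h$ if and only if $f\in D$ and $\mathcal Q(f,g)=(-h,g)$ for all $g\in D$. Let $\mathcal A^+$, $\mathcal A^3$, $\mathscr A$ be the generators of $(\mathcal E^+,\mathcal F^+)$, $(\mathcal E^3,\mathcal F^3)$, $(\mathscr E,\mathscr F)$ in $L^2(\mathbb R_+,m_+)$, $L^2(\mathbb R^3,m_\gamma)$, $L^2(E,\mathfrak m)$. Let $\mathscr G$ be the operator on $L^2(E,\mathfrak m)$ with domain $$\mathcal D(\mathscr G)=\{f\in\mathscr F: f|_{\mathfrak R_+}\in\mathcal D(\mathcal A^+),\ f|_{\mathfrak R^3}\in\mathcal D(\mathcal A^3)\},$$ given by $\mathscr Gf|_{\mathfrak R_+}=\mathcal A^+(f|_{\mathfrak R_+})$ and $\mathscr Gf|_{\mathfrak R^3}=\mathcal A^3(f|_{\mathfrak R^3})$. **Proposition.** 1. $\mathscr A$ is a self-adjoint extension of $\mathscr G$ on $L^2(E,\mathfrak m)$, and $\mathscr G$ itself is not self-adjoint. 2. Suppose that $\rho\in L^1(\mathbb R_+)$ and $\gamma>0$. Then $f\in\mathcal D(\mathscr G)$ if and only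 if $f\in\mathcal D(\mathscr A)$ and $\mathfrak m_+(\mathscr Af|_{\mathfrak R_+})=\mathfrak m_3(\mathscr Af|_{\mathfrak R^3})=0$, where $\mathfrak m_+(u)$, $\mathfrak m_3(u)$ denote the integrals of $u$. -/

import Mathlib

open MeasureTheory Topology
open scoped NNReal ENNReal ContDiff

noncomputable section

namespace VaryingDim

/-! ### Symmetric forms on a real Hilbert space and their generators -/

/-- A nonnegative symmetric bilinear form `E`, with a linear domain, on a real Hilbert space. -/
structure SymmForm (H : Type*) [NormedAddCommGroup H] [InnerProductSpace ℝ H] where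
  domain : Submodule ℝ H
  form : domain →ₗ[ℝ] domain →ₗ[ℝ] ℝ
  symm' : ∀ f g, form f g = form g f
  nonneg' : ∀ f, 0 ≤ form f f

namespace SymmForm

variable {H : Type*} [NormedAddCommGroup H] [InnerProductSpace ℝ H]

/-- The graph `{(f, h) : f ∈ D(E) and E(f, g) = (-h, g) for all g ∈ D(E)}`. -/
def generatorGraph (E : SymmForm H) : Submodule ℝ (H × H) where
  carrier := {x | ∃ hx : x.1 ∈ E.domain, ∀ g : E.domain, E.form ⟨x.1, hx⟩ g = -inner ℝ x.2 (g : H)}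
  zero_mem' := by
    refine ⟨E.domain.zero_mem, fun g => ?_⟩
    have h0 : (⟨(0 : H × H).1, E.domain.zero_mem⟩ : E.domain) = 0 := rfl
    rw [h0]
    simp
  add_mem' := by
    rintro ⟨a, b⟩ ⟨c, d⟩ ⟨ha, hab⟩ ⟨hc, hcd⟩
    refine ⟨E.domain.add_mem ha hc, fun g => ?_⟩
    have h0 : (⟨((a, b) + (c, d) : H × H).1, E.domain.add_mem ha hc⟩ : E.domain)
      = ⟨a, ha⟩ + ⟨c, hc⟩ := rfl
    have h1 := hab g
    have h2 := hcd g
    rw [h0, map_add, LinearMap.add_apply]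
    simp only [Prod.snd_add, inner_add_left] at *
    linarith
  smul_mem' := by
    rintro t ⟨a, b⟩ ⟨ha, hab⟩
    refine ⟨E.domain.smul_mem t ha, fun g => ?_⟩
    have h0 : (⟨(t • (a, b) : H × H).1, E.domain.smul_mem t ha⟩ : E.domain) = t • ⟨a, ha⟩ := rfl
    have h1 := hab g
    rw [h0, map_smul, LinearMap.smul_apply]
    simp only [Prod.smul_snd, real_inner_smul_left, smul_eq_mul] at *
    rw [h1]
    ring

/-- The generator `A` of a form `E` (with dense domain): `f ∈ D(A)` and `A f = h` if and only if
`f ∈ D(E)` and `E(f, g) = (-h, g)` for all `g ∈ D(E)`. When `D(E)` is dense, `h` is unique. -/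
def generator (E : SymmForm H) : H →ₗ.[ℝ] H := E.generatorGraph.toLinearPMap

/-- `E₁(u, u) = E(u, u) + (u, u)`. -/
def energyOne (E : SymmForm H) (u : E.domain) : ℝ := E.form u u + ‖(u : H)‖ ^ 2

lemma energyOne_nonneg (E : SymmForm H) (u : E.domain) : 0 ≤ E.energyOne u :=
  add_nonneg (E.nonneg' u) (sq_nonneg _)

lemma energyOne_add_le (E : SymmForm H) (u v : E.domain) :
    E.energyOne (u + v) ≤ 2 * E.energyOne u + 2 * E.energyOne v := by
  have h1 := E.energyOne_nonneg (u - v)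
  have h2 : E.energyOne (u + v) + E.energyOne (u - v)
      = 2 * E.energyOne u + 2 * E.energyOne v := by
    have h3 := parallelogram_law_with_norm ℝ (u : H) (v : H)
    simp only [energyOne, map_add, map_sub, LinearMap.add_apply, LinearMap.sub_apply,
      Submodule.coe_add, Submodule.coe_sub]
    nlinarith [h3]
  linarith

end SymmForm

/-! ### Capacity and quasi-continuity relative to a form on `L²(X, μ)` -/

section Capacity

variable {X : Type*} [MeasurableSpace X] {μ : Measure X}

/-- The `1`-capacity of an open set `U`: the infimum of `E₁(u, u)` over the nonnegative `u ∈ D(E)`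
with `u ≥ 1` a.e. on `U`. (For a Dirichlet form, the restriction to nonnegative `u` does not change
the infimum, as `E₁` decreases under `u ↦ u⁺`.) -/
def openCapacity (E : SymmForm (Lp ℝ 2 μ)) (U : Set X) : ℝ≥0∞ :=
  ⨅ (u : E.domain) (_ : ∀ᵐ x ∂μ, 0 ≤ (u : Lp ℝ 2 μ) x)
    (_ : ∀ᵐ x ∂μ, x ∈ U → 1 ≤ (u : Lp ℝ 2 μ) x), ENNReal.ofReal (E.energyOne u)

lemma exists_of_openCapacity_lt {E : SymmForm (Lp ℝ 2 μ)} {U : Set X} {ε : ℝ≥0∞}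
    (h : openCapacity E U < ε) :
    ∃ u : E.domain, (∀ᵐ x ∂μ, 0 ≤ (u : Lp ℝ 2 μ) x) ∧
      (∀ᵐ x ∂μ, x ∈ U → 1 ≤ (u : Lp ℝ 2 μ) x) ∧ ENNReal.ofReal (E.energyOne u) < ε := by
  simp only [openCapacity, iInf_lt_iff] at h
  obtain ⟨u, h0, h1, h2⟩ := h
  exact ⟨u, h0, h1, h2⟩

lemma openCapacity_le {E : SymmForm (Lp ℝ 2 μ)} {U : Set X} (u : E.domain)
    (h0 : ∀ᵐ x ∂μ, 0 ≤ (u : Lp ℝ 2 μ) x) (h1 : ∀ᵐ x ∂μ, x ∈ U → 1 ≤ (u : Lp ℝ 2 μ) x) :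
    openCapacity E U ≤ ENNReal.ofReal (E.energyOne u) :=
  iInf_le_of_le u (iInf_le_of_le h0 (iInf_le _ h1))

variable [TopologicalSpace X]

/-- `f` is `E`-quasi-continuous: it is continuous off open sets of arbitrarily small capacity. -/
def QuasiContinuous (E : SymmForm (Lp ℝ 2 μ)) (f : X → ℝ) : Prop :=
  ∀ ε : ℝ≥0∞, 0 < ε → ∃ G : Set X, IsOpen G ∧ openCapacity E G < ε ∧ ContinuousOn f Gᶜ

/-- The real number `a` is the value at the point `x₀` of an `E`-quasi-continuous version of `f`.
(If `{x₀}` has positive capacity, there is at most one such `a`.) -/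
def IsQuasiValue (E : SymmForm (Lp ℝ 2 μ)) (f : Lp ℝ 2 μ) (x₀ : X) (a : ℝ) : Prop :=
  ∃ u : X → ℝ, QuasiContinuous E u ∧ u =ᵐ[μ] f ∧ u x₀ = a

lemma QuasiContinuous.of_continuous (E : SymmForm (Lp ℝ 2 μ)) {f : X → ℝ} (hf : Continuous f) :
    QuasiContinuous E f := by
  intro ε hε
  refine ⟨∅, isOpen_empty, lt_of_le_of_lt (openCapacity_le 0 ?_ (by simp)) ?_, hf.continuousOn⟩
  · have h : ((0 : E.domain) : Lp ℝ 2 μ) =ᵐ[μ] 0 := Lp.coeFn_zero ℝ 2 μ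
    filter_upwards [h] with x hx
    exact hx.symm.le
  · simpa [SymmForm.energyOne] using hε

lemma QuasiContinuous.add {E : SymmForm (Lp ℝ 2 μ)} {f g : X → ℝ}
    (hf : QuasiContinuous E f) (hg : QuasiContinuous E g) : QuasiContinuous E (f + g) := by
  intro ε hε
  have h2 : (2 * 2 : ℝ≥0∞) ≠ ⊤ := by norm_num
  have hε' : 0 < ε / (2 * 2) := ENNReal.div_pos hε.ne' h2
  obtain ⟨G, hG, hGc, hGf⟩ := hf _ hε'
  obtain ⟨K, hK, hKc, hKg⟩ := hg _ hε'
  obtain ⟨u, hu0, hu1, hu2⟩ := exists_of_openCapacity_lt hGc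
  obtain ⟨v, hv0, hv1, hv2⟩ := exists_of_openCapacity_lt hKc
  refine ⟨G ∪ K, hG.union hK, ?_, ?_⟩
  · have hadd : ((u + v : E.domain) : Lp ℝ 2 μ) =ᵐ[μ] (u : Lp ℝ 2 μ) + (v : Lp ℝ 2 μ) :=
      Lp.coeFn_add (u : Lp ℝ 2 μ) (v : Lp ℝ 2 μ)
    refine lt_of_le_of_lt (openCapacity_le (u + v) ?_ ?_) ?_
    · filter_upwards [hadd, hu0, hv0] with x hx h0 h0'
      rw [hx]
      exact add_nonneg h0 h0'
    · filter_upwards [hadd, hu0, hv0, hu1, hv1] with x hx h0 h0' h1 h1'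
      rintro (hxG | hxK)
      · rw [hx, Pi.add_apply]
        linarith [h1 hxG]
      · rw [hx, Pi.add_apply]
        linarith [h1' hxK]
    · calc ENNReal.ofReal (E.energyOne (u + v))
          ≤ ENNReal.ofReal (2 * E.energyOne u + 2 * E.energyOne v) :=
            ENNReal.ofReal_le_ofReal (E.energyOne_add_le u v)
        _ = 2 * ENNReal.ofReal (E.energyOne u) + 2 * ENNReal.ofReal (E.energyOne v) := by
            have hu := E.energyOne_nonneg u
            have hv := E.energyOne_nonneg v
            rw [ENNReal.ofReal_add (by positivity) (by positivity),
              ENNReal.ofReal_mul (by norm_num), ENNReal.ofReal_mul (by norm_num)]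
            simp
        _ < 2 * (ε / (2 * 2)) + 2 * (ε / (2 * 2)) := by
            apply ENNReal.add_lt_add <;>
            exact ENNReal.mul_lt_mul_right (by norm_num) (by norm_num) (by assumption)
        _ = ε := by
            rw [← two_mul, ← mul_assoc, ENNReal.mul_div_cancel (by norm_num) h2]
  · rw [Set.compl_union]
    exact (hGf.mono Set.inter_subset_left).add (hKg.mono Set.inter_subset_right)

lemma QuasiContinuous.const_smul {E : SymmForm (Lp ℝ 2 μ)} {f : X → ℝ}
    (hf : QuasiContinuous E f) (c : ℝ) : QuasiContinuous E (c • f) := by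
  intro ε hε
  obtain ⟨G, hG, hGc, hGf⟩ := hf ε hε
  exact ⟨G, hG, hGc, hGf.const_smul c⟩

lemma IsQuasiValue.zero (E : SymmForm (Lp ℝ 2 μ)) (x₀ : X) : IsQuasiValue E 0 x₀ 0 :=
  ⟨0, .of_continuous E continuous_zero, (Lp.coeFn_zero ℝ 2 μ).symm, rfl⟩

lemma IsQuasiValue.add {E : SymmForm (Lp ℝ 2 μ)} {f g : Lp ℝ 2 μ} {x₀ : X} {a b : ℝ}
    (hf : IsQuasiValue E f x₀ a) (hg : IsQuasiValue E g x₀ b) :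
    IsQuasiValue E (f + g) x₀ (a + b) := by
  obtain ⟨u, hu, huf, rfl⟩ := hf
  obtain ⟨v, hv, hvg, rfl⟩ := hg
  exact ⟨u + v, hu.add hv, (huf.add hvg).trans (Lp.coeFn_add f g).symm, rfl⟩

lemma IsQuasiValue.const_smul {E : SymmForm (Lp ℝ 2 μ)} {f : Lp ℝ 2 μ} {x₀ : X} {a : ℝ}
    (hf : IsQuasiValue E f x₀ a) (c : ℝ) : IsQuasiValue E (c • f) x₀ (c * a) := by
  obtain ⟨u, hu, huf, rfl⟩ := hf
  exact ⟨c • u, hu.const_smul c, (huf.const_smul c).trans (Lp.coeFn_smul c f).symm, rfl⟩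

end Capacity

/-- If `w > 0` a.e. and `1 / w` is locally integrable, then `L²(w dμ)` consists of locally
integrable functions. -/
lemma locallyIntegrable_of_memLp_withDensity {X F : Type*} [TopologicalSpace X] [MeasurableSpace X]
    [NormedAddCommGroup F] {μ : Measure X} {w : X → ℝ}
    (hw : AEMeasurable w μ) (hpos : ∀ᵐ x ∂μ, 0 < w x)
    (hinv : LocallyIntegrable (fun x => 1 / w x) μ) {f : X → F}
    (hf : MemLp f 2 (μ.withDensity fun x => ENNReal.ofReal (w x))) : LocallyIntegrable f μ := by
  have hw' : AEMeasurable (fun x => ENNReal.ofReal (w x)) μ := hw.ennreal_ofReal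
  have hac : μ ≪ μ.withDensity fun x => ENNReal.ofReal (w x) := by
    refine withDensity_absolutelyContinuous' hw' ?_
    filter_upwards [hpos] with x hx
    simpa using hx
  have hm : AEStronglyMeasurable f μ := hf.1.mono_ac hac
  have h2 : Integrable (fun x => ‖f x‖ ^ 2) (μ.withDensity fun x => ENNReal.ofReal (w x)) :=
    hf.integrable_norm_pow (by norm_num)
  rw [integrable_withDensity_iff_integrable_smul₀' hw' (by simp)] at h2
  refine (h2.locallyIntegrable.add hinv).mono hm ?_
  filter_upwards [hpos] with x hx
  rw [Pi.add_apply, ENNReal.toReal_ofReal hx.le, smul_eq_mul, Real.norm_eq_abs,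
    abs_of_nonneg (by positivity)]
  have h3 : w x * ‖f x‖ ^ 2 + 1 / w x - 2 * ‖f x‖ = (w x * ‖f x‖ - 1) ^ 2 / w x := by
    field_simp
    ring
  have h4 : 0 ≤ (w x * ‖f x‖ - 1) ^ 2 / w x := by positivity
  have h5 := norm_nonneg (f x)
  linarith

/-! ### The parameters -/

/-- Lebesgue measure on the half-line `ℝ₊ = [0, ∞)`. -/
def halfLineVolume : Measure ℝ≥0 := (volume : Measure ℝ).comap ((↑) : ℝ≥0 → ℝ)

/-- The parameters `γ ∈ ℝ`, `p > 0` and the density `ρ` on `ℝ₊`, with the standing assumptions: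
`ρ > 0` a.e., `ρ` and `1 / ρ` are locally integrable on `[0, ∞)`, and
`∫₀^∞ (1 / ρ(r)) ∫₀^r ρ(s) ds dr = ∞`. -/
structure Params where
  γ : ℝ
  p : ℝ
  ρ : ℝ≥0 → ℝ
  p_pos : 0 < p
  ρ_pos : ∀ᵐ r ∂halfLineVolume, 0 < ρ r
  ρ_loc : LocallyIntegrable ρ halfLineVolume
  inv_ρ_loc : LocallyIntegrable (fun r => 1 / ρ r) halfLineVolume
  conservative : ∫⁻ r, ENNReal.ofReal (1 / ρ r) *
    (∫⁻ s in Set.Iic r, ENNReal.ofReal (ρ s) ∂halfLineVolume) ∂halfLineVolume = ⊤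

abbrev R3 : Type := EuclideanSpace ℝ (Fin 3)

/-- `ψ_γ(x) = e^{-γ|x|} / (2π|x|)` on `ℝ³` (its value at the origin is irrelevant). -/
def psi (γ : ℝ) (x : R3) : ℝ := Real.exp (-γ * ‖x‖) / (2 * Real.pi * ‖x‖)

namespace Params

variable (P : Params)

/-- `m₊(dr) = ρ(r) dr` on `ℝ₊`. -/
def mPlus : Measure ℝ≥0 := halfLineVolume.withDensity fun r => ENNReal.ofReal (P.ρ r)

/-- `m_γ(dx) = ψ_γ(x)² dx` on `ℝ³`. -/
def mThree : Measure R3 := volume.withDensity fun x => ENNReal.ofReal (psi P.γ x ^ 2)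

lemma locallyIntegrable_mPlus {F : Type*} [NormedAddCommGroup F] (f : Lp F 2 P.mPlus) :
    LocallyIntegrable f halfLineVolume :=
  locallyIntegrable_of_memLp_withDensity P.ρ_loc.aestronglyMeasurable.aemeasurable P.ρ_pos
    P.inv_ρ_loc (Lp.memLp f)

lemma ae_halfLine {F : Type*} {f g : ℝ≥0 → F} (h : f =ᵐ[P.mPlus] g) : f =ᵐ[halfLineVolume] g :=
  (withDensity_absolutelyContinuous' P.ρ_loc.aestronglyMeasurable.aemeasurable.ennreal_ofReal
    (by filter_upwards [P.ρ_pos] with x hx; simpa using hx)).ae_eq h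

lemma measurable_psi_sq (γ : ℝ) : Measurable fun x : R3 => psi γ x ^ 2 := by
  unfold psi
  fun_prop

lemma ae_psi_sq_pos (γ : ℝ) : ∀ᵐ x : R3, 0 < psi γ x ^ 2 := by
  have h : ∀ᵐ x : R3, x ≠ 0 := by simp [ae_iff]
  filter_upwards [h] with x hx
  have : 0 < ‖x‖ := norm_pos_iff.2 hx
  unfold psi
  positivity

lemma ae_volume {F : Type*} {f g : R3 → F} (h : f =ᵐ[P.mThree] g) : f =ᵐ[volume] g :=
  (withDensity_absolutelyContinuous' (measurable_psi_sq P.γ).aemeasurable.ennreal_ofReal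
    (by filter_upwards [ae_psi_sq_pos P.γ] with x hx
        exact (ENNReal.ofReal_pos.2 hx).ne')).ae_eq h

lemma locallyIntegrable_mThree {F : Type*} [NormedAddCommGroup F] (f : Lp F 2 P.mThree) :
    LocallyIntegrable f (volume : Measure R3) := by
  refine locallyIntegrable_of_memLp_withDensity (measurable_psi_sq P.γ).aemeasurable
    (ae_psi_sq_pos P.γ) ?_ (Lp.memLp f)
  have h : (fun x : R3 => 1 / psi P.γ x ^ 2)
      = fun x => (Real.exp (P.γ * ‖x‖) * (2 * Real.pi * ‖x‖)) ^ 2 := by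
    ext x
    rw [psi, div_pow, one_div_div, mul_pow, neg_mul, Real.exp_neg, inv_pow, div_inv_eq_mul]
    ring
  rw [h]
  apply Continuous.locallyIntegrable
  fun_prop

/-! ### The form `(𝓔⁺, 𝓕⁺)` on `L²(ℝ₊, m₊)` -/

/-- Pairs `(f, f')` in `L²(ℝ₊, m₊)` such that (a version of) `f` is absolutely continuous on
`[0, ∞)` with derivative `f'`, that is `f(r) = c + ∫₀^r f'(s) ds`. -/
def derivGraph : Submodule ℝ (Lp ℝ 2 P.mPlus × Lp ℝ 2 P.mPlus) where
  carrier := {x | ∃ c : ℝ, ∀ᵐ r ∂P.mPlus, x.1 r = c + ∫ s in Set.Iic r, x.2 s ∂halfLineVolume}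
  zero_mem' := by
    refine ⟨0, ?_⟩
    have h : ((0 : Lp ℝ 2 P.mPlus) : ℝ≥0 → ℝ) =ᵐ[halfLineVolume] 0 :=
      P.ae_halfLine (Lp.coeFn_zero ℝ 2 P.mPlus)
    filter_upwards [Lp.coeFn_zero ℝ 2 P.mPlus] with r hr
    rw [Prod.fst_zero, Prod.snd_zero, hr, integral_congr_ae (ae_restrict_of_ae h)]
    simp
  add_mem' := by
    rintro ⟨f, f'⟩ ⟨g, g'⟩ ⟨c, hc⟩ ⟨d, hd⟩
    refine ⟨c + d, ?_⟩
    have h : ((f' + g' : Lp ℝ 2 P.mPlus) : ℝ≥0 → ℝ) =ᵐ[halfLineVolume] f' + g' :=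
      P.ae_halfLine (Lp.coeFn_add f' g')
    filter_upwards [Lp.coeFn_add f g, hc, hd] with r hr hcr hdr
    have hcomp : IsCompact (Set.Iic r) := by
      rw [← Set.Icc_bot]
      exact isCompact_Icc
    have hi := (P.locallyIntegrable_mPlus f').integrableOn_isCompact hcomp
    have hj := (P.locallyIntegrable_mPlus g').integrableOn_isCompact hcomp
    simp only [Prod.mk_add_mk] at *
    rw [hr, integral_congr_ae (ae_restrict_of_ae h), Pi.add_apply, hcr, hdr]
    simp only [Pi.add_apply]
    rw [integral_add hi hj]
    ring
  smul_mem' := by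
    rintro t ⟨f, f'⟩ ⟨c, hc⟩
    refine ⟨t * c, ?_⟩
    have h : ((t • f' : Lp ℝ 2 P.mPlus) : ℝ≥0 → ℝ) =ᵐ[halfLineVolume] t • f' :=
      P.ae_halfLine (Lp.coeFn_smul t f')
    filter_upwards [Lp.coeFn_smul t f, hc] with r hr hcr
    simp only [Prod.smul_mk] at *
    rw [hr, integral_congr_ae (ae_restrict_of_ae h), Pi.smul_apply, hcr]
    simp only [Pi.smul_apply, smul_eq_mul]
    rw [integral_const_mul]
    ring

/-- The derivative `f ↦ f'` as an operator in `L²(ℝ₊, m₊)`; its domain is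
`𝓕⁺ = {f ∈ L²(ℝ₊, m₊) : f' ∈ L²(ℝ₊, m₊)}`. -/
def derivPlus : Lp ℝ 2 P.mPlus →ₗ.[ℝ] Lp ℝ 2 P.mPlus := P.derivGraph.toLinearPMap

/-- `𝓔⁺(f, g) = ½ ∫ f' g' dm₊` on `𝓕⁺`. -/
def formPlus : SymmForm (Lp ℝ 2 P.mPlus) where
  domain := P.derivPlus.domain
  form := (1 / 2 : ℝ) • (innerₗ (Lp ℝ 2 P.mPlus)).compl₁₂ P.derivPlus.toFun P.derivPlus.toFun
  symm' f g := by simp [real_inner_comm]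
  nonneg' f := by
    simp only [LinearMap.smul_apply, LinearMap.compl₁₂_apply, innerₗ_apply_apply, smul_eq_mul]
    exact mul_nonneg (by norm_num) real_inner_self_nonneg

/-! ### The form `(𝓔³, 𝓕³)` on `L²(ℝ³, m_γ)` -/

lemma integrable_mul_fderiv (f : Lp ℝ 2 P.mThree) {φ : R3 → ℝ} (hφ : ContDiff ℝ ∞ φ)
    (hc : HasCompactSupport φ) (i : Fin 3) :
    Integrable fun y : R3 => f y * fderiv ℝ φ y (EuclideanSpace.single i 1) := by
  have hcont : Continuous fun y : R3 => fderiv ℝ φ y (EuclideanSpace.single i 1) :=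
    (hφ.continuous_fderiv (by simp)).clm_apply continuous_const
  have hsupp : HasCompactSupport fun y : R3 => fderiv ℝ φ y (EuclideanSpace.single i 1) :=
    hc.fderiv_apply ℝ (EuclideanSpace.single i 1)
  simpa [mul_comm] using
    (P.locallyIntegrable_mThree f).integrable_smul_left_of_hasCompactSupport hcont hsupp

lemma integrable_coord_mul (F : Lp R3 2 P.mThree) {φ : R3 → ℝ} (hφ : ContDiff ℝ ∞ φ)
    (hc : HasCompactSupport φ) (i : Fin 3) : Integrable fun y : R3 => F y i * φ y := by
  have h := (P.locallyIntegrable_mThree F).integrable_smul_left_of_hasCompactSupport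
    hφ.continuous hc
  simpa [mul_comm] using (EuclideanSpace.proj (𝕜 := ℝ) i).integrable_comp h

/-- Pairs `(f, ∇f)` with `f` and `∇f` in `L²(ℝ³, m_γ)`, where `∇f` is the weak gradient of `f` on
`ℝ³`, that is `∫ f ∂ᵢφ dx = -∫ (∇f)ᵢ φ dx` for all `φ ∈ C_c^∞(ℝ³)`. -/
def gradGraph : Submodule ℝ (Lp ℝ 2 P.mThree × Lp R3 2 P.mThree) where
  carrier := {x | ∀ φ : R3 → ℝ, ContDiff ℝ ∞ φ → HasCompactSupport φ → ∀ i : Fin 3,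
    ∫ y : R3, x.1 y * fderiv ℝ φ y (EuclideanSpace.single i 1) = -∫ y : R3, x.2 y i * φ y}
  zero_mem' := by
    intro φ _ _ i
    have h1 := P.ae_volume (Lp.coeFn_zero ℝ 2 P.mThree)
    have h2 := P.ae_volume (Lp.coeFn_zero R3 2 P.mThree)
    rw [Prod.fst_zero, Prod.snd_zero, integral_eq_zero_of_ae, integral_eq_zero_of_ae, neg_zero]
    · filter_upwards [h2] with y hy
      rw [hy, Pi.zero_apply, PiLp.zero_apply, zero_mul, Pi.zero_apply]
    · filter_upwards [h1] with y hy
      rw [hy, Pi.zero_apply, zero_mul]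
  add_mem' := by
    rintro ⟨f, F⟩ ⟨g, G⟩ hf hg φ hφ hc i
    have h1 := P.ae_volume (Lp.coeFn_add f g)
    have h2 := P.ae_volume (Lp.coeFn_add F G)
    have e1 : ∫ y : R3, (f + g : Lp ℝ 2 P.mThree) y * fderiv ℝ φ y (EuclideanSpace.single i 1)
        = (∫ y : R3, f y * fderiv ℝ φ y (EuclideanSpace.single i 1))
          + ∫ y : R3, g y * fderiv ℝ φ y (EuclideanSpace.single i 1) := by
      rw [← integral_add (P.integrable_mul_fderiv f hφ hc i) (P.integrable_mul_fderiv g hφ hc i)]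
      refine integral_congr_ae ?_
      filter_upwards [h1] with y hy
      rw [hy, Pi.add_apply, add_mul]
    have e2 : ∫ y : R3, (F + G : Lp R3 2 P.mThree) y i * φ y
        = (∫ y : R3, F y i * φ y) + ∫ y : R3, G y i * φ y := by
      rw [← integral_add (P.integrable_coord_mul F hφ hc i) (P.integrable_coord_mul G hφ hc i)]
      refine integral_congr_ae ?_
      filter_upwards [h2] with y hy
      rw [hy, Pi.add_apply, PiLp.add_apply, add_mul]
    have h3 := hf φ hφ hc i
    have h4 := hg φ hφ hc i
    simp only [Prod.mk_add_mk] at *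
    rw [e1, e2, h3, h4]
    ring
  smul_mem' := by
    rintro t ⟨f, F⟩ hf φ hφ hc i
    have h1 := P.ae_volume (Lp.coeFn_smul t f)
    have h2 := P.ae_volume (Lp.coeFn_smul t F)
    have e1 : ∫ y : R3, (t • f : Lp ℝ 2 P.mThree) y * fderiv ℝ φ y (EuclideanSpace.single i 1)
        = t * ∫ y : R3, f y * fderiv ℝ φ y (EuclideanSpace.single i 1) := by
      rw [← integral_const_mul]
      refine integral_congr_ae ?_
      filter_upwards [h1] with y hy
      rw [hy, Pi.smul_apply, smul_eq_mul, mul_assoc]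
    have e2 : ∫ y : R3, (t • F : Lp R3 2 P.mThree) y i * φ y = t * ∫ y : R3, F y i * φ y := by
      rw [← integral_const_mul]
      refine integral_congr_ae ?_
      filter_upwards [h2] with y hy
      rw [hy, Pi.smul_apply, PiLp.smul_apply, smul_eq_mul, mul_assoc]
    have h3 := hf φ hφ hc i
    simp only [Prod.smul_mk] at *
    rw [e1, e2, h3]
    ring

/-- The weak gradient as an operator from `L²(ℝ³, m_γ)` to `L²(ℝ³, m_γ; ℝ³)`; its domain is
`𝓕³ = {f ∈ L²(ℝ³, m_γ) : ∇f ∈ L²(ℝ³, m_γ)}`. -/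
def grad : Lp ℝ 2 P.mThree →ₗ.[ℝ] Lp R3 2 P.mThree := P.gradGraph.toLinearPMap

/-- `𝓔³(f, g) = ½ ∫ ∇f · ∇g dm_γ` on `𝓕³`. -/
def formThree : SymmForm (Lp ℝ 2 P.mThree) where
  domain := P.grad.domain
  form := (1 / 2 : ℝ) • (innerₗ (Lp R3 2 P.mThree)).compl₁₂ P.grad.toFun P.grad.toFun
  symm' f g := by simp [real_inner_comm]
  nonneg' f := by
    simp only [LinearMap.smul_apply, LinearMap.compl₁₂_apply, innerₗ_apply_apply, smul_eq_mul]
    exact mul_nonneg (by norm_num) real_inner_self_nonneg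

/-! ### The space `E = ℝ₊ ∪ ℝ³` and the measure `𝔪` -/

end Params

/-- The linear map `f ↦ f ∘ ι` from `L²(X, μ)` to `L²(Y, ν)`, for a map `ι : Y → X` that allows
it. -/
def compLp {X Y : Type*} [MeasurableSpace X] [MeasurableSpace Y] {μ : Measure X} {ν : Measure Y}
    (ι : Y → X) (hmem : ∀ {f : X → ℝ}, MemLp f 2 μ → MemLp (f ∘ ι) 2 ν)
    (hae : ∀ {f g : X → ℝ}, f =ᵐ[μ] g → f ∘ ι =ᵐ[ν] g ∘ ι) : Lp ℝ 2 μ →ₗ[ℝ] Lp ℝ 2 ν where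
  toFun f := (hmem (Lp.memLp f)).toLp (f ∘ ι)
  map_add' f g := by
    apply Lp.ext
    filter_upwards [(hmem (Lp.memLp (f + g))).coeFn_toLp, hae (Lp.coeFn_add f g),
      Lp.coeFn_add ((hmem (Lp.memLp f)).toLp (f ∘ ι)) ((hmem (Lp.memLp g)).toLp (g ∘ ι)),
      (hmem (Lp.memLp f)).coeFn_toLp, (hmem (Lp.memLp g)).coeFn_toLp] with y h1 h2 h3 h4 h5
    rw [h1, h2, h3, Pi.add_apply, h4, h5]
    rfl
  map_smul' c f := by
    apply Lp.ext
    filter_upwards [(hmem (Lp.memLp (c • f))).coeFn_toLp, hae (Lp.coeFn_smul c f),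
      Lp.coeFn_smul c ((hmem (Lp.memLp f)).toLp (f ∘ ι)),
      (hmem (Lp.memLp f)).coeFn_toLp] with y h1 h2 h3 h4
    rw [h1, h2, RingHom.id_apply, h3, Pi.smul_apply, h4]
    rfl

/-- `E = {(0, 0, 0, r) : r ≥ 0} ∪ {(x₁, x₂, x₃, 0)} ⊆ ℝ⁴`. -/
abbrev Space : Type :=
  {x : EuclideanSpace ℝ (Fin 4) // (x 0 = 0 ∧ x 1 = 0 ∧ x 2 = 0 ∧ 0 ≤ x 3) ∨ x 3 = 0}

/-- `ι₊ : ℝ₊ → E`, `r ↦ (0, 0, 0, r)`. -/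
def iotaPlus (r : ℝ≥0) : Space := ⟨!₂[0, 0, 0, (r : ℝ)], Or.inl (by simp)⟩

/-- `ι₃ : ℝ³ → E`, `(x₁, x₂, x₃) ↦ (x₁, x₂, x₃, 0)`. -/
def iotaThree (x : R3) : Space := ⟨!₂[x 0, x 1, x 2, 0], Or.inr (by simp)⟩

lemma measurable_iotaPlus : Measurable iotaPlus := by
  have h : Continuous iotaPlus := by
    unfold iotaPlus
    refine Continuous.subtype_mk ((PiLp.continuous_toLp 2 _).comp (continuous_pi fun i => ?_)) _
    fin_cases i <;> simp <;> fun_prop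
  exact h.measurable

lemma measurable_iotaThree : Measurable iotaThree := by
  have h : Continuous iotaThree := by
    unfold iotaThree
    refine Continuous.subtype_mk ((PiLp.continuous_toLp 2 _).comp (continuous_pi fun i => ?_)) _
    fin_cases i <;> simp <;> fun_prop
  exact h.measurable

namespace Params

variable (P : Params)

/-- The measure `𝔪` on `E`, equal to `p · m₊ ∘ ι₊⁻¹` on `ℝ₊` and to `m_γ ∘ ι₃⁻¹` on `ℝ³`. -/
def m : Measure Space :=
  ENNReal.ofReal P.p • P.mPlus.map iotaPlus + P.mThree.map iotaThree

lemma map_mPlus_le : P.mPlus.map iotaPlus ≤ ENNReal.ofReal (1 / P.p) • P.m := by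
  have hp := P.p_pos
  have h : ENNReal.ofReal (1 / P.p) • (ENNReal.ofReal P.p • P.mPlus.map iotaPlus)
      = P.mPlus.map iotaPlus := by
    rw [smul_smul, ← ENNReal.ofReal_mul (by positivity), one_div_mul_cancel hp.ne',
      ENNReal.ofReal_one, one_smul]
  calc P.mPlus.map iotaPlus
      = ENNReal.ofReal (1 / P.p) • (ENNReal.ofReal P.p • P.mPlus.map iotaPlus) := h.symm
    _ ≤ ENNReal.ofReal (1 / P.p) • P.m := by
      rw [m, smul_add]
      exact Measure.le_add_right le_rfl

lemma map_mThree_le : P.mThree.map iotaThree ≤ P.m := Measure.le_add_left le_rfl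

lemma memLp_comp_iotaPlus {f : Space → ℝ} (hf : MemLp f 2 P.m) :
    MemLp (f ∘ iotaPlus) 2 P.mPlus :=
  (hf.of_measure_le_smul ENNReal.ofReal_ne_top P.map_mPlus_le).comp_measurePreserving
    ⟨measurable_iotaPlus, rfl⟩

lemma memLp_comp_iotaThree {f : Space → ℝ} (hf : MemLp f 2 P.m) :
    MemLp (f ∘ iotaThree) 2 P.mThree :=
  (hf.mono_measure P.map_mThree_le).comp_measurePreserving ⟨measurable_iotaThree, rfl⟩

lemma ae_comp_iotaPlus {f g : Space → ℝ} (h : f =ᵐ[P.m] g) :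
    f ∘ iotaPlus =ᵐ[P.mPlus] g ∘ iotaPlus :=
  ae_of_ae_map measurable_iotaPlus.aemeasurable
    ((P.map_mPlus_le.absolutelyContinuous.trans
      (Measure.AbsolutelyContinuous.rfl.smul_left _)).ae_eq h)

lemma ae_comp_iotaThree {f g : Space → ℝ} (h : f =ᵐ[P.m] g) :
    f ∘ iotaThree =ᵐ[P.mThree] g ∘ iotaThree :=
  ae_of_ae_map measurable_iotaThree.aemeasurable (P.map_mThree_le.absolutelyContinuous.ae_eq h)

/-- The restriction of `f ∈ L²(E, 𝔪)` to the half-line, as the element `f ∘ ι₊` of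
`L²(ℝ₊, m₊)`. -/
def resPlus : Lp ℝ 2 P.m →ₗ[ℝ] Lp ℝ 2 P.mPlus :=
  compLp iotaPlus P.memLp_comp_iotaPlus P.ae_comp_iotaPlus

/-- The restriction of `f ∈ L²(E, 𝔪)` to `ℝ³`, as the element `f ∘ ι₃` of `L²(ℝ³, m_γ)`. -/
def resThree : Lp ℝ 2 P.m →ₗ[ℝ] Lp ℝ 2 P.mThree :=
  compLp iotaThree P.memLp_comp_iotaThree P.ae_comp_iotaThree

/-! ### The form `(𝓔, 𝓕)` on `L²(E, 𝔪)` and the operators `𝒜` and `𝒢` -/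

/-- `𝓕`: the `f ∈ L²(E, 𝔪)` with `f|_{ℝ₊} ∈ 𝓕⁺` and `f|_{ℝ³} ∈ 𝓕³` whose quasi-continuous versions
(relative to `𝓔⁺` and to `𝓔³`) take the same value at the origin. -/
def domainE : Submodule ℝ (Lp ℝ 2 P.m) where
  carrier := {f | P.resPlus f ∈ P.formPlus.domain ∧ P.resThree f ∈ P.formThree.domain ∧
    ∃ a : ℝ, IsQuasiValue P.formPlus (P.resPlus f) 0 a ∧
      IsQuasiValue P.formThree (P.resThree f) 0 a}
  zero_mem' := by
    refine ⟨?_, ?_, 0, ?_, ?_⟩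
    · rw [map_zero]; exact Submodule.zero_mem _
    · rw [map_zero]; exact Submodule.zero_mem _
    · rw [map_zero]; exact .zero _ _
    · rw [map_zero]; exact .zero _ _
  add_mem' := by
    rintro f g ⟨hf, hf', a, ha, ha'⟩ ⟨hg, hg', b, hb, hb'⟩
    refine ⟨?_, ?_, a + b, ?_, ?_⟩
    · rw [map_add]; exact Submodule.add_mem _ hf hg
    · rw [map_add]; exact Submodule.add_mem _ hf' hg'
    · rw [map_add]; exact ha.add hb
    · rw [map_add]; exact ha'.add hb'
  smul_mem' := by
    rintro c f ⟨hf, hf', a, ha, ha'⟩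
    refine ⟨?_, ?_, c * a, ?_, ?_⟩
    · rw [map_smul]; exact Submodule.smul_mem _ c hf
    · rw [map_smul]; exact Submodule.smul_mem _ c hf'
    · rw [map_smul]; exact ha.const_smul c
    · rw [map_smul]; exact ha'.const_smul c

/-- The restriction map `𝓕 → 𝓕⁺`. -/
def resPlusF : P.domainE →ₗ[ℝ] P.formPlus.domain :=
  P.resPlus.restrict fun _ hf => hf.1

/-- The restriction map `𝓕 → 𝓕³`. -/
def resThreeF : P.domainE →ₗ[ℝ] P.formThree.domain :=
  P.resThree.restrict fun _ hf => hf.2.1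

/-- `𝓔(f, g) = p 𝓔⁺(f|_{ℝ₊}, g|_{ℝ₊}) + 𝓔³(f|_{ℝ³}, g|_{ℝ³})` on `𝓕`. -/
def formE : SymmForm (Lp ℝ 2 P.m) where
  domain := P.domainE
  form := P.p • P.formPlus.form.compl₁₂ P.resPlusF P.resPlusF
    + P.formThree.form.compl₁₂ P.resThreeF P.resThreeF
  symm' f g := by
    simp only [LinearMap.add_apply, LinearMap.smul_apply, LinearMap.compl₁₂_apply]
    rw [P.formPlus.symm', P.formThree.symm']
  nonneg' f := by
    simp only [LinearMap.add_apply, LinearMap.smul_apply, LinearMap.compl₁₂_apply, smul_eq_mul]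
    exact add_nonneg (mul_nonneg P.p_pos.le (P.formPlus.nonneg' _)) (P.formThree.nonneg' _)

/-- `𝒜⁺`, the generator of `(𝓔⁺, 𝓕⁺)`. -/
def opPlus : Lp ℝ 2 P.mPlus →ₗ.[ℝ] Lp ℝ 2 P.mPlus := P.formPlus.generator

/-- `𝒜³`, the generator of `(𝓔³, 𝓕³)`. -/
def opThree : Lp ℝ 2 P.mThree →ₗ.[ℝ] Lp ℝ 2 P.mThree := P.formThree.generator

/-- `𝒜`, the generator of `(𝓔, 𝓕)`. -/
def opA : Lp ℝ 2 P.m →ₗ.[ℝ] Lp ℝ 2 P.m := P.formE.generator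

/-- `𝒢`: its domain is `{f ∈ 𝓕 : f|_{ℝ₊} ∈ D(𝒜⁺), f|_{ℝ³} ∈ D(𝒜³)}`, and `𝒢 f` is the element `h`
of `L²(E, 𝔪)` with `h|_{ℝ₊} = 𝒜⁺(f|_{ℝ₊})` and `h|_{ℝ³} = 𝒜³(f|_{ℝ³})`. -/
def opG : Lp ℝ 2 P.m →ₗ.[ℝ] Lp ℝ 2 P.m :=
  Submodule.toLinearPMap
    (P.formE.domain.comap (LinearMap.fst ℝ _ _) ⊓
      P.opPlus.graph.comap (P.resPlus.prodMap P.resPlus) ⊓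
      P.opThree.graph.comap (P.resThree.prodMap P.resThree))

end Params

end VaryingDim

end

/-! Both branches are governed by closed, densely defined forms for which evaluation at the origin
is a bounded functional of the energy `E₁`. The matching condition at the origin is therefore
closed, `𝓕` is complete for `𝓔₁`, and the generator `𝒜` is self-adjoint: the Riesz representation
theorem solves `(1 - 𝒜) f = h` for every `h`, and a symmetric operator with this property has no
larger adjoint (`isSelfAdjoint_generator`).

On the half-line the bound on evaluation comes from `f(0) = f(r) - ∫₀^r f'` and the local
integrability of `1 / ρ`. On `ℝ³` the weight `ψ_γ²` is comparable near the origin to `1 / |x|²` and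
cancels the Jacobian `t²` of polar coordinates, so each ray behaves like a half-line with bounded
density; averaging over the sphere bounds `φ(0)` for `C¹` functions (`exists_sq_apply_zero_le`). The
bound extends to `𝓕³` by mollification, which is uniformly bounded on `L²(m_γ)` because `1 / |x|²`
is a Muckenhoupt `A₁` weight. A capacitary weak type inequality for `C¹` functions turns limits in
energy into quasi-continuous versions (`isQuasiValue_of_tendsto`), so the limit of the mollified
values is the quasi-continuous value at the origin (`exists_tendsto_mollify_zero`).

Adding the defining identities of `𝒜⁺` and `𝒜³`, the first weighted by `p`, gives `𝒢 ⊆ 𝒜`. If `𝒢`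
were self-adjoint, it would equal `𝒜`. Let `v ∈ 𝓕⁺` represent evaluation at the origin for `𝓔⁺₁`,
and solve `(1 - 𝒜) f = h` with `h` equal to `v` on the half-line and to `0` on `ℝ³`. If `f ∈ D(𝒢)`,
then `f` vanishes on `ℝ³`, so its common value at the origin is `0`; pairing with `v` gives `‖v‖² =
0`, although evaluation is not the zero functional.

When both measures are finite, constants lie in both form domains and have zero energy. Testing `𝒢
f` against constants on each branch shows that both integrals vanish. Conversely, any `g ∈ 𝓕⁺`
extends to an element of `𝓕` by the constant `g(0)` on `ℝ³`; if the integral of `𝒜 f` over `ℝ³` is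
zero, the constant contributes nothing and the identity for `𝓔` reduces to that for `𝓔⁺`. The same
works with the branches exchanged. -/

noncomputable section

namespace VaryingDim

open Filter

/-! ### Closed forms and their generators -/

namespace SymmForm

variable {H : Type*} [NormedAddCommGroup H] [InnerProductSpace ℝ H]

/-- The domain of a form `E`, to be equipped with the inner product `E₁`. -/
def EnergySpace (E : SymmForm H) : Type _ := E.domain

instance (E : SymmForm H) : AddCommGroup E.EnergySpace := inferInstanceAs (AddCommGroup E.domain)

instance (E : SymmForm H) : Module ℝ E.EnergySpace := inferInstanceAs (Module ℝ E.domain)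

/-- The identity map from the domain of `E` to its energy space. -/
def toEnergy (E : SymmForm H) : E.domain ≃ₗ[ℝ] E.EnergySpace := LinearEquiv.refl ℝ E.domain

lemma energyOne_eq (E : SymmForm H) (u : E.domain) :
    E.energyOne u = E.form u u + inner ℝ (u : H) (u : H) := by
  rw [energyOne, real_inner_self_eq_norm_sq]

/-- The inner product `E₁(u, v) = E(u, v) + (u, v)`. -/
@[reducible] def energyCore (E : SymmForm H) : InnerProductSpace.Core ℝ E.EnergySpace where
  inner u v := E.form (E.toEnergy.symm u) (E.toEnergy.symm v)
    + inner ℝ (E.toEnergy.symm u : H) (E.toEnergy.symm v : H)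
  conj_inner_symm u v := by
    simp only [conj_trivial]
    rw [E.symm', real_inner_comm]
  re_inner_nonneg u := by
    simp only [RCLike.re_to_real]
    exact add_nonneg (E.nonneg' _) real_inner_self_nonneg
  add_left u v w := by
    simp only [map_add, LinearMap.add_apply, Submodule.coe_add, inner_add_left]
    ring
  smul_left u v c := by
    simp only [map_smul, LinearMap.smul_apply, Submodule.coe_smul, real_inner_smul_left,
      smul_eq_mul, conj_trivial]
    ring
  definite u hu := by
    have h1 := E.nonneg' (E.toEnergy.symm u)
    have h2 : 0 ≤ inner ℝ (E.toEnergy.symm u : H) (E.toEnergy.symm u : H) :=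
      real_inner_self_nonneg
    have h3 : inner ℝ (E.toEnergy.symm u : H) (E.toEnergy.symm u : H) = 0 := by linarith
    have h4 : E.toEnergy.symm u = 0 := Subtype.ext (inner_self_eq_zero.1 h3)
    simpa using h4

instance (E : SymmForm H) : NormedAddCommGroup E.EnergySpace := E.energyCore.toNormedAddCommGroup

instance (E : SymmForm H) : InnerProductSpace ℝ E.EnergySpace :=
  InnerProductSpace.ofCore E.energyCore.toCore

lemma inner_toEnergy (E : SymmForm H) (u v : E.domain) :
    inner ℝ (E.toEnergy u) (E.toEnergy v) = E.form u v + inner ℝ (u : H) (v : H) := rfl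

lemma norm_toEnergy_sq (E : SymmForm H) (u : E.domain) :
    ‖E.toEnergy u‖ ^ 2 = E.energyOne u := by
  rw [← real_inner_self_eq_norm_sq, inner_toEnergy, energyOne_eq]

lemma norm_sq_le_energyOne (E : SymmForm H) (u : E.domain) : ‖(u : H)‖ ^ 2 ≤ E.energyOne u :=
  le_add_of_nonneg_left (E.nonneg' u)

lemma form_le_energyOne (E : SymmForm H) (u : E.domain) : E.form u u ≤ E.energyOne u :=
  le_add_of_nonneg_right (sq_nonneg _)

lemma norm_le_norm_toEnergy (E : SymmForm H) (u : E.domain) : ‖(u : H)‖ ≤ ‖E.toEnergy u‖ := by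
  refine le_of_sq_le_sq ?_ (norm_nonneg _)
  rw [norm_toEnergy_sq]
  exact E.norm_sq_le_energyOne u

/-- A linear map on the domain of `E` which is bounded relative to `E₁`, as a continuous map. -/
def boundedMap (E : SymmForm H) {K : Type*} [NormedAddCommGroup K] [NormedSpace ℝ K]
    (L : E.domain →ₗ[ℝ] K) (C : ℝ) (hL : ∀ u, ‖L u‖ ^ 2 ≤ C * E.energyOne u) :
    E.EnergySpace →L[ℝ] K :=
  (L ∘ₗ E.toEnergy.symm.toLinearMap).mkContinuous (Real.sqrt C) fun u => by
    obtain ⟨u, rfl⟩ := E.toEnergy.surjective u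
    simp only [LinearMap.comp_apply, LinearEquiv.coe_coe, LinearEquiv.symm_apply_apply]
    have h := Real.sqrt_le_sqrt (hL u)
    rw [Real.sqrt_sq (norm_nonneg _)] at h
    rw [← norm_toEnergy_sq] at h
    rwa [Real.sqrt_mul' _ (sq_nonneg _), Real.sqrt_sq (norm_nonneg _)] at h

@[simp]
lemma boundedMap_apply (E : SymmForm H) {K : Type*} [NormedAddCommGroup K] [NormedSpace ℝ K]
    (L : E.domain →ₗ[ℝ] K) (C : ℝ) (hL : ∀ u, ‖L u‖ ^ 2 ≤ C * E.energyOne u) (u : E.domain) :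
    E.boundedMap L C hL (E.toEnergy u) = L u := rfl

lemma tendsto_toEnergy_iff (E : SymmForm H) {u : ℕ → E.domain} {v : E.domain} :
    Tendsto (fun n => E.toEnergy (u n)) atTop (𝓝 (E.toEnergy v)) ↔
      Tendsto (fun n => E.energyOne (u n - v)) atTop (𝓝 0) := by
  rw [tendsto_iff_norm_sub_tendsto_zero]
  have h : ∀ n, E.energyOne (u n - v) = ‖E.toEnergy (u n) - E.toEnergy v‖ ^ 2 := fun n => by
    rw [← map_sub, norm_toEnergy_sq]
  simp_rw [h]
  constructor
  · intro h
    simpa using h.pow 2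
  · intro h
    simpa using h.sqrt

/-- A form `c ‖D u‖²` is closed if the operator `D` is closed. -/
lemma completeSpace_of_closed [CompleteSpace H] {K : Type*} [NormedAddCommGroup K]
    [NormedSpace ℝ K] [CompleteSpace K] (E : SymmForm H) (D : E.domain →ₗ[ℝ] K) {c : ℝ}
    (hc : 0 < c) (hform : ∀ u, E.form u u = c * ‖D u‖ ^ 2)
    (hclosed : ∀ (u : ℕ → E.domain) (f : H) (g : K), Tendsto (fun n => (u n : H)) atTop (𝓝 f) →
      Tendsto (fun n => D (u n)) atTop (𝓝 g) → ∃ h : f ∈ E.domain, D ⟨f, h⟩ = g) :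
    CompleteSpace E.EnergySpace := by
  have hD : ∀ u, ‖D u‖ ^ 2 ≤ c⁻¹ * E.energyOne u := fun u => by
    rw [← div_eq_inv_mul, le_div_iff₀ hc, mul_comm, ← hform]
    exact E.form_le_energyOne u
  have hI : ∀ u, ‖E.domain.subtype u‖ ^ 2 ≤ 1 * E.energyOne u := fun u => by
    rw [one_mul]
    exact E.norm_sq_le_energyOne u
  refine Metric.complete_of_cauchySeq_tendsto fun u hu => ?_
  obtain ⟨v, rfl⟩ : ∃ v : ℕ → E.domain, u = fun n => E.toEnergy (v n) :=
    ⟨fun n => E.toEnergy.symm (u n), by simp⟩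
  -- A sequence that is Cauchy for `E₁` is Cauchy in `H`, and so are its images under `D`;
  -- closedness of `D` ties the two limits together.
  obtain ⟨f, hf⟩ := cauchySeq_tendsto_of_complete
    ((E.boundedMap E.domain.subtype 1 hI).uniformContinuous.comp_cauchySeq hu)
  obtain ⟨g, hg⟩ := cauchySeq_tendsto_of_complete
    ((E.boundedMap D c⁻¹ hD).uniformContinuous.comp_cauchySeq hu)
  simp only [Function.comp_def, boundedMap_apply, Submodule.subtype_apply] at hf hg
  obtain ⟨hfE, rfl⟩ := hclosed v f g hf hg
  refine ⟨E.toEnergy ⟨f, hfE⟩, E.tendsto_toEnergy_iff.2 ?_⟩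
  have h1 := ((tendsto_iff_norm_sub_tendsto_zero.1 hg).pow 2).const_mul c
  have h2 := (tendsto_iff_norm_sub_tendsto_zero.1 hf).pow 2
  have h3 : ∀ n, E.energyOne (v n - ⟨f, hfE⟩)
      = c * ‖D (v n) - D ⟨f, hfE⟩‖ ^ 2 + ‖(v n : H) - f‖ ^ 2 :=
    fun n => by
      rw [energyOne, hform, map_sub]
      rfl
  simp_rw [h3]
  simpa using h1.add h2

section Riesz

/-- Riesz representation in the energy space. It is used twice: for `u ↦ (h, u)`, which yields the
resolvent, and for evaluation at the origin, which yields the counterexample to self-adjointness of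
`𝒢`. -/
lemma exists_form_add_inner_eq (E : SymmForm H) [CompleteSpace E.EnergySpace]
    (L : E.domain →ₗ[ℝ] ℝ) (C : ℝ) (hL : ∀ u, L u ^ 2 ≤ C * E.energyOne u) :
    ∃ v : E.domain, ∀ u, E.form v u + inner ℝ (v : H) (u : H) = L u := by
  have hL' : ∀ u, ‖L u‖ ^ 2 ≤ C * E.energyOne u := by simpa using hL
  obtain ⟨w, hw⟩ := (InnerProductSpace.toDual ℝ E.EnergySpace).surjective (E.boundedMap L C hL')
  obtain ⟨v, rfl⟩ := E.toEnergy.surjective w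
  refine ⟨v, fun u => ?_⟩
  rw [← inner_toEnergy, ← InnerProductSpace.toDual_apply_apply (𝕜 := ℝ), hw, boundedMap_apply]

/-- The equation `(1 - A) v = h` is solvable for every `h`. -/
lemma exists_resolvent (E : SymmForm H) [CompleteSpace E.EnergySpace] (h : H) :
    ∃ v : E.domain, ∀ u : E.domain, E.form v u + inner ℝ (v : H) (u : H) = inner ℝ h (u : H) := by
  refine E.exists_form_add_inner_eq ((innerₗ H h) ∘ₗ E.domain.subtype) (‖h‖ ^ 2) fun u => ?_
  have h1 : |inner ℝ h (u : H)| ≤ ‖h‖ * ‖(u : H)‖ := abs_real_inner_le_norm _ _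
  have h2 := E.norm_sq_le_energyOne u
  calc inner ℝ h (u : H) ^ 2 = |inner ℝ h (u : H)| ^ 2 := (sq_abs _).symm
    _ ≤ (‖h‖ * ‖(u : H)‖) ^ 2 := by gcongr
    _ = ‖h‖ ^ 2 * ‖(u : H)‖ ^ 2 := mul_pow _ _ _
    _ ≤ _ := by gcongr

end Riesz

section Generator

/-- A pair `(0, h)` in the graph has `h` orthogonal to the dense domain, hence `h = 0`. Only for
such a single-valued graph does `toLinearPMap` give the graph back. -/
lemma graph_generator {E : SymmForm H} (hE : Dense (E.domain : Set H)) :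
    E.generator.graph = E.generatorGraph := by
  refine Submodule.toLinearPMap_graph_eq _ ?_
  rintro ⟨f, h⟩ ⟨hf, hfg⟩ (rfl : f = 0)
  refine hE.eq_zero_of_inner_left ℝ fun g hg => ?_
  have h1 := hfg ⟨g, hg⟩
  have h2 : (⟨((0 : H), h).1, hf⟩ : E.domain) = 0 := rfl
  rw [h2, map_zero, LinearMap.zero_apply] at h1
  simpa using h1.symm

lemma form_eq_neg_inner_generator {E : SymmForm H} (hE : Dense (E.domain : Set H))
    (f : E.generator.domain) : ∃ hf : (f : H) ∈ E.domain,
      ∀ g : E.domain, E.form ⟨f, hf⟩ g = -inner ℝ (E.generator f) (g : H) := by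
  have h := LinearPMap.mem_graph E.generator f
  rw [graph_generator hE] at h
  exact h

lemma exists_generator_eq {E : SymmForm H} (hE : Dense (E.domain : Set H)) {f h : H}
    (hf : f ∈ E.domain) (hfg : ∀ g : E.domain, E.form ⟨f, hf⟩ g = -inner ℝ h (g : H)) :
    ∃ hf' : f ∈ E.generator.domain, E.generator ⟨f, hf'⟩ = h := by
  have h1 : (f, h) ∈ E.generator.graph := by
    rw [graph_generator hE]
    exact ⟨hf, hfg⟩
  obtain ⟨y, hy, hy'⟩ := (LinearPMap.mem_graph_iff _).1 h1
  subst hy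
  exact ⟨y.2, hy'⟩

/-- The weak resolvent equation `E(v, g) + (v, g) = (h, g)` says exactly that `A v = v - h`. -/
lemma exists_sub_generator_eq {E : SymmForm H} (hE : Dense (E.domain : Set H))
    [CompleteSpace E.EnergySpace] (h : H) : ∃ f : E.generator.domain, f - E.generator f = h := by
  obtain ⟨v, hv⟩ := E.exists_resolvent h
  obtain ⟨hf, hv'⟩ := exists_generator_eq hE (h := v - h) v.2 fun g => by
    have := hv g
    rw [inner_sub_left]
    linarith
  refine ⟨⟨v, hf⟩, ?_⟩
  rw [hv']
  exact sub_sub_cancel _ _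

lemma inner_generator_comm {E : SymmForm H} (hE : Dense (E.domain : Set H))
    (f g : E.generator.domain) :
    inner ℝ (E.generator f) (g : H) = inner ℝ (f : H) (E.generator g) := by
  obtain ⟨hf, hf'⟩ := form_eq_neg_inner_generator hE f
  obtain ⟨hg, hg'⟩ := form_eq_neg_inner_generator hE g
  have h1 := hf' ⟨g, hg⟩
  have h2 := hg' ⟨f, hf⟩
  rw [E.symm', h1] at h2
  rw [real_inner_comm (f : H)] at h2
  simp only at h1 h2
  linarith [real_inner_comm (E.generator f) (g : H)]

/-- Write a vector orthogonal to `D(A)` as `(1 - A) f`. Pairing it with `f` gives `‖f‖² + E(f, f) =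
0`, so the vector is zero. -/
lemma dense_domain_generator [CompleteSpace H] {E : SymmForm H} (hE : Dense (E.domain : Set H))
    [CompleteSpace E.EnergySpace] : Dense (E.generator.domain : Set H) := by
  rw [Submodule.dense_iff_topologicalClosure_eq_top, Submodule.topologicalClosure_eq_top_iff,
    Submodule.eq_bot_iff]
  intro h hh
  obtain ⟨f, rfl⟩ := exists_sub_generator_eq hE h
  obtain ⟨hf, hf'⟩ := form_eq_neg_inner_generator hE f
  have h1 := (Submodule.mem_orthogonal _ _).1 hh f f.2
  have h2 := hf' ⟨f, hf⟩
  have h3 := E.nonneg' ⟨f, hf⟩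
  rw [inner_sub_right, real_inner_self_eq_norm_sq, ← real_inner_comm] at h1
  simp only at h2
  have h4 : ‖(f : H)‖ ^ 2 = 0 := le_antisymm (by linarith) (sq_nonneg _)
  have h5 : f = 0 := Subtype.ext (by simpa using h4)
  simp [h5]

/-- The generator of a closed, densely defined form is self-adjoint. -/
theorem isSelfAdjoint_generator [CompleteSpace H] {E : SymmForm H}
    (hE : Dense (E.domain : Set H)) [CompleteSpace E.EnergySpace] :
    IsSelfAdjoint E.generator := by
  have hd := dense_domain_generator hE
  rw [LinearPMap.isSelfAdjoint_def]
  have hle : E.generator ≤ E.generator.adjoint :=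
    LinearPMap.IsFormalAdjoint.le_adjoint hd fun f g => inner_generator_comm hE f g
  refine (LinearPMap.eq_of_le_of_domain_eq hle (le_antisymm hle.1 fun y hy => ?_)).symm
  set z := E.generator.adjoint ⟨y, hy⟩ with hz
  have hyz : ∀ f : E.generator.domain, inner ℝ (E.generator f) y = inner ℝ (f : H) z := fun f => by
    rw [real_inner_comm, real_inner_comm z]
    exact (LinearPMap.adjoint_isFormalAdjoint hd ⟨y, hy⟩ f).symm
  -- With `z = A* y`, both `y` and `w` solve the equation `(1 - A*) · = y - z`. Hence `y - w` is
  -- orthogonal to the range of `1 - A`, which is everything.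
  obtain ⟨w, hw⟩ := exists_sub_generator_eq hE (y - z)
  suffices h : y = w by rw [h]; exact w.2
  obtain ⟨f, hf⟩ := exists_sub_generator_eq hE (y - w)
  have h1 : inner ℝ (f - E.generator f) (y - w : H) = 0 := by
    have h2 := hyz f
    have h3 := inner_generator_comm hE f w
    have h4 : inner ℝ (f : H) (w - E.generator w) = inner ℝ (f : H) (y - z) := by rw [hw]
    simp only [inner_sub_left, inner_sub_right] at *
    linarith
  rw [hf] at h1
  exact sub_eq_zero.1 (inner_self_eq_zero.1 h1)

end Generator

end SymmForm

/-! ### Existence and uniqueness of quasi-continuous versions at a point -/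

section Capacity

variable {X : Type*} [MeasurableSpace X] {μ : Measure X}

/-- The union of open sets `G k` that admit potentials with summable norms has small capacity. -/
lemma openCapacity_iUnion_le {E : SymmForm (Lp ℝ 2 μ)} [CompleteSpace E.EnergySpace]
    {G : ℕ → Set X} {e : ℕ → E.domain} {b : ℕ → ℝ} {B : ℝ}
    (h0 : ∀ k, ∀ᵐ x ∂μ, 0 ≤ (e k : Lp ℝ 2 μ) x)
    (h1 : ∀ k, ∀ᵐ x ∂μ, x ∈ G k → 1 ≤ (e k : Lp ℝ 2 μ) x)
    (hb : ∀ k, ‖E.toEnergy (e k)‖ ≤ b k) (hB : HasSum b B) :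
    openCapacity E (⋃ k, G k) ≤ ENNReal.ofReal (B ^ 2) := by
  have hsum : Summable fun k => E.toEnergy (e k) := Summable.of_norm_bounded hB.summable hb
  obtain ⟨S, hS⟩ := E.toEnergy.surjective (∑' k, E.toEnergy (e k))
  have hI : ∀ u, ‖E.domain.subtype u‖ ^ 2 ≤ 1 * E.energyOne u := fun u => by
    rw [one_mul]
    exact E.norm_sq_le_energyOne u
  -- The inclusion of the energy space into `L²` is continuous, so the energy sum `S` is also the
  -- `L²` sum. Its terms are nonnegative, so `S` dominates each of them.
  have hSsum : HasSum (fun k => (e k : Lp ℝ 2 μ)) (S : Lp ℝ 2 μ) := by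
    have h := hsum.hasSum.mapL (E.boundedMap E.domain.subtype 1 hI)
    rw [← hS] at h
    exact h
  have h0' : ∀ k, 0 ≤ (e k : Lp ℝ 2 μ) := fun k => (Lp.coeFn_nonneg _).1 (h0 k)
  have hle : ∀ k, (e k : Lp ℝ 2 μ) ≤ S := fun k => le_hasSum hSsum k fun j _ => h0' j
  refine (openCapacity_le S ((Lp.coeFn_nonneg _).2 (hSsum.nonneg h0')) ?_).trans
    (ENNReal.ofReal_le_ofReal ?_)
  · have hle' : ∀ᵐ x ∂μ, ∀ k, (e k : Lp ℝ 2 μ) x ≤ (S : Lp ℝ 2 μ) x :=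
      ae_all_iff.2 fun k => (Lp.coeFn_le _ _).2 (hle k)
    filter_upwards [hle', ae_all_iff.2 h1] with x hx hx1 hxG
    obtain ⟨k, hk⟩ := Set.mem_iUnion.1 hxG
    exact (hx1 k hk).trans (hx k)
  · rw [← SymmForm.norm_toEnergy_sq, hS]
    gcongr
    exact tsum_of_norm_bounded hB hb

variable [TopologicalSpace X]

/-- If `{x₀}` has positive capacity, a quasi-continuous function that vanishes a.e. vanishes at
`x₀`. -/
lemma QuasiContinuous.eq_zero_of_ae_eq_zero {E : SymmForm (Lp ℝ 2 μ)} {x₀ : X} {C : ℝ}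
    (hE : ∀ e : E.domain, ∀ U ∈ 𝓝 x₀, (∀ᵐ x ∂μ, x ∈ U → 1 ≤ (e : Lp ℝ 2 μ) x) →
      1 ≤ C * E.energyOne e)
    {u : X → ℝ} (hu : QuasiContinuous E u) (h0 : u =ᵐ[μ] 0) : u x₀ = 0 := by
  by_contra hne
  -- The bound `1 / (|C| + 1)` forces `C * E₁(e) < 1` for the potential `e` of `G`, so `e ≥ 1` can
  -- hold near `x₀` only at the price of a contradiction.
  obtain ⟨G, hG, hcap, hcont⟩ := hu (ENNReal.ofReal (1 / (|C| + 1)))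
    (ENNReal.ofReal_pos.2 (by positivity))
  obtain ⟨e, -, he1, he⟩ := exists_of_openCapacity_lt hcap
  rw [ENNReal.ofReal_lt_ofReal_iff (by positivity), lt_div_iff₀ (by positivity)] at he
  have hsmall : ¬ 1 ≤ C * E.energyOne e := by
    have h1 := E.energyOne_nonneg e
    have h2 := mul_le_mul_of_nonneg_right (le_abs_self C) h1
    nlinarith
  by_cases hx : x₀ ∈ G
  · exact hsmall (hE e G (hG.mem_nhds hx) he1)
  -- Off `G` the function `u` is continuous, so it is nonzero on `V ∩ Gᶜ` for some neighbourhood `V`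
  -- of `x₀`. That set is null, so almost all of `V` lies in `G`, where the potential is at least
  -- `1`.
  · have h1 : {x | u x ≠ 0} ∈ 𝓝[Gᶜ] x₀ := (hcont x₀ hx) (isOpen_ne.mem_nhds hne)
    obtain ⟨V, hV, hVG⟩ := mem_nhdsWithin_iff_exists_mem_nhds_inter.1 h1
    refine hsmall (hE e V hV ?_)
    filter_upwards [he1, h0] with x hx1 hx0 hxV
    refine hx1 (by_contra fun hxG => ?_)
    exact hVG ⟨hxV, hxG⟩ hx0

lemma IsQuasiValue.eq_zero {E : SymmForm (Lp ℝ 2 μ)} {x₀ : X} {C a : ℝ}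
    (hE : ∀ e : E.domain, ∀ U ∈ 𝓝 x₀, (∀ᵐ x ∂μ, x ∈ U → 1 ≤ (e : Lp ℝ 2 μ) x) →
      1 ≤ C * E.energyOne e)
    (ha : IsQuasiValue E 0 x₀ a) : a = 0 := by
  obtain ⟨u, hu, hu0, rfl⟩ := ha
  exact hu.eq_zero_of_ae_eq_zero hE (hu0.trans (Lp.coeFn_zero ℝ 2 μ))

lemma IsQuasiValue.sub {E : SymmForm (Lp ℝ 2 μ)} {f g : Lp ℝ 2 μ} {x₀ : X} {a b : ℝ}
    (hf : IsQuasiValue E f x₀ a) (hg : IsQuasiValue E g x₀ b) :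
    IsQuasiValue E (f - g) x₀ (a - b) := by
  have h := hf.add (hg.const_smul (-1))
  convert h using 1
  · rw [neg_one_smul, sub_eq_add_neg]
  · ring

/-- If continuous functions `φ n` converge to `f` with respect to `E₁` and satisfy a capacitary
weak type inequality, then `f` has a quasi-continuous version whose value at `x₀` is the limit
of `φ n x₀`. -/
lemma isQuasiValue_of_tendsto {E : SymmForm (Lp ℝ 2 μ)} [CompleteSpace E.EnergySpace]
    {x₀ : X} {f : E.domain} {φ : ℕ → X → ℝ} {v : ℕ → E.domain} {K a : ℝ}
    (hφ : ∀ n, Continuous (φ n)) (hv : ∀ n, (v n : Lp ℝ 2 μ) =ᵐ[μ] φ n)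
    (hlim : Tendsto (fun n => E.energyOne (v n - f)) atTop (𝓝 0))
    (hcap : ∀ m n, ∀ l > 0, ∃ e : E.domain, (∀ᵐ x ∂μ, 0 ≤ (e : Lp ℝ 2 μ) x) ∧
      (∀ᵐ x ∂μ, l < |φ m x - φ n x| → 1 ≤ (e : Lp ℝ 2 μ) x) ∧
      l ^ 2 * E.energyOne e ≤ K * E.energyOne (v m - v n))
    (ha : Tendsto (fun n => φ n x₀) atTop (𝓝 a)) :
    IsQuasiValue E f x₀ a := by
  have hnorm : Tendsto (fun n => ‖E.toEnergy (v n) - E.toEnergy f‖) atTop (𝓝 0) :=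
    tendsto_iff_norm_sub_tendsto_zero.1 (E.tendsto_toEnergy_iff.2 hlim)
  have hLp : Tendsto (fun n => (v n : Lp ℝ 2 μ)) atTop (𝓝 (f : Lp ℝ 2 μ)) := by
    refine tendsto_iff_norm_sub_tendsto_zero.2 (squeeze_zero (fun _ => norm_nonneg _) (fun n => ?_)
      hnorm)
    exact E.norm_le_norm_toEnergy (v n - f)
  -- The first extraction gives convergence a.e., which identifies the limit with `f`. The second
  -- makes the errors at most `8⁻ᵏ`, so consecutive differences have energy at most `4 · 64⁻ᵏ`. With
  -- thresholds `2⁻ᵏ` the potentials then have energy at most `4|K| · 16⁻ᵏ`, hence summable norms.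
  obtain ⟨n₁, hn₁, hae⟩ := (tendstoInMeasure_of_tendsto_Lp hLp).exists_seq_tendsto_ae
  obtain ⟨n₂, hn₂, hfast⟩ := extraction_forall_of_eventually fun k =>
    (hnorm.comp hn₁.tendsto_atTop).eventually_lt_const (show (0 : ℝ) < (1 / 8) ^ k by positivity)
  set ns := n₁ ∘ n₂ with hns
  have hmono : StrictMono ns := hn₁.comp hn₂
  have hdiff : ∀ k, E.energyOne (v (ns (k + 1)) - v (ns k)) ≤ 4 * (1 / 64) ^ k := fun k => by
    rw [← SymmForm.norm_toEnergy_sq, map_sub]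
    have h1 : ‖E.toEnergy (v (ns (k + 1))) - E.toEnergy f‖ < (1 / 8) ^ (k + 1) := hfast (k + 1)
    have h2 : ‖E.toEnergy (v (ns k)) - E.toEnergy f‖ < (1 / 8) ^ k := hfast k
    have h3 := norm_sub_le_norm_sub_add_norm_sub (E.toEnergy (v (ns (k + 1)))) (E.toEnergy f)
      (E.toEnergy (v (ns k)))
    rw [norm_sub_rev (E.toEnergy f)] at h3
    have h4 : (1 / 8 : ℝ) ^ (k + 1) ≤ (1 / 8) ^ k :=
      pow_le_pow_of_le_one (by norm_num) (by norm_num) (by omega)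
    calc ‖E.toEnergy (v (ns (k + 1))) - E.toEnergy (v (ns k))‖ ^ 2
        ≤ (2 * (1 / 8) ^ k) ^ 2 := by
          gcongr
          linarith
      _ = 4 * (1 / 64) ^ k := by
          rw [mul_pow, ← pow_mul, mul_comm k 2, pow_mul]
          norm_num
  choose e he0 he1 heE using fun k : ℕ =>
    hcap (ns (k + 1)) (ns k) ((1 / 2) ^ k) (by positivity)
  set M := Real.sqrt (4 * |K|) with hM
  have henorm : ∀ k, ‖E.toEnergy (e k)‖ ≤ M * (1 / 4) ^ k := fun k => by
    refine le_of_sq_le_sq ?_ (by positivity)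
    rw [SymmForm.norm_toEnergy_sq, mul_pow, hM, Real.sq_sqrt (by positivity), ← pow_mul,
      mul_comm k 2, pow_mul]
    have h1 : (1 / 4 : ℝ) ^ k * E.energyOne (e k) ≤ (1 / 4) ^ k * (4 * |K| * (1 / 16) ^ k) := by
      calc (1 / 4 : ℝ) ^ k * E.energyOne (e k)
          = ((1 / 2) ^ k) ^ 2 * E.energyOne (e k) := by
            rw [← pow_mul, mul_comm k 2, pow_mul]
            norm_num
        _ ≤ K * E.energyOne (v (ns (k + 1)) - v (ns k)) := heE k
        _ ≤ |K| * (4 * (1 / 64) ^ k) := by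
            have := hdiff k
            have := E.energyOne_nonneg (v (ns (k + 1)) - v (ns k))
            gcongr
            exact le_abs_self K
        _ = |K| * (4 * ((1 / 4) ^ k * (1 / 16) ^ k)) := by
            rw [← mul_pow]
            norm_num
        _ = _ := by ring
    have h2 := le_of_mul_le_mul_left h1 (by positivity)
    norm_num at h2 ⊢
    exact h2
  have hb : Summable fun k : ℕ => M * (1 / 4 : ℝ) ^ k :=
    (summable_geometric_of_lt_one (by norm_num) (by norm_num)).mul_left M
  -- Where the sequence diverges, `u` has an arbitrary value. This is harmless: convergence is
  -- uniform off exceptional open sets of small capacity, and at `x₀` it holds by assumption.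
  set u : X → ℝ := fun x => limUnder atTop fun k => φ (ns k) x with hu
  refine ⟨u, fun ε hε => ?_, ?_, (ha.comp hmono.tendsto_atTop).limUnder_eq⟩
  · have htail : Tendsto (fun N => ENNReal.ofReal ((∑' k : ℕ, M * (1 / 4 : ℝ) ^ (k + N)) ^ 2)) atTop
        (𝓝 0) := by
      have h := ENNReal.tendsto_ofReal
        ((tendsto_sum_nat_add fun k : ℕ => M * (1 / 4 : ℝ) ^ k).pow 2)
      simpa using h
    obtain ⟨N, hN⟩ := (htail.eventually_lt_const hε).exists
    refine ⟨⋃ k, {x | (1 / 2) ^ (k + N) < |φ (ns (k + N + 1)) x - φ (ns (k + N)) x|},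
      isOpen_iUnion fun k => isOpen_lt continuous_const ((hφ _).sub (hφ _)).abs, ?_, ?_⟩
    · exact (openCapacity_iUnion_le (e := fun k => e (k + N)) (fun k => he0 _) (fun k => he1 _)
        (fun k => henorm _) ((summable_nat_add_iff N).2 hb).hasSum).trans_lt hN
    · have hstep : ∀ x ∈ (⋃ k, {x | (1 / 2) ^ (k + N) <
          |φ (ns (k + N + 1)) x - φ (ns (k + N)) x|})ᶜ, ∀ k,
          dist (φ (ns (k + N)) x) (φ (ns (k + 1 + N)) x) ≤ (1 / 2) ^ N * (1 / 2) ^ k := by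
        intro x hx k
        simp only [Set.mem_compl_iff, Set.mem_iUnion, Set.mem_ofPred_eq, not_exists, not_lt] at hx
        have h := hx k
        rw [← pow_add, add_comm N k, dist_comm, Real.dist_eq, add_right_comm]
        exact h
      have hptw : ∀ x ∈ (⋃ k, {x | (1 / 2) ^ (k + N) <
          |φ (ns (k + N + 1)) x - φ (ns (k + N)) x|})ᶜ,
          Tendsto (fun k => φ (ns (k + N)) x) atTop (𝓝 (u x)) := by
        intro x hx
        obtain ⟨y, hy⟩ := cauchySeq_tendsto_of_complete
          (cauchySeq_of_le_geometric (1 / 2) _ (by norm_num) (hstep x hx))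
        have hy' : Tendsto (fun k => φ (ns k) x) atTop (𝓝 y) :=
          (tendsto_add_atTop_iff_nat N).1 hy
        have hxy : u x = y := hy'.limUnder_eq
        rwa [hxy]
      have hunif : TendstoUniformlyOn (fun k x => φ (ns (k + N)) x) u atTop
          (⋃ k, {x | (1 / 2) ^ (k + N) < |φ (ns (k + N + 1)) x - φ (ns (k + N)) x|})ᶜ := by
        rw [Metric.tendstoUniformlyOn_iff]
        intro δ hδ
        have hz : Tendsto (fun k : ℕ => (1 / 2 : ℝ) ^ N * (1 / 2) ^ k / (1 - 1 / 2)) atTop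
            (𝓝 0) := by
          have h := ((tendsto_pow_atTop_nhds_zero_of_lt_one (r := (1 / 2 : ℝ)) (by norm_num)
            (by norm_num)).const_mul ((1 / 2 : ℝ) ^ N)).div_const (1 - 1 / 2)
          simpa using h
        filter_upwards [hz.eventually_lt_const hδ] with k hk x hx
        rw [dist_comm]
        exact (dist_le_of_le_geometric_of_tendsto (1 / 2) _ (by norm_num) (hstep x hx)
          (hptw x hx) k).trans_lt hk
      exact hunif.continuousOn (Frequently.of_forall fun k => (hφ _).continuousOn)
  · filter_upwards [hae, ae_all_iff.2 hv] with x hx hvx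
    have h := hx.comp hn₂.tendsto_atTop
    refine Tendsto.limUnder_eq (h.congr fun k => ?_)
    exact hvx _

end Capacity

/-! ### The half-line -/

section HalfLine

lemma measurableEmbedding_coe : MeasurableEmbedding ((↑) : ℝ≥0 → ℝ) :=
  NNReal.isClosedEmbedding_coe.measurableEmbedding

lemma map_coe_halfLineVolume :
    halfLineVolume.map ((↑) : ℝ≥0 → ℝ) = volume.restrict (Set.Ici 0) := by
  rw [halfLineVolume, measurableEmbedding_coe.map_comap]
  congr 1
  ext x
  exact ⟨fun ⟨y, hy⟩ => hy ▸ y.2, fun hx => ⟨⟨x, hx⟩, rfl⟩⟩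

lemma integral_halfLineVolume_coe (g : ℝ → ℝ) :
    ∫ r : ℝ≥0, g r ∂halfLineVolume = ∫ x in Set.Ici 0, g x := by
  rw [← map_coe_halfLineVolume, measurableEmbedding_coe.integral_map]

lemma setIntegral_Iic_coe (g : ℝ → ℝ) (r : ℝ≥0) :
    ∫ s in Set.Iic r, g s ∂halfLineVolume = ∫ x in (0 : ℝ)..r, g x := by
  have h : Set.Iic r = ((↑) : ℝ≥0 → ℝ) ⁻¹' Set.Iic (r : ℝ) := by
    ext s
    simp
  rw [h, ← measurableEmbedding_coe.setIntegral_map, map_coe_halfLineVolume,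
    Measure.restrict_restrict measurableSet_Iic, Set.inter_comm, Set.Ici_inter_Iic,
    intervalIntegral.integral_of_le r.coe_nonneg, integral_Icc_eq_integral_Ioc]

lemma ae_halfLineVolume_coe {p : ℝ → Prop} :
    (∀ᵐ r : ℝ≥0 ∂halfLineVolume, p r) ↔ ∀ᵐ x : ℝ, 0 ≤ x → p x := by
  rw [← measurableEmbedding_coe.ae_map_iff, map_coe_halfLineVolume,
    ae_restrict_iff' measurableSet_Ici]
  rfl

lemma integrableOn_Iic_coe {g : ℝ → ℝ} {r : ℝ≥0} :
    IntegrableOn (fun s : ℝ≥0 => g s) (Set.Iic r) halfLineVolume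
      ↔ IntegrableOn g (Set.Icc 0 r) := by
  have h : Set.Iic r = ((↑) : ℝ≥0 → ℝ) ⁻¹' Set.Iic (r : ℝ) := by
    ext s
    simp
  rw [h, ← Function.comp_def g, ← measurableEmbedding_coe.integrableOn_map_iff,
    map_coe_halfLineVolume, IntegrableOn, Measure.restrict_restrict measurableSet_Iic,
    Set.inter_comm, Set.Ici_inter_Iic]
  rfl

instance : Measure.IsOpenPosMeasure halfLineVolume where
  open_pos U hU hne h0 := by
    obtain ⟨V, hV, rfl⟩ := NNReal.isClosedEmbedding_coe.isInducing.isOpen_iff.1 hU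
    obtain ⟨x, hx⟩ := hne
    rw [← Measure.map_apply measurableEmbedding_coe.measurable hV.measurableSet,
      map_coe_halfLineVolume, Measure.restrict_apply hV.measurableSet] at h0
    -- An open subset of `[0, ∞)` containing `0` need not be open in `ℝ`, but it always meets `(0,
    -- ∞)` in a nonempty open set.
    have hxc : (x : ℝ) ∈ closure (Set.Ioi (0 : ℝ)) := by
      rw [closure_Ioi]
      exact x.2
    have hne : (V ∩ Set.Ioi (0 : ℝ)).Nonempty := mem_closure_iff.1 hxc V hV hx
    exact ((hV.inter isOpen_Ioi).measure_pos volume hne).ne'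
      (measure_mono_null (Set.inter_subset_inter_right _ Set.Ioi_subset_Ici_self) h0)

instance : NullSingletonClass halfLineVolume where
  measure_singleton x := by
    rw [halfLineVolume, measurableEmbedding_coe.comap_apply]
    simp

lemma isCompact_Iic (r : ℝ≥0) : IsCompact (Set.Iic r) := by
  rw [← Set.Icc_bot]
  exact isCompact_Icc

/-- Extension by zero of a function on the half-line. -/
def extendZero (g : ℝ≥0 → ℝ) : ℝ → ℝ := (Set.Ici 0).indicator fun x => g x.toNNReal

lemma extendZero_coe (g : ℝ≥0 → ℝ) (r : ℝ≥0) : extendZero g r = g r := by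
  rw [extendZero, Set.indicator_of_mem (Set.mem_Ici.2 r.coe_nonneg), Real.toNNReal_coe]

/-- Local integrability on `[0, ∞)` includes integrability up to the endpoint, so the extension has
no singularity at `0`. -/
lemma locallyIntegrable_extendZero {g : ℝ≥0 → ℝ} (hg : LocallyIntegrable g halfLineVolume) :
    LocallyIntegrable (extendZero g) := by
  rw [locallyIntegrable_iff]
  intro K hK
  obtain ⟨R, hR⟩ := hK.bddAbove
  have h1 : IntegrableOn (fun s : ℝ≥0 => extendZero g s) (Set.Iic R.toNNReal) halfLineVolume := by
    simp_rw [extendZero_coe]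
    exact hg.integrableOn_isCompact (isCompact_Iic _)
  rw [integrableOn_Iic_coe] at h1
  have h2 : IntegrableOn (extendZero g) (Set.Iic (R.toNNReal : ℝ)) := by
    refine h1.of_forall_sdiff_eq_zero measurableSet_Iic fun x hx => ?_
    exact Set.indicator_of_notMem (fun h => hx.2 ⟨h, hx.1⟩) _
  exact h2.mono_set fun x hx => (hR hx).trans (Real.le_coe_toNNReal R)

lemma setIntegral_Iic_eq (g : ℝ≥0 → ℝ) (r : ℝ≥0) :
    ∫ s in Set.Iic r, g s ∂halfLineVolume = ∫ x in (0 : ℝ)..r, extendZero g x := by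
  rw [← setIntegral_Iic_coe]
  simp_rw [extendZero_coe]

lemma continuous_primitive {g : ℝ≥0 → ℝ} (hg : LocallyIntegrable g halfLineVolume) :
    Continuous fun r => ∫ s in Set.Iic r, g s ∂halfLineVolume := by
  simp_rw [setIntegral_Iic_eq]
  exact (intervalIntegral.continuous_primitive
    (fun a b => ((locallyIntegrable_extendZero hg).integrableOn_isCompact
      isCompact_uIcc).intervalIntegrable) 0).comp NNReal.continuous_coe

lemma primitive_zero (g : ℝ≥0 → ℝ) : ∫ s in Set.Iic (0 : ℝ≥0), g s ∂halfLineVolume = 0 := by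
  rw [setIntegral_Iic_eq]
  simp

/-- The primitive is continuous, so it is constant everywhere and not only a.e.; by Lebesgue's
differentiation theorem its derivative is `g` almost everywhere. This makes the derivative on `𝓕⁺`
single-valued. -/
lemma ae_eq_zero_of_primitive_eq_const {g : ℝ≥0 → ℝ} (hg : LocallyIntegrable g halfLineVolume)
    {c : ℝ} (h : ∀ᵐ r ∂halfLineVolume, c = ∫ s in Set.Iic r, g s ∂halfLineVolume) :
    g =ᵐ[halfLineVolume] 0 := by
  have h1 := (Continuous.ae_eq_iff_eq halfLineVolume continuous_const (continuous_primitive hg)).1 h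
  have h2 : ∀ r : ℝ≥0, c = ∫ x in (0 : ℝ)..r, extendZero g x := fun r => by
    rw [← setIntegral_Iic_eq]
    exact congrFun h1 r
  have h3 : ∀ᵐ x : ℝ, 0 ≤ x → extendZero g x = 0 := by
    have hne : ∀ᵐ x : ℝ, x ≠ 0 := by simp [ae_iff]
    filter_upwards [LocallyIntegrable.ae_hasDerivAt_integral (locallyIntegrable_extendZero hg),
      hne] with x hx hx0 hxn
    have hpos : 0 < x := lt_of_le_of_ne hxn hx0.symm
    have h4 : (fun t => ∫ y in (0 : ℝ)..t, extendZero g y) =ᶠ[𝓝 x] fun _ => c := by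
      filter_upwards [lt_mem_nhds hpos] with t ht
      exact (h2 ⟨t, ht.le⟩).symm
    exact ((hx 0).congr_of_eventuallyEq h4.symm).unique (hasDerivAt_const x c)
  filter_upwards [ae_halfLineVolume_coe.2 h3] with r hr
  rwa [extendZero_coe] at hr

end HalfLine

lemma exists_toLinearPMap_eq {E F : Type*} [AddCommGroup E] [Module ℝ E] [AddCommGroup F]
    [Module ℝ F] {g : Submodule ℝ (E × F)} (hg : ∀ x ∈ g, x.1 = 0 → x.2 = 0) {a : E} {b : F}
    (h : (a, b) ∈ g) : ∃ ha : a ∈ g.toLinearPMap.domain, g.toLinearPMap ⟨a, ha⟩ = b := by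
  rw [← Submodule.toLinearPMap_graph_eq g hg] at h
  obtain ⟨y, hy, hy'⟩ := (LinearPMap.mem_graph_iff _).1 h
  subst hy
  exact ⟨y.2, hy'⟩

namespace Params

variable (P : Params)

/-! ### The form on the half-line -/

lemma aemeasurable_ρ : AEMeasurable P.ρ halfLineVolume :=
  P.ρ_loc.aestronglyMeasurable.aemeasurable

lemma mPlus_absolutelyContinuous : P.mPlus ≪ halfLineVolume := withDensity_absolutelyContinuous _ _

lemma absolutelyContinuous_mPlus : halfLineVolume ≪ P.mPlus :=
  withDensity_absolutelyContinuous' P.aemeasurable_ρ.ennreal_ofReal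
    (by filter_upwards [P.ρ_pos] with x hx; simpa using hx)

lemma integrable_mPlus_iff {f : ℝ≥0 → ℝ} :
    Integrable f P.mPlus ↔ Integrable (fun r => P.ρ r * f r) halfLineVolume := by
  rw [mPlus, integrable_withDensity_iff_integrable_smul₀' P.aemeasurable_ρ.ennreal_ofReal (by simp)]
  refine integrable_congr ?_
  filter_upwards [P.ρ_pos] with r hr
  rw [ENNReal.toReal_ofReal hr.le, smul_eq_mul]

lemma integral_mPlus (f : ℝ≥0 → ℝ) :
    ∫ r, f r ∂P.mPlus = ∫ r, P.ρ r * f r ∂halfLineVolume := by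
  rw [mPlus,
    integral_withDensity_eq_integral_toReal_smul₀ P.aemeasurable_ρ.ennreal_ofReal (by simp)]
  refine integral_congr_ae ?_
  filter_upwards [P.ρ_pos] with r hr
  rw [ENNReal.toReal_ofReal hr.le, smul_eq_mul]

/-- The element `1_{[0, r]} / ρ` of `L²(m₊)`, which represents `g ↦ ∫₀^r g`. -/
lemma memLp_kernel (r : ℝ≥0) :
    MemLp ((Set.Iic r).indicator fun s => 1 / P.ρ s) 2 P.mPlus := by
  have hm : AEStronglyMeasurable ((Set.Iic r).indicator fun s => 1 / P.ρ s) P.mPlus :=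
    (P.inv_ρ_loc.aestronglyMeasurable.mono_ac P.mPlus_absolutelyContinuous).indicator
      measurableSet_Iic
  rw [memLp_two_iff_integrable_sq hm, integrable_mPlus_iff]
  refine ((P.inv_ρ_loc.integrableOn_isCompact (isCompact_Iic r)).integrable_indicator
    measurableSet_Iic).congr ?_
  filter_upwards [P.ρ_pos] with s hs
  by_cases h : s ∈ Set.Iic r
  · simp only [Set.indicator_of_mem h]
    field_simp
  · simp [Set.indicator_of_notMem h]

def kernel (r : ℝ≥0) : Lp ℝ 2 P.mPlus := (P.memLp_kernel r).toLp _

/-- The density `ρ` of `m₊` cancels the factor `1 / ρ`. As an inner product, the primitive at a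
fixed `r` depends continuously on `g ∈ L²(m₊)`. -/
lemma inner_kernel (r : ℝ≥0) (g : Lp ℝ 2 P.mPlus) :
    inner ℝ (P.kernel r) g = ∫ s in Set.Iic r, g s ∂halfLineVolume := by
  rw [L2.inner_def, ← integral_indicator measurableSet_Iic, integral_mPlus]
  refine integral_congr_ae ?_
  filter_upwards [P.ρ_pos, P.ae_halfLine (P.memLp_kernel r).coeFn_toLp] with s hs hk
  rw [kernel, hk]
  by_cases h : s ∈ Set.Iic r
  · simp only [Set.indicator_of_mem h, RCLike.inner_apply, conj_trivial]
    field_simp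
  · simp [Set.indicator_of_notMem h]

lemma norm_kernel_le {r s : ℝ≥0} (h : r ≤ s) : ‖P.kernel r‖ ≤ ‖P.kernel s‖ := by
  rw [kernel, kernel, Lp.norm_toLp, Lp.norm_toLp]
  refine ENNReal.toReal_mono (P.memLp_kernel s).2.ne (eLpNorm_mono_ae ?_)
  filter_upwards with t
  exact norm_indicator_le_of_subset (Set.Iic_subset_Iic.2 h) _ _

lemma mem_derivGraph_iff {f g : Lp ℝ 2 P.mPlus} : (f, g) ∈ P.derivGraph ↔
    ∃ c : ℝ, ∀ᵐ r ∂P.mPlus, f r = c + inner ℝ (P.kernel r) g := by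
  simp_rw [inner_kernel]
  rfl

instance : NeZero P.mPlus where
  out h := by
    have h1 := P.absolutelyContinuous_mPlus
    rw [h, Measure.absolutelyContinuous_zero_iff] at h1
    have h2 : (0 : ℝ≥0∞) < halfLineVolume Set.univ := isOpen_univ.measure_pos _ ⟨0, trivial⟩
    simp [h1] at h2

lemma derivGraph_functional (x : Lp ℝ 2 P.mPlus × Lp ℝ 2 P.mPlus) (hx : x ∈ P.derivGraph)
    (h0 : x.1 = 0) : x.2 = 0 := by
  obtain ⟨f, g⟩ := x
  obtain rfl : f = 0 := h0
  obtain ⟨c, hc⟩ := hx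
  have h1 : ∀ᵐ r ∂halfLineVolume, -c = ∫ s in Set.Iic r, g s ∂halfLineVolume := by
    refine P.absolutelyContinuous_mPlus.ae_le ?_
    filter_upwards [hc, Lp.coeFn_zero ℝ 2 P.mPlus] with r hr hr0
    rw [hr0, Pi.zero_apply] at hr
    linarith
  refine Lp.ext ?_
  have h2 := P.mPlus_absolutelyContinuous.ae_eq
    (ae_eq_zero_of_primitive_eq_const (P.locallyIntegrable_mPlus g) h1)
  exact h2.trans (Lp.coeFn_zero ℝ 2 P.mPlus).symm

/-- The derivative on `𝓕⁺`. -/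
def derivLin : P.formPlus.domain →ₗ[ℝ] Lp ℝ 2 P.mPlus := P.derivPlus.toFun

lemma exists_derivLin_eq {f g : Lp ℝ 2 P.mPlus} (h : (f, g) ∈ P.derivGraph) :
    ∃ hf : f ∈ P.formPlus.domain, P.derivLin ⟨f, hf⟩ = g :=
  exists_toLinearPMap_eq P.derivGraph_functional h

lemma mem_derivGraph (f : P.formPlus.domain) :
    ((f : Lp ℝ 2 P.mPlus), P.derivLin f) ∈ P.derivGraph := by
  have h := LinearPMap.mem_graph P.derivGraph.toLinearPMap f
  rwa [Submodule.toLinearPMap_graph_eq _ P.derivGraph_functional] at h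

lemma formPlus_apply (f g : P.formPlus.domain) :
    P.formPlus.form f g = 1 / 2 * inner ℝ (P.derivLin f) (P.derivLin g) := rfl

lemma formPlus_self (f : P.formPlus.domain) :
    P.formPlus.form f f = 1 / 2 * ‖P.derivLin f‖ ^ 2 := by
  rw [formPlus_apply, real_inner_self_eq_norm_sq]

/-- The derivative is a closed operator: the primitives converge at every `r`, the functions
converge a.e. along a subsequence, and therefore the constants of integration converge. Their limit
does not depend on `r`, so one point `r₀` supplies the constant for `f`. -/
instance : CompleteSpace P.formPlus.EnergySpace := by
  refine P.formPlus.completeSpace_of_closed P.derivLin (c := 1 / 2) (by norm_num)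
    P.formPlus_self fun u f g hf hg => ?_
  refine P.exists_derivLin_eq (P.mem_derivGraph_iff.2 ?_)
  obtain ⟨n, hn, hae⟩ := (tendstoInMeasure_of_tendsto_Lp hf).exists_seq_tendsto_ae
  choose c hc using fun k => P.mem_derivGraph_iff.1 (P.mem_derivGraph (u k))
  have hk : ∀ r, Tendsto (fun k => inner ℝ (P.kernel r) (P.derivLin (u (n k)))) atTop
      (𝓝 (inner ℝ (P.kernel r) g)) := fun r =>
    tendsto_const_nhds.inner (hg.comp hn.tendsto_atTop)
  have hlim : ∀ᵐ r ∂P.mPlus, Tendsto (fun k => c (n k)) atTop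
      (𝓝 (f r - inner ℝ (P.kernel r) g)) := by
    filter_upwards [hae, ae_all_iff.2 hc] with r hr hcr
    refine (hr.sub (hk r)).congr fun k => ?_
    rw [hcr]
    ring
  obtain ⟨r₀, hr₀⟩ := hlim.exists
  refine ⟨f r₀ - inner ℝ (P.kernel r₀) g, ?_⟩
  filter_upwards [hlim] with r hr
  rw [tendsto_nhds_unique hr₀ hr]
  ring

/-- The continuous version of `f ∈ 𝓕⁺`. -/
lemma exists_continuous_version (f : P.formPlus.domain) : ∃ u : ℝ≥0 → ℝ, Continuous u ∧
    u =ᵐ[P.mPlus] f ∧ ∀ r, u r = u 0 + inner ℝ (P.kernel r) (P.derivLin f) := by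
  obtain ⟨c, hc⟩ := P.mem_derivGraph f
  refine ⟨fun r => c + ∫ s in Set.Iic r, P.derivLin f s ∂halfLineVolume, ?_, ?_, fun r => ?_⟩
  · exact continuous_const.add (continuous_primitive (P.locallyIntegrable_mPlus _))
  · filter_upwards [hc] with r hr using hr.symm
  · simp only [primitive_zero, inner_kernel, add_zero]

lemma mPlus_Iic_lt_top (r : ℝ≥0) : P.mPlus (Set.Iic r) < ⊤ := by
  have h : IntegrableOn P.ρ (Set.Iic r) halfLineVolume :=
    P.ρ_loc.integrableOn_isCompact (isCompact_Iic r)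
  rw [mPlus, withDensity_apply _ measurableSet_Iic]
  exact h.lintegral_lt_top

lemma mPlus_Iic_pos {r : ℝ≥0} (hr : 0 < r) : 0 < P.mPlus (Set.Iic r) := by
  refine pos_iff_ne_zero.2 fun h => ?_
  have h1 := measure_mono_null (Set.Iio_subset_Iic_self) (P.absolutelyContinuous_mPlus h)
  exact (isOpen_Iio.measure_pos halfLineVolume ⟨0, hr⟩).ne' h1

/-- Obtained by averaging `u(0)² ≤ 2 f(r)² + 2 (∫₀^r f')²` over `[0, 1]` with respect to `m₊`, using
`‖f'‖² ≤ 2 𝓔⁺₁(f, f)`. The first term is twice what is needed. -/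
def evalConst : ℝ := 4 / P.mPlus.real (Set.Iic 1) + 4 * ‖P.kernel 1‖ ^ 2

/-- Evaluation at the origin is bounded on `𝓕⁺`. -/
lemma sq_le_of_continuous_version (f : P.formPlus.domain) {u : ℝ≥0 → ℝ}
    (hu : u =ᵐ[P.mPlus] f) (hd : ∀ r, u r = u 0 + inner ℝ (P.kernel r) (P.derivLin f)) :
    u 0 ^ 2 ≤ P.evalConst * P.formPlus.energyOne f := by
  set M := P.mPlus.real (Set.Iic 1) with hM
  have hMpos : 0 < M := ENNReal.toReal_pos (P.mPlus_Iic_pos one_pos).ne' (P.mPlus_Iic_lt_top 1).ne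
  set N := ‖P.kernel 1‖ * ‖P.derivLin f‖ with hN
  have hint : Integrable (fun r => (f : Lp ℝ 2 P.mPlus) r ^ 2) P.mPlus :=
    (Lp.memLp (f : Lp ℝ 2 P.mPlus)).integrable_sq
  have hle : ∀ᵐ r ∂P.mPlus.restrict (Set.Iic 1),
      u 0 ^ 2 ≤ 2 * (f : Lp ℝ 2 P.mPlus) r ^ 2 + 2 * N ^ 2 := by
    rw [ae_restrict_iff' measurableSet_Iic]
    filter_upwards [hu] with r hr hr1
    have h1 : |inner ℝ (P.kernel r) (P.derivLin f)| ≤ N :=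
      (abs_real_inner_le_norm _ _).trans
        (mul_le_mul_of_nonneg_right (P.norm_kernel_le hr1) (norm_nonneg _))
    have h2 : inner ℝ (P.kernel r) (P.derivLin f) ^ 2 ≤ N ^ 2 := sq_le_sq' (abs_le.1 h1).1
      (abs_le.1 h1).2
    have h3 := hd r
    rw [hr] at h3
    have h4 : u 0 = (f : Lp ℝ 2 P.mPlus) r - inner ℝ (P.kernel r) (P.derivLin f) := by linarith
    rw [h4]
    nlinarith [sq_nonneg ((f : Lp ℝ 2 P.mPlus) r + inner ℝ (P.kernel r) (P.derivLin f))]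
  have hfin : P.mPlus (Set.Iic 1) ≠ ⊤ := (P.mPlus_Iic_lt_top 1).ne
  have h5 : ∫ r in Set.Iic 1, u 0 ^ 2 ∂P.mPlus
      ≤ ∫ r in Set.Iic 1, (2 * (f : Lp ℝ 2 P.mPlus) r ^ 2 + 2 * N ^ 2) ∂P.mPlus :=
    integral_mono_ae (integrableOn_const hfin)
      ((hint.integrableOn.const_mul 2).add (integrableOn_const hfin)) hle
  rw [integral_add (hint.integrableOn.const_mul 2) (integrableOn_const hfin), setIntegral_const,
    setIntegral_const, integral_const_mul, smul_eq_mul, smul_eq_mul, ← hM] at h5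
  have h6 : ∫ r in Set.Iic 1, (f : Lp ℝ 2 P.mPlus) r ^ 2 ∂P.mPlus ≤ ‖(f : Lp ℝ 2 P.mPlus)‖ ^ 2 := by
    refine (setIntegral_le_integral hint (ae_of_all _ fun _ => sq_nonneg _)).trans_eq ?_
    rw [← real_inner_self_eq_norm_sq, L2.inner_def]
    simp [sq]
  have h7 : ‖(f : Lp ℝ 2 P.mPlus)‖ ^ 2 ≤ P.formPlus.energyOne f :=
    P.formPlus.norm_sq_le_energyOne f
  have h8 : ‖P.derivLin f‖ ^ 2 ≤ 2 * P.formPlus.energyOne f := by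
    have := P.formPlus.form_le_energyOne f
    rw [formPlus_self] at this
    linarith
  have h9 : M * u 0 ^ 2 ≤ 2 * P.formPlus.energyOne f
      + M * (2 * (‖P.kernel 1‖ ^ 2 * (2 * P.formPlus.energyOne f))) := by
    have : N ^ 2 ≤ ‖P.kernel 1‖ ^ 2 * (2 * P.formPlus.energyOne f) := by
      rw [hN, mul_pow]
      gcongr
    calc M * u 0 ^ 2 ≤ _ := h5
      _ ≤ _ := by
        gcongr
        linarith
  have hE := P.formPlus.energyOne_nonneg f
  have h10 : M * u 0 ^ 2 ≤ M * (P.evalConst * P.formPlus.energyOne f) := by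
    refine h9.trans ?_
    have : M * (P.evalConst * P.formPlus.energyOne f) = 4 * P.formPlus.energyOne f
      + M * (2 * (‖P.kernel 1‖ ^ 2 * (2 * P.formPlus.energyOne f))) := by
      rw [evalConst, ← hM]
      field_simp
      ring
    rw [this]
    linarith
  exact le_of_mul_le_mul_left h10 hMpos

/-- If the continuous version were below `1` at the origin, it would be so on a whole neighbourhood,
which has positive measure. Hence its value there is at least `1`, and the bound on evaluation
applies. -/
lemma one_le_of_ge_one_near_zero (e : P.formPlus.domain) (U : Set ℝ≥0) (hU : U ∈ 𝓝 0)
    (he : ∀ᵐ x ∂P.mPlus, x ∈ U → 1 ≤ (e : Lp ℝ 2 P.mPlus) x) :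
    1 ≤ P.evalConst * P.formPlus.energyOne e := by
  obtain ⟨u, hu, hue, hd⟩ := P.exists_continuous_version e
  suffices h : 1 ≤ u 0 by
    have := P.sq_le_of_continuous_version e hue hd
    nlinarith
  by_contra! hlt
  have h1 : U ∩ {x | u x < 1} ∈ 𝓝 (0 : ℝ≥0) :=
    inter_mem hU (hu.continuousAt.eventually_lt_const hlt)
  have h2 : ∀ᵐ x ∂halfLineVolume, x ∉ U ∩ {x | u x < 1} := by
    refine P.absolutelyContinuous_mPlus.ae_le ?_
    filter_upwards [he, hue] with x hx hux
    rintro ⟨hxU, hxu⟩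
    have := hx hxU
    rw [← hux] at this
    exact absurd hxu (not_lt.2 this)
  have h3 : halfLineVolume (U ∩ {x | u x < 1}) = 0 := measure_eq_zero_iff_ae_notMem.2 h2
  exact (Measure.measure_pos_of_mem_nhds halfLineVolume h1).ne' h3

lemma exists_isQuasiValue_plus (f : P.formPlus.domain) :
    ∃ a, IsQuasiValue P.formPlus f 0 a ∧ a ^ 2 ≤ P.evalConst * P.formPlus.energyOne f := by
  obtain ⟨u, hu, hue, hd⟩ := P.exists_continuous_version f
  exact ⟨u 0, ⟨u, .of_continuous _ hu, hue, rfl⟩, P.sq_le_of_continuous_version f hue hd⟩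

end Params

/-! ### Test functions, constants and density on the half-line -/

namespace Params

variable (P : Params)

lemma memLp_two_mPlus_of_continuous {φ : ℝ → ℝ} (hφ : Continuous φ) (hc : HasCompactSupport φ) :
    MemLp (fun r : ℝ≥0 => φ r) 2 P.mPlus := by
  have hcont : Continuous fun r : ℝ≥0 => φ r := hφ.comp NNReal.continuous_coe
  have hc' : HasCompactSupport fun r : ℝ≥0 => φ r :=
    hc.comp_isClosedEmbedding NNReal.isClosedEmbedding_coe
  rw [memLp_two_iff_integrable_sq hcont.aestronglyMeasurable, integrable_mPlus_iff]
  have hsq : HasCompactSupport fun r : ℝ≥0 => φ r ^ 2 := by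
    simp_rw [sq]
    exact hc'.mul_left
  simpa [mul_comm] using
    P.ρ_loc.integrable_smul_left_of_hasCompactSupport (hcont.pow 2) hsq

/-- The restriction of a test function on `ℝ` belongs to `𝓕⁺`. -/
lemma exists_testFunction {φ : ℝ → ℝ} (hφ : ContDiff ℝ 1 φ) (hc : HasCompactSupport φ) :
    ∃ f : P.formPlus.domain, f =ᵐ[P.mPlus] (fun r : ℝ≥0 => φ r) ∧
      IsQuasiValue P.formPlus f 0 (φ 0) := by
  have h1 := P.memLp_two_mPlus_of_continuous hφ.continuous hc
  have h2 := P.memLp_two_mPlus_of_continuous (hφ.continuous_deriv le_rfl) hc.deriv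
  have h3 : (h1.toLp _, h2.toLp _) ∈ P.derivGraph := by
    refine ⟨φ 0, ?_⟩
    filter_upwards [h1.coeFn_toLp] with r hr
    rw [hr]
    rw [setIntegral_congr_ae (g := fun s : ℝ≥0 => deriv φ s) measurableSet_Iic, setIntegral_Iic_coe,
      intervalIntegral.integral_deriv_eq_sub]
    · simp
    · exact fun x _ => hφ.differentiable one_ne_zero x
    · exact (hφ.continuous_deriv le_rfl).intervalIntegrable _ _
    · filter_upwards [P.ae_halfLine h2.coeFn_toLp] with s hs _ using hs
  obtain ⟨hf, -⟩ := P.exists_derivLin_eq h3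
  refine ⟨⟨_, hf⟩, h1.coeFn_toLp, fun r => φ r, .of_continuous _ ?_, h1.coeFn_toLp.symm, by simp⟩
  exact hφ.continuous.comp NNReal.continuous_coe

/-- If `m₊` is finite, then the constants belong to `𝓕⁺` and have zero energy. -/
lemma exists_const_plus (hρ : Integrable P.ρ halfLineVolume) (a : ℝ) :
    ∃ f : P.formPlus.domain, f =ᵐ[P.mPlus] (fun _ => a) ∧
      IsQuasiValue P.formPlus f 0 a ∧ ∀ g, P.formPlus.form g f = 0 := by
  have h1 : MemLp (fun _ : ℝ≥0 => a) 2 P.mPlus := by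
    rw [memLp_two_iff_integrable_sq aestronglyMeasurable_const, integrable_mPlus_iff]
    exact hρ.mul_const _
  have h3 : (h1.toLp _, 0) ∈ P.derivGraph := by
    refine P.mem_derivGraph_iff.2 ⟨a, ?_⟩
    filter_upwards [h1.coeFn_toLp] with r hr
    rw [hr, inner_zero_right, add_zero]
  obtain ⟨hf, hf0⟩ := P.exists_derivLin_eq h3
  refine ⟨⟨_, hf⟩, h1.coeFn_toLp, ⟨fun r => a, .of_continuous _ continuous_const,
    h1.coeFn_toLp.symm, rfl⟩, fun g => ?_⟩
  rw [formPlus_apply]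
  rw [hf0, inner_zero_right, mul_zero]

/-- Functions in `𝓕⁺` that vanish at the origin are dense in `L²(m₊)`. -/
lemma eq_zero_of_forall_inner_plus {h : Lp ℝ 2 P.mPlus}
    (hh : ∀ f : P.formPlus.domain, IsQuasiValue P.formPlus f 0 0 →
      inner ℝ h (f : Lp ℝ 2 P.mPlus) = 0) : h = 0 := by
  have hloc : LocallyIntegrable (fun r => P.ρ r * h r) halfLineVolume := by
    rw [locallyIntegrable_iff]
    intro K hK
    obtain ⟨R, hR⟩ := hK.bddAbove
    have : IsFiniteMeasure (P.mPlus.restrict (Set.Iic R)) :=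
      ⟨by rw [Measure.restrict_apply_univ]; exact P.mPlus_Iic_lt_top R⟩
    have h1 : IntegrableOn h (Set.Iic R) P.mPlus :=
      ((Lp.memLp h).restrict (Set.Iic R)).integrable (by norm_num)
    rw [← integrable_indicator_iff measurableSet_Iic, integrable_mPlus_iff] at h1
    simp_rw [← Set.indicator_mul_right] at h1
    rw [integrable_indicator_iff measurableSet_Iic] at h1
    exact h1.mono_set fun x hx => hR hx
  have h2 : ∀ᵐ x : ℝ, x ∈ Set.Ioi (0 : ℝ) → extendZero (fun r => P.ρ r * h r) x = 0 := by
    -- Test functions supported in the open half-line vanish at the origin, so the hypothesis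
    -- applies to them; the omitted point `0` is null.
    refine isOpen_Ioi.ae_eq_zero_of_integral_contDiff_smul_eq_zero
      ((locallyIntegrable_extendZero hloc).locallyIntegrableOn _) fun φ hφ hc hs => ?_
    obtain ⟨f, hf, hf0⟩ := P.exists_testFunction (hφ.of_le (by simp)) hc
    have hφ0 : φ 0 = 0 := image_eq_zero_of_notMem_tsupport fun h => lt_irrefl (0 : ℝ) (hs h)
    rw [hφ0] at hf0
    have h3 := hh f hf0
    rw [L2.inner_def, integral_mPlus] at h3
    rw [← h3]
    have h4 : ∫ x, φ x • extendZero (fun r => P.ρ r * h r) x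
        = ∫ x in Set.Ici 0, φ x • extendZero (fun r => P.ρ r * h r) x := by
      refine (setIntegral_eq_integral_of_forall_compl_eq_zero fun x hx => ?_).symm
      rw [extendZero, Set.indicator_of_notMem hx, smul_zero]
    rw [h4, ← integral_halfLineVolume_coe]
    refine integral_congr_ae ?_
    filter_upwards [P.ae_halfLine hf] with r hr
    rw [extendZero_coe, hr]
    simp only [smul_eq_mul, RCLike.inner_apply, conj_trivial]
    ring
  have h5 : ∀ᵐ x : ℝ, 0 ≤ x → extendZero (fun r => P.ρ r * h r) x = 0 := by
    have hne : ∀ᵐ x : ℝ, x ≠ 0 := by simp [ae_iff]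
    filter_upwards [h2, hne] with x hx hxn h0 using hx (lt_of_le_of_ne h0 hxn.symm)
  refine Lp.ext ?_
  refine EventuallyEq.trans ?_ (Lp.coeFn_zero ℝ 2 P.mPlus).symm
  refine P.mPlus_absolutelyContinuous.ae_le ?_
  filter_upwards [ae_halfLineVolume_coe.2 h5, P.ρ_pos] with r hr hρ
  rw [extendZero_coe] at hr
  simpa [hρ.ne'] using hr

lemma dense_domain_plus : Dense (P.formPlus.domain : Set (Lp ℝ 2 P.mPlus)) := by
  rw [Submodule.dense_iff_topologicalClosure_eq_top, Submodule.topologicalClosure_eq_top_iff,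
    Submodule.eq_bot_iff]
  intro h hh
  refine P.eq_zero_of_forall_inner_plus fun f _ => ?_
  rw [real_inner_comm]
  exact (Submodule.mem_orthogonal _ _).1 hh f f.2

/-- Evaluation at the origin is not the zero functional; this closes the argument that `𝒢` is not
self-adjoint. -/
lemma exists_isQuasiValue_one_plus : ∃ f : P.formPlus.domain, IsQuasiValue P.formPlus f 0 1 := by
  let b : ContDiffBump (0 : ℝ) := default
  obtain ⟨f, -, hf⟩ := P.exists_testFunction (b.contDiff (n := 1)) b.hasCompactSupport
  refine ⟨f, ?_⟩
  rwa [b.one_of_mem_closedBall (Metric.mem_closedBall_self b.rIn_pos.le)] at hf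

end Params

/-! ### The form on `ℝ³` -/

/-- The identity holds at the origin too: division by zero makes `psi γ 0` and its reciprocal equal
to `0`, which is also the limit of `1 / ψ_γ²` there. So `1 / ψ_γ²` is continuous on all of `ℝ³`. -/
lemma one_div_psi_sq (γ : ℝ) (x : R3) :
    1 / psi γ x ^ 2 = (Real.exp (γ * ‖x‖) * (2 * Real.pi * ‖x‖)) ^ 2 := by
  rw [psi, div_pow, one_div_div, mul_pow, neg_mul, Real.exp_neg, inv_pow, div_inv_eq_mul]
  ring

lemma continuous_one_div_psi_sq (γ : ℝ) : Continuous fun x : R3 => 1 / psi γ x ^ 2 := by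
  simp_rw [one_div_psi_sq]
  fun_prop

lemma gradient_apply (φ : R3 → ℝ) (x : R3) (i : Fin 3) :
    gradient φ x i = fderiv ℝ φ x (EuclideanSpace.single i 1) := by
  rw [← inner_gradient_left (𝕜 := ℝ), EuclideanSpace.inner_single_right]
  simp

lemma norm_gradient (φ : R3 → ℝ) (x : R3) : ‖gradient φ x‖ = ‖fderiv ℝ φ x‖ := by
  rw [gradient, LinearIsometryEquiv.norm_map]

lemma continuous_gradient {φ : R3 → ℝ} (hφ : ContDiff ℝ 1 φ) : Continuous (gradient φ) :=
  (InnerProductSpace.toDual ℝ R3).symm.continuous.comp (hφ.continuous_fderiv one_ne_zero)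

namespace Params

variable (P : Params)

lemma mThree_absolutelyContinuous : P.mThree ≪ (volume : Measure R3) :=
  withDensity_absolutelyContinuous _ _

lemma absolutelyContinuous_mThree : (volume : Measure R3) ≪ P.mThree :=
  withDensity_absolutelyContinuous' (measurable_psi_sq P.γ).aemeasurable.ennreal_ofReal
    (by filter_upwards [ae_psi_sq_pos P.γ] with x hx
        exact (ENNReal.ofReal_pos.2 hx).ne')

lemma integrable_mThree_iff {f : R3 → ℝ} :
    Integrable f P.mThree ↔ Integrable (fun x => psi P.γ x ^ 2 * f x) := by
  rw [mThree, integrable_withDensity_iff_integrable_smul₀'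
    (measurable_psi_sq P.γ).aemeasurable.ennreal_ofReal (by simp)]
  simp only [ENNReal.toReal_ofReal (sq_nonneg _), smul_eq_mul]

lemma integral_mThree (f : R3 → ℝ) :
    ∫ x, f x ∂P.mThree = ∫ x, psi P.γ x ^ 2 * f x := by
  rw [mThree, integral_withDensity_eq_integral_toReal_smul₀
    (measurable_psi_sq P.γ).aemeasurable.ennreal_ofReal (by simp)]
  simp only [ENNReal.toReal_ofReal (sq_nonneg _), smul_eq_mul]

lemma psi_sq_eq (γ : ℝ) (x : R3) :
    psi γ x ^ 2 = (fun t : ℝ => Real.exp (-γ * t) ^ 2 / (2 * Real.pi * t) ^ 2) ‖x‖ := by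
  rw [psi, div_pow]

/-- The Jacobian cancels the singularity of the weight, leaving on each ray the density `e^{-2γt} /
(2π)²` of a one-dimensional problem. Local finiteness of `m_γ`, its finiteness for `γ > 0` and the
positive capacity of the origin all rest on this. -/
lemma psi_sq_radial (γ : ℝ) {t : ℝ} (ht : 0 < t) :
    t ^ (Module.finrank ℝ R3 - 1) • (Real.exp (-γ * t) ^ 2 / (2 * Real.pi * t) ^ 2)
      = Real.exp (-(2 * γ) * t) / (2 * Real.pi) ^ 2 := by
  have h1 : Real.exp (-γ * t) ^ 2 = Real.exp (-(2 * γ) * t) := by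
    rw [← Real.exp_nat_mul]
    congr 1
    push_cast
    ring
  rw [h1, finrank_euclideanSpace_fin, smul_eq_mul]
  field_simp

instance : IsFiniteMeasureOnCompacts P.mThree where
  lt_top_of_isCompact K hK := by
    obtain ⟨R, hR⟩ := hK.isBounded.subset_ball (0 : R3)
    refine (measure_mono hR).trans_lt ?_
    have h : IntegrableOn (fun x : R3 => psi P.γ x ^ 2) (Metric.ball 0 R) := by
      simp_rw [psi_sq_eq]
      rw [integrableOn_fun_norm_addHaar volume
        (f := fun t : ℝ => Real.exp (-P.γ * t) ^ 2 / (2 * Real.pi * t) ^ 2),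
        integrableOn_congr_fun (fun t ht => psi_sq_radial P.γ ht.1) measurableSet_Ioo]
      refine (Continuous.integrableOn_Icc (a := 0) (b := R) ?_).mono_set Set.Ioo_subset_Icc_self
      fun_prop
    rw [mThree, withDensity_apply _ Metric.isOpen_ball.measurableSet]
    exact h.lintegral_lt_top

lemma isFiniteMeasure_mThree (hγ : 0 < P.γ) : IsFiniteMeasure P.mThree := by
  have h : Integrable (fun x : R3 => psi P.γ x ^ 2) := by
    simp_rw [psi_sq_eq]
    rw [integrable_fun_norm_addHaar volume
      (f := fun t : ℝ => Real.exp (-P.γ * t) ^ 2 / (2 * Real.pi * t) ^ 2),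
      integrableOn_congr_fun (fun t (ht : t ∈ Set.Ioi (0 : ℝ)) => psi_sq_radial P.γ ht)
        measurableSet_Ioi]
    exact (integrableOn_exp_mul_Ioi (by linarith) 0).div_const _
  refine ⟨?_⟩
  rw [mThree, withDensity_apply _ MeasurableSet.univ, Measure.restrict_univ]
  exact h.lintegral_lt_top

lemma memLp_div_psi_sq {φ : R3 → ℝ} (hφ : Continuous φ) (hc : HasCompactSupport φ) :
    MemLp (fun x => φ x * (1 / psi P.γ x ^ 2)) 2 P.mThree := by
  have hcont := hφ.mul (continuous_one_div_psi_sq P.γ)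
  exact hcont.memLp_of_hasCompactSupport hc.mul_right

/-- The element of `L²(m_γ)` that represents `f ↦ ∫ f φ dx`. -/
def testKernel {φ : R3 → ℝ} (hφ : Continuous φ) (hc : HasCompactSupport φ) : Lp ℝ 2 P.mThree :=
  (P.memLp_div_psi_sq hφ hc).toLp _

lemma inner_testKernel {φ : R3 → ℝ} (hφ : Continuous φ) (hc : HasCompactSupport φ)
    (f : Lp ℝ 2 P.mThree) : inner ℝ (P.testKernel hφ hc) f = ∫ x, f x * φ x := by
  rw [L2.inner_def, integral_mThree]
  refine integral_congr_ae ?_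
  filter_upwards [ae_psi_sq_pos P.γ, P.ae_volume (P.memLp_div_psi_sq hφ hc).coeFn_toLp]
    with x hx hk
  rw [testKernel, hk]
  have hx' : psi P.γ x ≠ 0 := fun h => by simp [h] at hx
  simp only [RCLike.inner_apply, conj_trivial]
  field_simp

lemma memLp_div_psi_sq_smul {φ : R3 → ℝ} (hφ : Continuous φ) (hc : HasCompactSupport φ)
    (i : Fin 3) : MemLp (fun x => (φ x * (1 / psi P.γ x ^ 2)) • EuclideanSpace.single i (1 : ℝ))
      2 P.mThree :=
  (ContinuousLinearMap.toSpanSingleton ℝ (EuclideanSpace.single i (1 : ℝ))).comp_memLp'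
    (P.memLp_div_psi_sq hφ hc)

/-- The element of `L²(m_γ; ℝ³)` that represents `F ↦ ∫ Fᵢ φ dx`. -/
def testKernelVec {φ : R3 → ℝ} (hφ : Continuous φ) (hc : HasCompactSupport φ) (i : Fin 3) :
    Lp R3 2 P.mThree :=
  (P.memLp_div_psi_sq_smul hφ hc i).toLp _

lemma inner_testKernelVec {φ : R3 → ℝ} (hφ : Continuous φ) (hc : HasCompactSupport φ) (i : Fin 3)
    (F : Lp R3 2 P.mThree) : inner ℝ (P.testKernelVec hφ hc i) F = ∫ x, F x i * φ x := by
  rw [L2.inner_def, integral_mThree]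
  refine integral_congr_ae ?_
  filter_upwards [ae_psi_sq_pos P.γ, P.ae_volume (P.memLp_div_psi_sq_smul hφ hc i).coeFn_toLp]
    with x hx hk
  rw [testKernelVec, hk, real_inner_smul_left, EuclideanSpace.inner_single_left]
  have hx' : psi P.γ x ≠ 0 := fun h => by simp [h] at hx
  simp only [map_one, one_mul]
  field_simp

lemma gradGraph_functional (x : Lp ℝ 2 P.mThree × Lp R3 2 P.mThree) (hx : x ∈ P.gradGraph)
    (h0 : x.1 = 0) : x.2 = 0 := by
  obtain ⟨f, F⟩ := x
  obtain rfl : f = 0 := h0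
  have h1 : ∀ i : Fin 3, ∀ᵐ y : R3, F y i = 0 := fun i => by
    refine ae_eq_zero_of_integral_contDiff_smul_eq_zero ?_ fun φ hφ hc => ?_
    · have h := P.locallyIntegrable_mThree F
      rw [locallyIntegrable_iff] at h ⊢
      exact fun K hK => (EuclideanSpace.proj (𝕜 := ℝ) i).integrable_comp (h K hK)
    · have h := hx φ hφ hc i
      have h2 : ∫ y : R3, (0 : Lp ℝ 2 P.mThree) y * fderiv ℝ φ y (EuclideanSpace.single i 1)
          = 0 := by
        refine integral_eq_zero_of_ae ?_
        filter_upwards [P.ae_volume (Lp.coeFn_zero ℝ 2 P.mThree)] with y hy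
        rw [hy, Pi.zero_apply, zero_mul]
      rw [h2] at h
      simp only [smul_eq_mul]
      simp_rw [mul_comm (φ _)]
      linarith
  refine Lp.ext (EventuallyEq.trans ?_ (Lp.coeFn_zero R3 2 P.mThree).symm)
  refine P.mThree_absolutelyContinuous.ae_le ?_
  filter_upwards [ae_all_iff.2 h1] with y hy
  ext i
  exact hy i

/-- The weak gradient on `𝓕³`. -/
def gradLin : P.formThree.domain →ₗ[ℝ] Lp R3 2 P.mThree := P.grad.toFun

lemma exists_gradLin_eq {f : Lp ℝ 2 P.mThree} {F : Lp R3 2 P.mThree} (h : (f, F) ∈ P.gradGraph) :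
    ∃ hf : f ∈ P.formThree.domain, P.gradLin ⟨f, hf⟩ = F :=
  exists_toLinearPMap_eq P.gradGraph_functional h

lemma mem_gradGraph (f : P.formThree.domain) :
    ((f : Lp ℝ 2 P.mThree), P.gradLin f) ∈ P.gradGraph := by
  have h := LinearPMap.mem_graph P.gradGraph.toLinearPMap f
  rwa [Submodule.toLinearPMap_graph_eq _ P.gradGraph_functional] at h

lemma formThree_apply (f g : P.formThree.domain) :
    P.formThree.form f g = 1 / 2 * inner ℝ (P.gradLin f) (P.gradLin g) := rfl

lemma formThree_self (f : P.formThree.domain) :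
    P.formThree.form f f = 1 / 2 * ‖P.gradLin f‖ ^ 2 := by
  rw [formThree_apply, real_inner_self_eq_norm_sq]

/-- For a fixed test function, both sides of the weak gradient identity are inner products with
fixed elements of `L²(m_γ)`, so the identity passes to limits. -/
instance : CompleteSpace P.formThree.EnergySpace := by
  refine P.formThree.completeSpace_of_closed P.gradLin (c := 1 / 2) (by norm_num)
    P.formThree_self fun u f g hf hg => ?_
  refine P.exists_gradLin_eq fun φ hφ hc i => ?_
  have hcont : Continuous fun y : R3 => fderiv ℝ φ y (EuclideanSpace.single i 1) :=
    (hφ.continuous_fderiv (by simp)).clm_apply continuous_const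
  have hsupp : HasCompactSupport fun y : R3 => fderiv ℝ φ y (EuclideanSpace.single i 1) :=
    hc.fderiv_apply ℝ (EuclideanSpace.single i 1)
  have h1 : ∀ n, inner ℝ (P.testKernel hcont hsupp) (u n : Lp ℝ 2 P.mThree)
      = -inner ℝ (P.testKernelVec hφ.continuous hc i) (P.gradLin (u n)) := fun n => by
    rw [inner_testKernel, inner_testKernelVec]
    exact P.mem_gradGraph (u n) φ hφ hc i
  have h2 := (tendsto_const_nhds (x := P.testKernel hcont hsupp)).inner (𝕜 := ℝ) hf
  have h3 := ((tendsto_const_nhds (x := P.testKernelVec hφ.continuous hc i)).inner (𝕜 := ℝ) hg).neg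
  have h4 := tendsto_nhds_unique h2 (h3.congr fun n => (h1 n).symm)
  rwa [inner_testKernel, inner_testKernelVec] at h4

/-- `C¹` functions which are, with their gradients, square integrable. -/
structure IsCore (φ : R3 → ℝ) : Prop where
  contDiff : ContDiff ℝ 1 φ
  memLp : MemLp φ 2 P.mThree
  memLp_gradient : MemLp (gradient φ) 2 P.mThree

variable {P}

lemma IsCore.of_hasCompactSupport {φ : R3 → ℝ} (hφ : ContDiff ℝ 1 φ) (hc : HasCompactSupport φ) :
    P.IsCore φ where
  contDiff := hφ
  memLp := hφ.continuous.memLp_of_hasCompactSupport hc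
  memLp_gradient := by
    refine (continuous_gradient hφ).memLp_of_hasCompactSupport ?_
    exact (hc.fderiv ℝ).comp_left (map_zero (InnerProductSpace.toDual ℝ R3).symm)

/-- The classical gradient is the weak one, by integration by parts against compactly supported test
functions. -/
lemma IsCore.exists_domain {φ : R3 → ℝ} (h : P.IsCore φ) : ∃ f : P.formThree.domain,
    f =ᵐ[P.mThree] φ ∧ P.gradLin f =ᵐ[P.mThree] gradient φ := by
  have h1 : (h.memLp.toLp φ, h.memLp_gradient.toLp _) ∈ P.gradGraph := by
    intro η hη hc i
    have e1 : ∫ y : R3, (h.memLp.toLp φ) y * fderiv ℝ η y (EuclideanSpace.single i 1)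
        = ∫ y : R3, φ y * fderiv ℝ η y (EuclideanSpace.single i 1) := by
      refine integral_congr_ae ?_
      filter_upwards [P.ae_volume h.memLp.coeFn_toLp] with y hy
      rw [hy]
    have e2 : ∫ y : R3, (h.memLp_gradient.toLp _) y i * η y
        = ∫ y : R3, fderiv ℝ φ y (EuclideanSpace.single i 1) * η y := by
      refine integral_congr_ae ?_
      filter_upwards [P.ae_volume h.memLp_gradient.coeFn_toLp] with y hy
      rw [hy, gradient_apply]
    simp only
    rw [e1, e2]
    have c1 : Continuous fun y : R3 => fderiv ℝ φ y (EuclideanSpace.single i 1) :=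
      (h.contDiff.continuous_fderiv one_ne_zero).clm_apply continuous_const
    have c2 : Continuous fun y : R3 => fderiv ℝ η y (EuclideanSpace.single i 1) :=
      (hη.continuous_fderiv (by simp)).clm_apply continuous_const
    refine integral_mul_fderiv_eq_neg_fderiv_mul_of_integrable ?_ ?_ ?_
      (fun x _ => h.contDiff.differentiable one_ne_zero x)
      (fun x _ => hη.differentiable (by simp) x)
    · exact (c1.mul hη.continuous).integrable_of_hasCompactSupport hc.mul_left
    · exact (h.contDiff.continuous.mul c2).integrable_of_hasCompactSupport
        (hc.fderiv_apply ℝ _).mul_left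
    · exact (h.contDiff.continuous.mul hη.continuous).integrable_of_hasCompactSupport hc.mul_left
  obtain ⟨hf, hf'⟩ := P.exists_gradLin_eq h1
  refine ⟨⟨_, hf⟩, h.memLp.coeFn_toLp, ?_⟩
  rw [hf']
  exact h.memLp_gradient.coeFn_toLp

lemma isQuasiValue_of_continuous {f : P.formThree.domain} {φ : R3 → ℝ} (hφ : Continuous φ)
    (hf : f =ᵐ[P.mThree] φ) : IsQuasiValue P.formThree f 0 (φ 0) :=
  ⟨φ, .of_continuous _ hφ, hf.symm, rfl⟩

variable (P)

/-- If `γ > 0`, then the constants belong to `𝓕³` and have zero energy. -/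
lemma exists_const_three (hγ : 0 < P.γ) (a : ℝ) :
    ∃ f : P.formThree.domain, f =ᵐ[P.mThree] (fun _ => a) ∧
      IsQuasiValue P.formThree f 0 a ∧ ∀ g, P.formThree.form g f = 0 := by
  have := P.isFiniteMeasure_mThree hγ
  have hg : gradient (fun _ : R3 => a) = fun _ => 0 := by
    ext x
    simp [gradient]
  have hcore : P.IsCore fun _ => a :=
    ⟨contDiff_const, memLp_const a, by rw [hg]; exact memLp_const 0⟩
  obtain ⟨f, hf, hf'⟩ := hcore.exists_domain
  refine ⟨f, hf, isQuasiValue_of_continuous continuous_const hf, fun g => ?_⟩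
  have h0 : P.gradLin f = 0 := by
    refine Lp.ext (hf'.trans ?_)
    rw [hg]
    exact (Lp.coeFn_zero R3 2 P.mThree).symm
  rw [formThree_apply, h0, inner_zero_right, mul_zero]

/-- Functions in `𝓕³` that vanish at the origin are dense in `L²(m_γ)`. -/
lemma eq_zero_of_forall_inner_three {h : Lp ℝ 2 P.mThree}
    (hh : ∀ f : P.formThree.domain, IsQuasiValue P.formThree f 0 0 →
      inner ℝ h (f : Lp ℝ 2 P.mThree) = 0) : h = 0 := by
  have hloc : LocallyIntegrable (fun x => psi P.γ x ^ 2 * h x) := by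
    rw [locallyIntegrable_iff]
    intro K hK
    have : IsFiniteMeasure (P.mThree.restrict K) :=
      ⟨by rw [Measure.restrict_apply_univ]; exact hK.measure_lt_top⟩
    have h1 : IntegrableOn h K P.mThree := ((Lp.memLp h).restrict K).integrable (by norm_num)
    rw [← integrable_indicator_iff hK.measurableSet, integrable_mThree_iff] at h1
    have h2 : (fun x => psi P.γ x ^ 2 * K.indicator h x)
        = K.indicator fun x => psi P.γ x ^ 2 * h x := by
      ext x
      by_cases hx : x ∈ K <;> simp [hx]
    rwa [h2, integrable_indicator_iff hK.measurableSet] at h1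
  have h2 : ∀ᵐ x : R3, x ∈ ({0}ᶜ : Set R3) → psi P.γ x ^ 2 * h x = 0 := by
    -- Test functions supported away from the origin vanish there, and a single point is null.
    refine isOpen_compl_singleton.ae_eq_zero_of_integral_contDiff_smul_eq_zero
      (hloc.locallyIntegrableOn _) fun φ hφ hc hs => ?_
    obtain ⟨f, hf, -⟩ :=
      (IsCore.of_hasCompactSupport (P := P) (hφ.of_le (by simp)) hc).exists_domain
    have hf0 := isQuasiValue_of_continuous hφ.continuous hf
    have hφ0 : φ 0 = 0 := image_eq_zero_of_notMem_tsupport fun h => hs h rfl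
    rw [hφ0] at hf0
    have h3 := hh f hf0
    rw [L2.inner_def, integral_mThree] at h3
    rw [← h3]
    refine integral_congr_ae ?_
    filter_upwards [P.ae_volume hf] with x hx
    rw [hx]
    simp only [smul_eq_mul, RCLike.inner_apply, conj_trivial]
    ring
  refine Lp.ext (EventuallyEq.trans ?_ (Lp.coeFn_zero ℝ 2 P.mThree).symm)
  refine P.mThree_absolutelyContinuous.ae_le ?_
  have hne : ∀ᵐ x : R3, x ≠ 0 := by simp [ae_iff]
  filter_upwards [h2, hne, ae_psi_sq_pos P.γ] with x hx hxn hpos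
  simpa [hpos.ne'] using hx hxn

lemma dense_domain_three : Dense (P.formThree.domain : Set (Lp ℝ 2 P.mThree)) := by
  rw [Submodule.dense_iff_topologicalClosure_eq_top, Submodule.topologicalClosure_eq_top_iff,
    Submodule.eq_bot_iff]
  intro h hh
  refine P.eq_zero_of_forall_inner_three fun f _ => ?_
  rw [real_inner_comm]
  exact (Submodule.mem_orthogonal _ _).1 hh f f.2

end Params

/-! ### Evaluation at the origin on `𝓕³` -/

/-- Integration in polar coordinates. -/
lemma lintegral_polar {F : R3 → ℝ≥0∞} (hF : Measurable F) :
    ∫⁻ x : R3, F x = ∫⁻ θ : Metric.sphere (0 : R3) 1, ∫⁻ t in Set.Ioi (0 : ℝ),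
      ENNReal.ofReal (t ^ 2) * F (t • (θ : R3)) ∂volume ∂(volume : Measure R3).toSphere := by
  have h1 : ∫⁻ x : R3, F x = ∫⁻ x : ({0}ᶜ : Set R3), F x ∂(volume.comap Subtype.val) := by
    rw [lintegral_subtype_comap (measurableSet_singleton _).compl, restrict_compl_singleton]
  have hG : Measurable fun p : Metric.sphere (0 : R3) 1 × Set.Ioi (0 : ℝ) =>
      F ((p.2 : ℝ) • (p.1 : R3)) := hF.comp (by fun_prop)
  have h2 := (volume : Measure R3).measurePreserving_homeomorphUnitSphereProd.lintegral_comp hG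
  have h3 : ∀ x : ({0}ᶜ : Set R3), (((homeomorphUnitSphereProd R3) x).2 : ℝ) •
      (((homeomorphUnitSphereProd R3) x).1 : R3) = x := fun x => by
    have h := (homeomorphUnitSphereProd R3).symm_apply_apply x
    rw [← homeomorphUnitSphereProd_symm_apply_coe, h]
  simp_rw [h3] at h2
  rw [h1, h2, lintegral_prod _ hG.aemeasurable]
  refine lintegral_congr fun θ => ?_
  have hg : Measurable fun y : Set.Ioi (0 : ℝ) => F ((y : ℝ) • (θ : R3)) := hF.comp (by fun_prop)
  rw [finrank_euclideanSpace_fin, Measure.volumeIoiPow, ← lintegral_subtype_comap measurableSet_Ioi]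
  exact lintegral_withDensity_eq_lintegral_mul _ (by fun_prop) hg

/-- The function `(1 - t) φ(tθ)` is `φ(0)` at `t = 0` and `0` at `t = 1`. Integrating its derivative
over `(0, 1)` gives the bound. -/
lemma enorm_apply_zero_le {φ : R3 → ℝ} (hφ : ContDiff ℝ 1 φ) {θ : R3} (hθ : ‖θ‖ = 1) :
    ‖φ 0‖ₑ ≤ ∫⁻ t in Set.Ioo (0 : ℝ) 1, (‖gradient φ (t • θ)‖ₑ + ‖φ (t • θ)‖ₑ) := by
  have hd : ∀ t : ℝ, HasDerivAt (fun t : ℝ => (1 - t) * φ (t • θ))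
      (-1 * φ (t • θ) + (1 - t) * fderiv ℝ φ (t • θ) θ) t := fun t => by
    have h1 : HasDerivAt (fun t : ℝ => t • θ) θ t := by
      simpa using (hasDerivAt_id t).smul_const θ
    have h2 := ((hφ.differentiable one_ne_zero (t • θ)).hasFDerivAt).comp_hasDerivAt t h1
    exact ((hasDerivAt_id t).const_sub 1).mul h2
  have hc : Continuous fun t : ℝ => -1 * φ (t • θ) + (1 - t) * fderiv ℝ φ (t • θ) θ := by
    have h1 := hφ.continuous_fderiv one_ne_zero
    have h2 := hφ.continuous
    have h3 : Continuous fun t : ℝ => t • θ := by fun_prop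
    exact (continuous_const.mul (h2.comp h3)).add
      ((continuous_const.sub continuous_id).mul ((h1.comp h3).clm_apply continuous_const))
  have h1 := intervalIntegral.integral_eq_sub_of_hasDerivAt (fun t _ => hd t)
    (hc.intervalIntegrable 0 1)
  have h2 : ‖φ 0‖ₑ = ‖∫ t in Set.Ioo (0 : ℝ) 1,
      (-1 * φ (t • θ) + (1 - t) * fderiv ℝ φ (t • θ) θ)‖ₑ := by
    rw [← integral_Ioc_eq_integral_Ioo, ← intervalIntegral.integral_of_le zero_le_one, h1]
    simp
  rw [h2]
  refine (enorm_integral_le_lintegral_enorm _).trans (setLIntegral_mono' measurableSet_Ioo ?_)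
  intro t ht
  rw [add_comm ‖gradient φ (t • θ)‖ₑ]
  refine (enorm_add_le _ _).trans (add_le_add (by simp) ?_)
  rw [← ofReal_norm, ← ofReal_norm, norm_gradient]
  refine ENNReal.ofReal_le_ofReal ?_
  rw [norm_mul, Real.norm_eq_abs, abs_of_nonneg (by linarith [ht.2])]
  have h3 := (fderiv ℝ φ (t • θ)).le_opNorm θ
  rw [hθ, mul_one] at h3
  calc (1 - t) * ‖fderiv ℝ φ (t • θ) θ‖ ≤ 1 * ‖fderiv ℝ φ (t • θ) θ‖ := by
        gcongr
        linarith [ht.1]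
    _ ≤ _ := by rwa [one_mul]

namespace Params

variable (P : Params)

/-- The one-dimensional bound is integrated over all directions `θ`; on the unit ball the radial
density `e^{-2γt} / (2π)²` is at least the constant on the left. -/
lemma enorm_apply_zero_mul_le {φ : R3 → ℝ} (hφ : ContDiff ℝ 1 φ) :
    ENNReal.ofReal (Real.exp (-(2 * |P.γ|)) / (2 * Real.pi) ^ 2)
        * (‖φ 0‖ₑ * (volume : Measure R3).toSphere Set.univ)
      ≤ ∫⁻ x in Metric.ball 0 1, (‖gradient φ x‖ₑ + ‖φ x‖ₑ) ∂P.mThree := by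
  set H : R3 → ℝ≥0∞ := fun x => ‖gradient φ x‖ₑ + ‖φ x‖ₑ with hH
  have hHm : Measurable H := (continuous_gradient hφ).measurable.enorm.add
    hφ.continuous.measurable.enorm
  have hw : Measurable fun x : R3 => ENNReal.ofReal (psi P.γ x ^ 2) :=
    (measurable_psi_sq P.γ).ennreal_ofReal
  have hFm : Measurable ((Metric.ball (0 : R3) 1).indicator fun x =>
      ENNReal.ofReal (psi P.γ x ^ 2) * H x) := (hw.mul hHm).indicator measurableSet_ball
  have h1 : ∫⁻ x in Metric.ball 0 1, H x ∂P.mThree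
      = ∫⁻ x, (Metric.ball (0 : R3) 1).indicator
        (fun x => ENNReal.ofReal (psi P.γ x ^ 2) * H x) x := by
    rw [mThree, restrict_withDensity measurableSet_ball,
      lintegral_withDensity_eq_lintegral_mul _ hw hHm, lintegral_indicator measurableSet_ball]
    rfl
  rw [h1, lintegral_polar hFm, mul_comm ‖φ 0‖ₑ, ← mul_assoc, mul_comm, ← mul_assoc,
    ← lintegral_const]
  refine lintegral_mono fun θ => ?_
  have hθ : ‖(θ : R3)‖ = 1 := mem_sphere_zero_iff_norm.1 θ.2
  rw [mul_comm]
  calc ENNReal.ofReal (Real.exp (-(2 * |P.γ|)) / (2 * Real.pi) ^ 2) * ‖φ 0‖ₑ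
      ≤ ENNReal.ofReal (Real.exp (-(2 * |P.γ|)) / (2 * Real.pi) ^ 2)
        * ∫⁻ t in Set.Ioo (0 : ℝ) 1, H (t • (θ : R3)) := by
        gcongr
        exact enorm_apply_zero_le hφ hθ
    _ = ∫⁻ t in Set.Ioo (0 : ℝ) 1, ENNReal.ofReal (Real.exp (-(2 * |P.γ|)) / (2 * Real.pi) ^ 2)
        * H (t • (θ : R3)) := by
        rw [lintegral_const_mul]
        exact hHm.comp (by fun_prop)
    _ ≤ ∫⁻ t in Set.Ioo (0 : ℝ) 1, ENNReal.ofReal (t ^ 2) *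
        (Metric.ball (0 : R3) 1).indicator (fun x => ENNReal.ofReal (psi P.γ x ^ 2) * H x)
          (t • (θ : R3)) := by
        refine setLIntegral_mono' measurableSet_Ioo fun t ht => ?_
        have hn : ‖t • (θ : R3)‖ = t := by
          rw [norm_smul, hθ, mul_one, Real.norm_eq_abs, abs_of_pos ht.1]
        rw [Set.indicator_of_mem (by rw [mem_ball_zero_iff, hn]; exact ht.2), ← mul_assoc,
          ← ENNReal.ofReal_mul (sq_nonneg t)]
        gcongr
        have h2 := psi_sq_radial P.γ ht.1
        rw [finrank_euclideanSpace_fin, smul_eq_mul] at h2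
        rw [psi_sq_eq, hn]
        simp only
        rw [show t ^ 2 * _ = _ from h2]
        gcongr
        have h3 : P.γ * t ≤ |P.γ| * 1 := by
          calc P.γ * t ≤ |P.γ| * t := mul_le_mul_of_nonneg_right (le_abs_self _) ht.1.le
            _ ≤ |P.γ| * 1 := mul_le_mul_of_nonneg_left ht.2.le (abs_nonneg _)
        nlinarith
    _ ≤ _ := lintegral_mono_set Set.Ioo_subset_Ioi_self

lemma lintegral_ball_le {F : Type*} [NormedAddCommGroup F] {f : R3 → F}
    (hf : AEStronglyMeasurable f P.mThree) :
    ∫⁻ x in Metric.ball 0 1, ‖f x‖ₑ ∂P.mThree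
      ≤ eLpNorm f 2 P.mThree * P.mThree (Metric.ball 0 1) ^ (1 / 2 : ℝ) := by
  have h := eLpNorm_le_eLpNorm_mul_rpow_measure_univ (p := 1) (q := 2) (by norm_num)
    (hf.mono_measure (Measure.restrict_le_self (s := Metric.ball 0 1)))
  rw [eLpNorm_one_eq_lintegral_enorm, Measure.restrict_apply_univ] at h
  refine h.trans ?_
  have : (1 / (1 : ℝ≥0∞).toReal - 1 / (2 : ℝ≥0∞).toReal : ℝ) = 1 / 2 := by norm_num
  rw [this]
  gcongr
  exact Measure.restrict_le_self

/-- Evaluation at the origin is bounded relative to `𝓔³₁` on `C¹` functions. -/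
lemma exists_sq_apply_zero_le : ∃ C : ℝ, ∀ (φ : R3 → ℝ) (f : P.formThree.domain), P.IsCore φ →
    f =ᵐ[P.mThree] φ → P.gradLin f =ᵐ[P.mThree] gradient φ →
    φ 0 ^ 2 ≤ C * P.formThree.energyOne f := by
  set κ : ℝ≥0∞ := ENNReal.ofReal (Real.exp (-(2 * |P.γ|)) / (2 * Real.pi) ^ 2)
    * (volume : Measure R3).toSphere Set.univ with hκ
  have hκ0 : κ ≠ 0 := by
    refine mul_ne_zero (ENNReal.ofReal_pos.2 (by positivity)).ne' ?_
    rw [Ne, Measure.measure_univ_eq_zero]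
    exact Measure.toSphere_ne_zero _
  have hκt : κ ≠ ⊤ := ENNReal.mul_ne_top ENNReal.ofReal_ne_top (measure_ne_top _ _)
  set V : ℝ≥0∞ := P.mThree (Metric.ball 0 1) ^ (1 / 2 : ℝ) with hV
  have hVt : V ≠ ⊤ := by
    have h : P.mThree (Metric.ball 0 1) < ⊤ :=
      (measure_mono Metric.ball_subset_closedBall).trans_lt
        (isCompact_closedBall (0 : R3) 1).measure_lt_top
    exact ENNReal.rpow_ne_top_of_nonneg (by norm_num) h.ne
  -- Here `6 = 2 · 2 + 2`, from `(a + b)² ≤ 2a² + 2b²`, `‖∇f‖² ≤ 2 𝓔³₁(f, f)` and `‖f‖² ≤ 𝓔³₁(f,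
  -- f)`.
  refine ⟨6 * (V.toReal / κ.toReal) ^ 2, fun φ f hφ hf hf' => ?_⟩
  have hκpos : 0 < κ.toReal := ENNReal.toReal_pos hκ0 hκt
  have h1 : κ * ‖φ 0‖ₑ ≤ (eLpNorm (P.gradLin f) 2 P.mThree
      + eLpNorm (f : Lp ℝ 2 P.mThree) 2 P.mThree) * V := by
    have h := P.enorm_apply_zero_mul_le hφ.contDiff
    rw [lintegral_add_left (continuous_gradient hφ.contDiff).measurable.enorm] at h
    rw [eLpNorm_congr_ae hf, eLpNorm_congr_ae hf', add_mul, hκ, mul_assoc, mul_comm _ ‖φ 0‖ₑ]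
    exact h.trans (add_le_add (P.lintegral_ball_le hφ.memLp_gradient.1)
      (P.lintegral_ball_le hφ.memLp.1))
  have h2 : κ.toReal * |φ 0| ≤ (‖P.gradLin f‖ + ‖(f : Lp ℝ 2 P.mThree)‖) * V.toReal := by
    have ht1 := Lp.eLpNorm_ne_top (P.gradLin f)
    have ht2 := Lp.eLpNorm_ne_top (f : Lp ℝ 2 P.mThree)
    have h := ENNReal.toReal_mono (ENNReal.mul_ne_top (ENNReal.add_ne_top.2 ⟨ht1, ht2⟩) hVt) h1
    rwa [ENNReal.toReal_mul, ENNReal.toReal_mul (b := V), ENNReal.toReal_add ht1 ht2, toReal_enorm,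
      Real.norm_eq_abs, ← Lp.norm_def, ← Lp.norm_def] at h
  have h3 : |φ 0| ≤ V.toReal / κ.toReal * (‖P.gradLin f‖ + ‖(f : Lp ℝ 2 P.mThree)‖) := by
    rw [div_mul_eq_mul_div, le_div_iff₀ hκpos]
    linarith
  have h4 : ‖(f : Lp ℝ 2 P.mThree)‖ ^ 2 ≤ P.formThree.energyOne f :=
    P.formThree.norm_sq_le_energyOne f
  have h5 : ‖P.gradLin f‖ ^ 2 ≤ 2 * P.formThree.energyOne f := by
    have := P.formThree.form_le_energyOne f
    rw [formThree_self] at this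
    linarith
  have h6 : (‖P.gradLin f‖ + ‖(f : Lp ℝ 2 P.mThree)‖) ^ 2 ≤ 6 * P.formThree.energyOne f := by
    nlinarith [sq_nonneg (‖P.gradLin f‖ - ‖(f : Lp ℝ 2 P.mThree)‖)]
  calc φ 0 ^ 2 = |φ 0| ^ 2 := (sq_abs _).symm
    _ ≤ (V.toReal / κ.toReal * (‖P.gradLin f‖ + ‖(f : Lp ℝ 2 P.mThree)‖)) ^ 2 := by gcongr
    _ = (V.toReal / κ.toReal) ^ 2 * (‖P.gradLin f‖ + ‖(f : Lp ℝ 2 P.mThree)‖) ^ 2 := mul_pow _ _ _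
    _ ≤ (V.toReal / κ.toReal) ^ 2 * (6 * P.formThree.energyOne f) := by gcongr
    _ = _ := by ring

end Params

/-! ### Mollification in `L²(m_γ)` -/

/-- A bump function supported in the ball of radius `1 / (n + 1)`. -/
def bump (n : ℕ) : ContDiffBump (0 : R3) where
  -- The ratio of the radii is `2`, which gives the factor `8 = 2³` in `eta_le`.
  rIn := 1 / (2 * (n + 1))
  rOut := 1 / (n + 1)
  rIn_pos := by positivity
  rIn_lt_rOut := by
    have : (0 : ℝ) < n + 1 := by positivity
    exact one_div_lt_one_div_of_lt this (by linarith)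

lemma bump_rOut (n : ℕ) : (bump n).rOut = 1 / (n + 1) := rfl

lemma bump_rOut_le_one (n : ℕ) : (bump n).rOut ≤ 1 := by
  rw [bump_rOut]
  exact div_le_one_of_le₀ (by linarith [(Nat.cast_nonneg n : (0 : ℝ) ≤ n)]) (by positivity)

lemma tendsto_bump_rOut : Tendsto (fun n => (bump n).rOut) atTop (𝓝 0) :=
  tendsto_one_div_add_atTop_nhds_zero_nat

/-- The mollifiers. -/
def eta (n : ℕ) : R3 → ℝ := (bump n).normed volume

lemma eta_nonneg (n : ℕ) (x : R3) : 0 ≤ eta n x := (bump n).nonneg_normed x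

lemma contDiff_eta (n : ℕ) : ContDiff ℝ ∞ (eta n) := (bump n).contDiff_normed

lemma continuous_eta (n : ℕ) : Continuous (eta n) := (bump n).continuous_normed

lemma hasCompactSupport_eta (n : ℕ) : HasCompactSupport (eta n) := (bump n).hasCompactSupport_normed

lemma eta_eq_zero {n : ℕ} {x : R3} (h : (bump n).rOut ≤ ‖x‖) : eta n x = 0 := by
  have h1 : x ∉ Function.support (eta n) := by
    rw [eta, ContDiffBump.support_normed_eq, mem_ball_zero_iff]
    exact not_lt.2 h
  simpa using h1

lemma integral_eta (n : ℕ) : ∫ x, eta n x = 1 := (bump n).integral_normed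

lemma lintegral_eta (n : ℕ) : ∫⁻ x, ENNReal.ofReal (eta n x) = 1 := by
  have h := ofReal_integral_eq_lintegral_ofReal (f := eta n) (bump n).integrable_normed
    (ae_of_all _ (eta_nonneg n))
  rw [← h, integral_eta, ENNReal.ofReal_one]

lemma eta_le (n : ℕ) (x : R3) :
    eta n x ≤ 8 / ((bump n).rOut ^ 3 * (volume : Measure R3).real (Metric.closedBall 0 1)) := by
  have h := (bump n).normed_le_div_measure_closedBall_rOut volume 2 (by
    have : (0 : ℝ) < n + 1 := by positivity
    simp only [bump]
    field_simp
    norm_num) x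
  rw [Measure.addHaar_real_closedBall' _ _ (bump n).rOut_pos.le, finrank_euclideanSpace_fin] at h
  norm_num at h ⊢
  exact h

section Weight

/-- The function `1 / |x|²`. -/
def invSq (x : R3) : ℝ≥0∞ := ENNReal.ofReal (1 / ‖x‖ ^ 2)

lemma measurable_invSq : Measurable invSq := by
  unfold invSq
  fun_prop

lemma lintegral_invSq_ball (R : ℝ) :
    ∫⁻ x, (Metric.ball 0 R).indicator invSq x
      = ENNReal.ofReal R * (volume : Measure R3).toSphere Set.univ := by
  rw [lintegral_polar (measurable_invSq.indicator measurableSet_ball), ← lintegral_const]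
  refine lintegral_congr fun θ => ?_
  have hθ : ‖(θ : R3)‖ = 1 := mem_sphere_zero_iff_norm.1 θ.2
  have h1 : ∀ t ∈ Set.Ioi (0 : ℝ), ENNReal.ofReal (t ^ 2) *
      (Metric.ball 0 R).indicator invSq (t • (θ : R3)) = (Set.Iio R).indicator 1 t := fun t ht => by
    have hn : ‖t • (θ : R3)‖ = t := by
      rw [norm_smul, hθ, mul_one, Real.norm_eq_abs, abs_of_pos ht]
    have ht' : t ≠ 0 := ne_of_gt ht
    by_cases h : t < R
    · rw [Set.indicator_of_mem (by rwa [mem_ball_zero_iff, hn]),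
        Set.indicator_of_mem (Set.mem_Iio.2 h), invSq, hn,
        ← ENNReal.ofReal_mul (sq_nonneg t), mul_one_div_cancel (pow_ne_zero 2 ht')]
      simp
    · rw [Set.indicator_of_notMem (by rwa [mem_ball_zero_iff, hn]),
        Set.indicator_of_notMem (fun h' => h (Set.mem_Iio.1 h')), mul_zero]
  rw [setLIntegral_congr_fun measurableSet_Ioi h1, lintegral_indicator_one measurableSet_Iio,
    Measure.restrict_apply measurableSet_Iio, Set.inter_comm, Set.Ioi_inter_Iio, Real.volume_Ioo,
    sub_zero]

/-- The Muckenhoupt constant of `1 / |x|²`. -/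
def muckenhoupt : ℝ≥0∞ :=
  4 + ENNReal.ofReal (32 / (volume : Measure R3).real (Metric.closedBall 0 1))
    * (volume : Measure R3).toSphere Set.univ

/-- If `|y + t| ≥ |y| / 2`, then `|y + t|⁻² ≤ 4 |y|⁻²`. Otherwise `|t| > |y| / 2`, so `eta n t`
vanishes unless the radius of the mollifier exceeds `|y| / 2`, and then `eta n t` is at most `8`
divided by `(|y| / 2)³` times the volume of the unit ball. -/
lemma eta_mul_invSq_le (n : ℕ) {y : R3} (hy : y ≠ 0) (t : R3) :
    ENNReal.ofReal (eta n t) * invSq (y + t) ≤ ENNReal.ofReal (eta n t) * (4 * invSq y) +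
      ENNReal.ofReal (64 / (‖y‖ ^ 3 * (volume : Measure R3).real (Metric.closedBall 0 1)))
        * (Metric.ball 0 (‖y‖ / 2)).indicator invSq (y + t) := by
  have hpos : 0 < ‖y‖ := norm_pos_iff.2 hy
  have hv : 0 < (volume : Measure R3).real (Metric.closedBall 0 1) :=
    ENNReal.toReal_pos (Metric.measure_closedBall_pos _ _ one_pos).ne' measure_closedBall_lt_top.ne
  rcases le_or_gt (‖y‖ / 2) ‖y + t‖ with h | h
  · refine le_add_right (mul_le_mul_right ?_ _)
    rw [invSq, invSq, show (4 : ℝ≥0∞) = ENNReal.ofReal 4 by simp,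
      ← ENNReal.ofReal_mul (by norm_num)]
    refine ENNReal.ofReal_le_ofReal ?_
    have hpos' : 0 < ‖y + t‖ := by linarith
    rw [mul_one_div, div_le_div_iff₀ (by positivity) (by positivity)]
    nlinarith
  · refine le_add_left ?_
    rw [Set.indicator_of_mem (by rwa [mem_ball_zero_iff])]
    refine mul_le_mul_left (ENNReal.ofReal_le_ofReal ?_) _
    rcases le_or_gt (bump n).rOut ‖t‖ with ht | ht
    · rw [eta_eq_zero ht]
      positivity
    · refine (eta_le n t).trans ?_
      have h1 : ‖y‖ ≤ ‖y + t‖ + ‖t‖ := by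
        have := norm_sub_le (y + t) t
        rwa [add_sub_cancel_right] at this
      have h2 : ‖y‖ / 2 ≤ (bump n).rOut := by linarith
      have h3 : (‖y‖ / 2) ^ 3 ≤ (bump n).rOut ^ 3 := pow_le_pow_left₀ (by positivity) h2 3
      have h4 := (bump n).rOut_pos
      rw [div_le_div_iff₀ (by positivity) (by positivity)]
      have h5 : ‖y‖ ^ 3 ≤ 8 * (bump n).rOut ^ 3 := by
        rw [div_pow] at h3
        linarith
      nlinarith

/-- The weight `1 / |x|²` satisfies the Muckenhoupt condition `A₁`. -/
lemma lintegral_eta_mul_invSq_le (n : ℕ) {y : R3} (hy : y ≠ 0) :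
    ∫⁻ t, ENNReal.ofReal (eta n t) * invSq (y + t) ≤ muckenhoupt * invSq y := by
  have hpos : 0 < ‖y‖ := norm_pos_iff.2 hy
  have hv : 0 < (volume : Measure R3).real (Metric.closedBall 0 1) :=
    ENNReal.toReal_pos (Metric.measure_closedBall_pos _ _ one_pos).ne' measure_closedBall_lt_top.ne
  have hm : Measurable fun t => ENNReal.ofReal (eta n t) :=
    (continuous_eta n).measurable.ennreal_ofReal
  have hm' : Measurable fun t => (Metric.ball 0 (‖y‖ / 2)).indicator invSq (y + t) :=
    (measurable_invSq.indicator measurableSet_ball).comp (measurable_const_add y)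
  refine (lintegral_mono (eta_mul_invSq_le n hy)).trans ?_
  -- The integral of `1 / |x|²` over the ball of radius `|y| / 2` is `|y| / 2` times the area of the
  -- sphere, so `64 / |y|³` becomes `32 / |y|²`.
  rw [lintegral_add_left (hm.mul_const _), lintegral_mul_const _ hm, lintegral_eta, one_mul,
    lintegral_const_mul _ hm',
    lintegral_add_left_eq_self (fun t => (Metric.ball 0 (‖y‖ / 2)).indicator invSq t) y,
    lintegral_invSq_ball, muckenhoupt, add_mul, ← mul_assoc,
    ← ENNReal.ofReal_mul (by positivity), mul_right_comm, invSq,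
    ← ENNReal.ofReal_mul (by positivity)]
  refine le_of_eq ?_
  congr 3
  field_simp
  norm_num

lemma psi_sq_eq_mul_invSq (γ : ℝ) (x : R3) : ENNReal.ofReal (psi γ x ^ 2)
    = ENNReal.ofReal (Real.exp (-(2 * γ) * ‖x‖) / (2 * Real.pi) ^ 2) * invSq x := by
  rw [invSq, ← ENNReal.ofReal_mul (by positivity), psi, div_pow, ← Real.exp_nat_mul, mul_pow]
  congr 1
  rw [div_mul_div_comm, mul_one]
  congr 2
  push_cast
  ring

/-- The mollifiers have radius at most `1`, and over that distance `e^{-2γ|x|}` changes by a factor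
of at most `e^{2|γ|}`. The remaining factor `1 / |x|²` is covered by the `A₁` condition. -/
lemma lintegral_eta_mul_psi_sq_le (γ : ℝ) (n : ℕ) {y : R3} (hy : y ≠ 0) :
    ∫⁻ t, ENNReal.ofReal (eta n t) * ENNReal.ofReal (psi γ (y + t) ^ 2)
      ≤ ENNReal.ofReal (Real.exp (2 * |γ|)) * muckenhoupt * ENNReal.ofReal (psi γ y ^ 2) := by
  set D := ENNReal.ofReal (Real.exp (2 * |γ|)) *
    ENNReal.ofReal (Real.exp (-(2 * γ) * ‖y‖) / (2 * Real.pi) ^ 2) with hD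
  have h1 : ∀ t, ENNReal.ofReal (eta n t) * ENNReal.ofReal (psi γ (y + t) ^ 2)
      ≤ D * (ENNReal.ofReal (eta n t) * invSq (y + t)) := fun t => by
    rcases le_or_gt (bump n).rOut ‖t‖ with ht | ht
    · simp [eta_eq_zero ht]
    · rw [psi_sq_eq_mul_invSq, mul_left_comm, hD, ← ENNReal.ofReal_mul (by positivity)]
      gcongr
      rw [← mul_div_assoc, ← Real.exp_add]
      gcongr
      have h2 : |‖y‖ - ‖y + t‖| ≤ 1 := by
        have h3 := abs_norm_sub_norm_le y (y + t)
        rw [sub_add_cancel_left, norm_neg] at h3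
        linarith [bump_rOut_le_one n]
      have h4 : γ * (‖y‖ - ‖y + t‖) ≤ |γ| * 1 := by
        refine (le_abs_self _).trans ?_
        rw [abs_mul]
        gcongr
      linarith
  have hm : Measurable fun t => ENNReal.ofReal (eta n t) * invSq (y + t) :=
    (continuous_eta n).measurable.ennreal_ofReal.mul
      (measurable_invSq.comp (measurable_const_add y))
  refine (lintegral_mono h1).trans ?_
  rw [lintegral_const_mul _ hm, psi_sq_eq_mul_invSq]
  calc D * ∫⁻ t, ENNReal.ofReal (eta n t) * invSq (y + t) ≤ D * (muckenhoupt * invSq y) := by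
        gcongr
        exact lintegral_eta_mul_invSq_le n hy
    _ = _ := by
        rw [hD]
        ring

end Weight

section Mollify

variable {F : Type*} [NormedAddCommGroup F] [NormedSpace ℝ F]

/-- The mollification `η_n * f`. -/
def mollify (n : ℕ) (f : R3 → F) : R3 → F :=
  convolution (eta n) f (ContinuousLinearMap.lsmul ℝ ℝ) volume

lemma mollify_apply (n : ℕ) (f : R3 → F) (x : R3) :
    mollify n f x = ∫ t, eta n t • f (x - t) := rfl

lemma convolutionExists_eta (n : ℕ) {f : R3 → F} (hf : LocallyIntegrable f) :
    ConvolutionExists (eta n) f (ContinuousLinearMap.lsmul ℝ ℝ) volume :=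
  (hasCompactSupport_eta n).convolutionExists_left _ (continuous_eta n) hf

lemma mollify_add (n : ℕ) {f g : R3 → F} (hf : LocallyIntegrable f) (hg : LocallyIntegrable g) :
    mollify n (f + g) = mollify n f + mollify n g :=
  (convolutionExists_eta n hf).distrib_add (convolutionExists_eta n hg)

lemma contDiff_mollify (n : ℕ) {f : R3 → F} (hf : LocallyIntegrable f) :
    ContDiff ℝ ∞ (mollify n f) :=
  (hasCompactSupport_eta n).contDiff_convolution_left _ (contDiff_eta n) hf

/-- Jensen's inequality. -/
lemma enorm_mollify_sq_le (n : ℕ) {f : R3 → F} (hf : StronglyMeasurable f) (x : R3) :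
    ‖mollify n f x‖ₑ ^ 2 ≤ ∫⁻ t, ENNReal.ofReal (eta n t) * ‖f (x - t)‖ₑ ^ 2 := by
  have hm : Measurable fun t => ENNReal.ofReal (eta n t) :=
    (continuous_eta n).measurable.ennreal_ofReal
  have hfm : Measurable fun t => ‖f (x - t)‖ₑ :=
    hf.enorm.comp (measurable_const_sub x)
  have h1 : ‖mollify n f x‖ₑ ≤ ∫⁻ t, ENNReal.ofReal (eta n t) * ‖f (x - t)‖ₑ := by
    rw [mollify_apply]
    refine (enorm_integral_le_lintegral_enorm _).trans_eq (lintegral_congr fun t => ?_)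
    rw [enorm_smul, Real.enorm_of_nonneg (eta_nonneg n t)]
  have h2 := ENNReal.lintegral_mul_le_Lp_mul_Lq
    (volume.withDensity fun t => ENNReal.ofReal (eta n t)) Real.HolderConjugate.two_two
    hfm.aemeasurable (measurable_const (a := (1 : ℝ≥0∞))).aemeasurable
  rw [lintegral_withDensity_eq_lintegral_mul _ hm (hfm.mul measurable_const),
    lintegral_withDensity_eq_lintegral_mul _ hm (hfm.pow_const _),
    lintegral_withDensity_eq_lintegral_mul _ hm (measurable_const.pow_const _)] at h2
  simp only [Pi.mul_apply, one_pow, mul_one, ENNReal.one_rpow, lintegral_eta,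
    ENNReal.rpow_ofNat] at h2
  calc ‖mollify n f x‖ₑ ^ 2
      ≤ ((∫⁻ t, ENNReal.ofReal (eta n t) * ‖f (x - t)‖ₑ ^ 2) ^ (1 / 2 : ℝ)) ^ 2 :=
        pow_le_pow_left₀ zero_le (h1.trans h2) 2
    _ = _ := by
        rw [← ENNReal.rpow_ofNat, ← ENNReal.rpow_mul]
        norm_num

end Mollify

/-- The norm of mollification in `L²(m_γ)`, squared. -/
def mollifyConst (γ : ℝ) : ℝ≥0∞ := ENNReal.ofReal (Real.exp (2 * |γ|)) * muckenhoupt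

lemma mollifyConst_ne_top (γ : ℝ) : mollifyConst γ ≠ ⊤ :=
  ENNReal.mul_ne_top ENNReal.ofReal_ne_top (ENNReal.add_ne_top.2 ⟨by simp,
    ENNReal.mul_ne_top ENNReal.ofReal_ne_top (measure_ne_top _ _)⟩)

/-- The derivative is put on the mollifier and written with the test function `z ↦ η_n(x - z)`, the
shape required by the definition of the weak gradient. The reflection produces the sign. -/
lemma fderiv_mollify_apply (n : ℕ) {f : R3 → ℝ} (hf : LocallyIntegrable f) (x v : R3) :
    fderiv ℝ (mollify n f) x v
      = -∫ y, f y * fderiv ℝ (fun z => eta n (x - z)) y v := by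
  have h1 := (hasCompactSupport_eta n).hasFDerivAt_convolution_left
    (ContinuousLinearMap.lsmul ℝ ℝ) ((contDiff_eta n).of_le (by simp)) hf x
  have h2 : ConvolutionExists (fderiv ℝ (eta n)) f
      ((ContinuousLinearMap.lsmul ℝ ℝ : ℝ →L[ℝ] ℝ →L[ℝ] ℝ).precompL R3) volume :=
    ((hasCompactSupport_eta n).fderiv ℝ).convolutionExists_left _
      ((contDiff_eta n).continuous_fderiv (by simp)) hf
  have h3 : fderiv ℝ (mollify n f) x v = ∫ t, fderiv ℝ (eta n) t v * f (x - t) := by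
    rw [mollify, h1.fderiv, convolution_def, ContinuousLinearMap.integral_apply (h2 x)]
    rfl
  rw [h3, ← integral_sub_left_eq_self _ volume x, ← integral_neg]
  refine integral_congr_ae (ae_of_all _ fun y => ?_)
  have h4 : fderiv ℝ (fun z => eta n (x - z)) y v = -fderiv ℝ (eta n) (x - y) v := by
    have h5 := (((contDiff_eta n).differentiable (by simp) (x - y)).hasFDerivAt).comp y
      ((hasFDerivAt_id y).const_sub x)
    have h6 : fderiv ℝ (fun z => eta n (x - z)) y = _ := h5.fderiv
    rw [h6]
    simp
  simp only [h4, sub_sub_cancel]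
  ring

lemma norm_sub_eq_of_ae_eq {X F : Type*} [MeasurableSpace X] {μ : Measure X}
    [NormedAddCommGroup F] {u : Lp F 2 μ} {g : X → F} (hu : u =ᵐ[μ] g) (f : Lp F 2 μ) :
    ‖u - f‖ = (eLpNorm (g - ⇑f) 2 μ).toReal := by
  rw [Lp.norm_def]
  congr 1
  exact eLpNorm_congr_ae ((Lp.coeFn_sub u f).trans (hu.sub (ae_eq_refl _)))

namespace Params

variable (P : Params)

section Mollify

variable {F : Type*} [NormedAddCommGroup F] [NormedSpace ℝ F]

lemma lintegral_mThree {g : R3 → ℝ≥0∞} (hg : Measurable g) :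
    ∫⁻ x, g x ∂P.mThree = ∫⁻ x, ENNReal.ofReal (psi P.γ x ^ 2) * g x := by
  rw [mThree, lintegral_withDensity_eq_lintegral_mul _ (measurable_psi_sq P.γ).ennreal_ofReal hg]
  rfl

/-- After Jensen's inequality, Tonelli's theorem and a translation move the average from `|f|²` to
the weight, where the `A₁` bound applies, uniformly in `n`. -/
lemma lintegral_enorm_mollify_sq_le (n : ℕ) {f : R3 → F} (hf : StronglyMeasurable f)
    (hloc : LocallyIntegrable f) :
    ∫⁻ x, ‖mollify n f x‖ₑ ^ 2 ∂P.mThree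
      ≤ mollifyConst P.γ * ∫⁻ x, ‖f x‖ₑ ^ 2 ∂P.mThree := by
  have hW : Measurable fun x : R3 => ENNReal.ofReal (psi P.γ x ^ 2) :=
    (measurable_psi_sq P.γ).ennreal_ofReal
  have hη : Measurable fun t => ENNReal.ofReal (eta n t) :=
    (continuous_eta n).measurable.ennreal_ofReal
  have hf2 : Measurable fun x => ‖f x‖ₑ ^ 2 := hf.enorm.pow_const 2
  rw [P.lintegral_mThree ((contDiff_mollify n hloc).continuous.enorm.measurable.pow_const 2),
    P.lintegral_mThree hf2]
  calc ∫⁻ x, ENNReal.ofReal (psi P.γ x ^ 2) * ‖mollify n f x‖ₑ ^ 2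
      ≤ ∫⁻ x, ENNReal.ofReal (psi P.γ x ^ 2) *
        ∫⁻ t, ENNReal.ofReal (eta n t) * ‖f (x - t)‖ₑ ^ 2 := by
        gcongr with x
        exact enorm_mollify_sq_le n hf x
    _ = ∫⁻ x, ∫⁻ t, ENNReal.ofReal (psi P.γ x ^ 2) *
        (ENNReal.ofReal (eta n t) * ‖f (x - t)‖ₑ ^ 2) := by
        refine lintegral_congr fun x => (lintegral_const_mul _ ?_).symm
        exact hη.mul (hf2.comp (measurable_const_sub x))
    _ = ∫⁻ t, ∫⁻ x, ENNReal.ofReal (psi P.γ x ^ 2) *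
        (ENNReal.ofReal (eta n t) * ‖f (x - t)‖ₑ ^ 2) := by
        refine lintegral_lintegral_swap (Measurable.aemeasurable ?_)
        exact (hW.comp measurable_fst).mul
          ((hη.comp measurable_snd).mul (hf2.comp (measurable_fst.sub measurable_snd)))
    _ = ∫⁻ t, ∫⁻ y, ENNReal.ofReal (psi P.γ (y + t) ^ 2) *
        (ENNReal.ofReal (eta n t) * ‖f y‖ₑ ^ 2) := by
        refine lintegral_congr fun t => ?_
        rw [← lintegral_add_right_eq_self _ t]
        simp only [add_sub_cancel_right]
    _ = ∫⁻ y, ∫⁻ t, ENNReal.ofReal (psi P.γ (y + t) ^ 2) *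
        (ENNReal.ofReal (eta n t) * ‖f y‖ₑ ^ 2) := by
        refine lintegral_lintegral_swap (Measurable.aemeasurable ?_)
        exact (hW.comp (measurable_snd.add measurable_fst)).mul
          ((hη.comp measurable_fst).mul (hf2.comp measurable_snd))
    _ = ∫⁻ y, (∫⁻ t, ENNReal.ofReal (eta n t) * ENNReal.ofReal (psi P.γ (y + t) ^ 2)) *
        ‖f y‖ₑ ^ 2 := by
        refine lintegral_congr fun y => ?_
        have hm : Measurable fun t =>
            ENNReal.ofReal (eta n t) * ENNReal.ofReal (psi P.γ (y + t) ^ 2) :=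
          hη.mul (hW.comp (measurable_const_add y))
        rw [← lintegral_mul_const _ hm]
        refine lintegral_congr fun t => ?_
        ring
    _ ≤ ∫⁻ y, mollifyConst P.γ * (ENNReal.ofReal (psi P.γ y ^ 2) * ‖f y‖ₑ ^ 2) := by
        have hne : ∀ᵐ x : R3, x ≠ 0 := by simp [ae_iff]
        refine lintegral_mono_ae ?_
        filter_upwards [hne] with y hy
        rw [← mul_assoc]
        gcongr
        exact lintegral_eta_mul_psi_sq_le P.γ n hy
    _ = _ := lintegral_const_mul _ (hW.mul hf2)

lemma eLpNorm_mollify_le (n : ℕ) {f : R3 → F} (hf : StronglyMeasurable f)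
    (hloc : LocallyIntegrable f) :
    eLpNorm (mollify n f) 2 P.mThree ≤ mollifyConst P.γ ^ (1 / 2 : ℝ) * eLpNorm f 2 P.mThree := by
  rw [eLpNorm_eq_lintegral_rpow_enorm_toReal (by norm_num) (by norm_num),
    eLpNorm_eq_lintegral_rpow_enorm_toReal (by norm_num) (by norm_num)]
  simp only [ENNReal.toReal_ofNat, ENNReal.rpow_ofNat]
  rw [← ENNReal.mul_rpow_of_nonneg _ _ (by norm_num : (0 : ℝ) ≤ 1 / 2)]
  exact ENNReal.rpow_le_rpow (P.lintegral_enorm_mollify_sq_le n hf hloc) (by norm_num)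

/-- Mollifications of a continuous function with compact support converge in `L²(m_γ)`. -/
lemma tendsto_eLpNorm_mollify_sub_of_continuous [CompleteSpace F] {g : R3 → F} (hg : Continuous g)
    (hc : HasCompactSupport g) :
    Tendsto (fun n => eLpNorm (mollify n g - g) 2 P.mThree) atTop (𝓝 0) := by
  -- All mollifiers have radius at most `1`, so every `η_n * g - g` vanishes off this fixed compact
  -- set of finite measure; uniform convergence then suffices.
  set K := Metric.cthickening 1 (tsupport g) with hK
  have hKc : IsCompact K := hc.isCompact.cthickening
  have hKt : P.mThree K ^ (2 : ℝ≥0∞).toReal⁻¹ ≠ ⊤ :=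
    ENNReal.rpow_ne_top_of_nonneg (by simp) hKc.measure_lt_top.ne
  rw [ENNReal.tendsto_atTop_zero]
  intro δ hδ
  have hlim : Tendsto (fun s : ℝ => P.mThree K ^ (2 : ℝ≥0∞).toReal⁻¹ * ENNReal.ofReal s)
      (𝓝[>] 0) (𝓝 0) := by
    have h := ENNReal.Tendsto.const_mul (a := P.mThree K ^ (2 : ℝ≥0∞).toReal⁻¹)
      (ENNReal.tendsto_ofReal (tendsto_id (x := 𝓝 (0 : ℝ)))) (Or.inr hKt)
    simp only [id, ENNReal.ofReal_zero, mul_zero] at h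
    exact h.mono_left nhdsWithin_le_nhds
  obtain ⟨s, hs, hs0⟩ := ((hlim.eventually_le_const hδ).and self_mem_nhdsWithin).exists
  obtain ⟨r, hr, hgr⟩ :=
    Metric.uniformContinuous_iff.1 (hc.uniformContinuous_of_continuous hg) s hs0
  obtain ⟨N, hN⟩ := eventually_atTop.1 (tendsto_bump_rOut.eventually_le_const hr)
  refine ⟨N, fun n hn => ?_⟩
  have h1 : ∀ x, ‖mollify n g x - g x‖ ≤ s := fun x => by
    rw [← dist_eq_norm]
    refine (bump n).dist_normed_convolution_le hg.aestronglyMeasurable fun y hy => ?_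
    exact (hgr (lt_of_lt_of_le hy (hN n hn))).le
  have h2 : ∀ x ∉ K, mollify n g x - g x = 0 := fun x hx => by
    have h3 : ∀ y, dist y x ≤ 1 → g y = 0 := fun y hy => by
      refine image_eq_zero_of_notMem_tsupport fun hys => hx ?_
      exact Metric.mem_cthickening_of_dist_le x y 1 _ hys (by rwa [dist_comm])
    rw [h3 x (by simp), sub_zero, mollify_apply]
    refine integral_eq_zero_of_ae (ae_of_all _ fun t => ?_)
    rcases le_or_gt (bump n).rOut ‖t‖ with ht | ht
    · simp [eta_eq_zero ht]
    · simp only [Pi.zero_apply]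
      rw [h3 (x - t), smul_zero]
      rw [dist_eq_norm, sub_sub_cancel_left, norm_neg]
      linarith [bump_rOut_le_one n]
  have h4 : mollify n g - g = K.indicator (mollify n g - g) := by
    refine (Set.indicator_eq_self.2 fun x hx => ?_).symm
    by_contra hxK
    exact hx (h2 x hxK)
  rw [h4, eLpNorm_indicator_eq_eLpNorm_restrict hKc.measurableSet]
  refine (eLpNorm_le_of_ae_bound (ae_of_all _ h1)).trans ?_
  rwa [Measure.restrict_apply_univ]

/-- Mollifications converge in `L²(m_γ)`. -/
lemma tendsto_eLpNorm_mollify_sub [CompleteSpace F] (f : Lp F 2 P.mThree) :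
    Tendsto (fun n => eLpNorm (mollify n f - ⇑f) 2 P.mThree) atTop (𝓝 0) := by
  -- A bound for the operators `f ↦ η_n * f - f`, uniform in `n`; the summand `1` accounts for the
  -- identity. It reduces the claim to the dense class of continuous functions with compact support.
  set A : ℝ≥0∞ := mollifyConst P.γ ^ (1 / 2 : ℝ) + 1 with hA
  have hAt : A ≠ ⊤ := ENNReal.add_ne_top.2
    ⟨ENNReal.rpow_ne_top_of_nonneg (by norm_num) (mollifyConst_ne_top _), by simp⟩
  have hA0 : A ≠ 0 := by simp [hA]
  rw [ENNReal.tendsto_atTop_zero]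
  intro δ hδ
  have hδ2 : δ / 2 / A ≠ 0 := (ENNReal.div_pos (ENNReal.div_pos hδ.ne' (by norm_num)).ne' hAt).ne'
  obtain ⟨g, hgc, hfg, hg, -⟩ := (Lp.memLp f).exists_hasCompactSupport_eLpNorm_sub_le
    (by norm_num) hδ2
  obtain ⟨N, hN⟩ := (ENNReal.tendsto_atTop_zero.1
    (P.tendsto_eLpNorm_mollify_sub_of_continuous hg hgc)) (δ / 2)
    (ENNReal.div_pos hδ.ne' (by norm_num))
  refine ⟨N, fun n hn => ?_⟩
  have hfl : LocallyIntegrable f := P.locallyIntegrable_mThree f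
  have hgl : LocallyIntegrable g := hg.locallyIntegrable
  have hd : LocallyIntegrable (⇑f - g) := hfl.sub hgl
  have hds : StronglyMeasurable (⇑f - g) := (Lp.stronglyMeasurable f).sub hg.stronglyMeasurable
  have hsplit : mollify n f - ⇑f = (mollify n (⇑f - g) - (⇑f - g)) + (mollify n g - g) := by
    have h := mollify_add n hd hgl
    rw [sub_add_cancel] at h
    rw [h]
    abel
  have hm1 : AEStronglyMeasurable (mollify n (⇑f - g)) P.mThree :=
    (contDiff_mollify n hd).continuous.aestronglyMeasurable
  have hm2 : AEStronglyMeasurable (mollify n g - g) P.mThree :=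
    ((contDiff_mollify n hgl).continuous.sub hg).aestronglyMeasurable
  rw [hsplit]
  refine (eLpNorm_add_le (hm1.sub hds.aestronglyMeasurable) hm2 (by norm_num)).trans ?_
  calc eLpNorm (mollify n (⇑f - g) - (⇑f - g)) 2 P.mThree + eLpNorm (mollify n g - g) 2 P.mThree
      ≤ A * eLpNorm (⇑f - g) 2 P.mThree + δ / 2 := by
        refine add_le_add ?_ (hN n hn)
        refine (eLpNorm_sub_le hm1 hds.aestronglyMeasurable (by norm_num)).trans ?_
        rw [hA, add_mul, one_mul]
        gcongr
        exact P.eLpNorm_mollify_le n hds hd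
    _ ≤ A * (δ / 2 / A) + δ / 2 := by gcongr
    _ = δ := by rw [ENNReal.mul_div_cancel hA0 hAt, ENNReal.add_halves]

lemma memLp_mollify (n : ℕ) (f : Lp F 2 P.mThree) : MemLp (mollify n f) 2 P.mThree := by
  have hfl : LocallyIntegrable f := P.locallyIntegrable_mThree f
  refine ⟨(contDiff_mollify n hfl).continuous.aestronglyMeasurable, ?_⟩
  refine (P.eLpNorm_mollify_le n (Lp.stronglyMeasurable f) hfl).trans_lt ?_
  exact ENNReal.mul_lt_top (ENNReal.rpow_lt_top_of_nonneg (by norm_num) (mollifyConst_ne_top _))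
    (Lp.eLpNorm_lt_top f)

end Mollify

/-- The function `z ↦ η_n(x - z)` is an admissible test function for the weak gradient, so
mollification commutes with differentiation. -/
lemma gradient_mollify (n : ℕ) (f : P.formThree.domain) :
    gradient (mollify n (f : Lp ℝ 2 P.mThree)) = mollify n (P.gradLin f) := by
  ext x i
  have hfl := P.locallyIntegrable_mThree (f : Lp ℝ 2 P.mThree)
  have hgl := P.locallyIntegrable_mThree (P.gradLin f)
  rw [gradient_apply, fderiv_mollify_apply n hfl]
  have h1 : ContDiff ℝ ∞ fun z => eta n (x - z) := (contDiff_eta n).comp (by fun_prop)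
  have h2 : HasCompactSupport fun z => eta n (x - z) :=
    (hasCompactSupport_eta n).comp_homeomorph (Homeomorph.subLeft x)
  rw [P.mem_gradGraph f _ h1 h2 i, neg_neg, mollify_apply]
  have h3 : Integrable fun t => eta n t • P.gradLin f (x - t) := convolutionExists_eta n hgl x
  have h4 : ∫ t, (eta n t • P.gradLin f (x - t)) i = (∫ t, eta n t • P.gradLin f (x - t)) i :=
    (EuclideanSpace.proj (𝕜 := ℝ) i).integral_comp_comm h3
  rw [← h4, ← integral_sub_left_eq_self _ volume x]
  refine integral_congr_ae (ae_of_all _ fun t => ?_)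
  simp only [sub_sub_cancel, PiLp.smul_apply, smul_eq_mul]
  ring

lemma isCore_mollify (n : ℕ) (f : P.formThree.domain) :
    P.IsCore (mollify n (f : Lp ℝ 2 P.mThree)) where
  contDiff := (contDiff_mollify n (P.locallyIntegrable_mThree _)).of_le (by simp)
  memLp := P.memLp_mollify n _
  memLp_gradient := by
    rw [gradient_mollify]
    exact P.memLp_mollify n _

/-- `C¹` functions are dense in `𝓕³`. -/
lemma exists_tendsto_mollify (f : P.formThree.domain) : ∃ v : ℕ → P.formThree.domain,
    (∀ n, v n =ᵐ[P.mThree] mollify n (f : Lp ℝ 2 P.mThree)) ∧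
    (∀ n, P.gradLin (v n) =ᵐ[P.mThree] gradient (mollify n (f : Lp ℝ 2 P.mThree))) ∧
    Tendsto (fun n => P.formThree.energyOne (v n - f)) atTop (𝓝 0) := by
  choose v hv hv' using fun n => (P.isCore_mollify n f).exists_domain
  refine ⟨v, hv, hv', ?_⟩
  have h1 : Tendsto (fun n => ‖(v n : Lp ℝ 2 P.mThree) - f‖) atTop (𝓝 0) := by
    have h := (ENNReal.tendsto_toReal ENNReal.zero_ne_top).comp
      (P.tendsto_eLpNorm_mollify_sub (f : Lp ℝ 2 P.mThree))
    exact h.congr fun n => (norm_sub_eq_of_ae_eq (hv n) _).symm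
  have h2 : Tendsto (fun n => ‖P.gradLin (v n) - P.gradLin f‖) atTop (𝓝 0) := by
    have h := (ENNReal.tendsto_toReal ENNReal.zero_ne_top).comp
      (P.tendsto_eLpNorm_mollify_sub (P.gradLin f))
    refine h.congr fun n => ?_
    rw [norm_sub_eq_of_ae_eq (hv' n), gradient_mollify]
    rfl
  have h3 : ∀ n, P.formThree.energyOne (v n - f)
      = 1 / 2 * ‖P.gradLin (v n) - P.gradLin f‖ ^ 2 + ‖(v n : Lp ℝ 2 P.mThree) - f‖ ^ 2 :=
    fun n => by
      rw [SymmForm.energyOne, formThree_self, map_sub]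
      rfl
  simp_rw [h3]
  have h4 := ((h2.pow 2).const_mul (1 / 2)).add (h1.pow 2)
  rwa [zero_pow two_ne_zero, mul_zero, add_zero] at h4

/-- The mollified value is an average for a probability density supported near the origin. This
transfers a lower bound a.e. near the origin to the pointwise values that define evaluation. -/
lemma one_le_mollify_zero {n : ℕ} {f : R3 → ℝ} (hf : LocallyIntegrable f)
    (h : ∀ᵐ x : R3, ‖x‖ < (bump n).rOut → 1 ≤ f x) : 1 ≤ mollify n f 0 := by
  rw [mollify_apply, ← integral_eta n]
  refine integral_mono_ae (bump n).integrable_normed (convolutionExists_eta n hf 0) ?_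
  have h' : ∀ᵐ t : R3, ‖-t‖ < (bump n).rOut → 1 ≤ f (-t) :=
    (Measure.measurePreserving_neg (volume : Measure R3)).quasiMeasurePreserving.ae h
  filter_upwards [h'] with t ht
  rcases le_or_gt (bump n).rOut ‖t‖ with h1 | h1
  · simp [eta_eq_zero h1]
  · simp only [zero_sub, smul_eq_mul]
    exact le_mul_of_one_le_right (eta_nonneg n t) (ht (by rwa [norm_neg]))

end Params

/-! ### Smoothed absolute values and the capacitary inequality on `ℝ³` -/

lemma SymmForm.energyOne_smul {H : Type*} [NormedAddCommGroup H] [InnerProductSpace ℝ H]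
    (E : SymmForm H) (c : ℝ) (u : E.domain) : E.energyOne (c • u) = c ^ 2 * E.energyOne u := by
  simp only [energyOne_eq, map_smul, LinearMap.smul_apply, Submodule.coe_smul,
    real_inner_smul_left, real_inner_smul_right, smul_eq_mul]
  ring

/-- A smooth approximation of `|φ|` from below. -/
def smoothAbs (d : ℝ) (φ : R3 → ℝ) (x : R3) : ℝ := Real.sqrt (φ x ^ 2 + d ^ 2) - d

section SmoothAbs

variable {d : ℝ} {φ : R3 → ℝ}

lemma smoothAbs_nonneg (x : R3) : 0 ≤ smoothAbs d φ x := by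
  rw [smoothAbs, sub_nonneg]
  exact Real.le_sqrt_of_sq_le (by nlinarith [sq_nonneg (φ x)])

lemma smoothAbs_le (hd : 0 < d) (x : R3) : smoothAbs d φ x ≤ |φ x| := by
  rw [smoothAbs, sub_le_iff_le_add, Real.sqrt_le_left (by positivity)]
  nlinarith [sq_abs (φ x), abs_nonneg (φ x)]

lemma sub_le_smoothAbs (x : R3) : |φ x| - d ≤ smoothAbs d φ x := by
  rw [smoothAbs]
  gcongr
  exact Real.le_sqrt_of_sq_le (by rw [sq_abs]; nlinarith [sq_nonneg d])

lemma contDiff_smoothAbs (hd : 0 < d) (hφ : ContDiff ℝ 1 φ) : ContDiff ℝ 1 (smoothAbs d φ) :=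
  (((hφ.pow 2).add contDiff_const).sqrt fun x => by positivity).sub contDiff_const

/-- By the chain rule the gradient is multiplied by `φ / √(φ² + d²)`, which has absolute value at
most `1`. -/
lemma norm_fderiv_smoothAbs_le (hd : 0 < d) (hφ : ContDiff ℝ 1 φ) (x : R3) :
    ‖fderiv ℝ (smoothAbs d φ) x‖ ≤ ‖fderiv ℝ φ x‖ := by
  have hpos : 0 < φ x ^ 2 + d ^ 2 := by positivity
  have h1 := (hφ.differentiable one_ne_zero x).hasFDerivAt
  have h2 := (((h1.pow 2).add_const (d ^ 2)).sqrt hpos.ne').sub_const d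
  have h3 : fderiv ℝ (smoothAbs d φ) x = _ := h2.fderiv
  have h4 : |φ x| ≤ Real.sqrt (φ x ^ 2 + d ^ 2) :=
    Real.le_sqrt_of_sq_le (by rw [sq_abs]; nlinarith [sq_nonneg d])
  have h5 : 0 < Real.sqrt (φ x ^ 2 + d ^ 2) := Real.sqrt_pos.2 hpos
  rw [h3, smul_smul, norm_smul]
  refine mul_le_of_le_one_left (norm_nonneg _) ?_
  rw [Real.norm_eq_abs, abs_mul, abs_of_pos (by positivity)]
  rw [div_mul_eq_mul_div, one_mul, div_le_one (by positivity)]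
  simp only [nsmul_eq_mul, Nat.cast_ofNat, Nat.add_one_sub_one, pow_one, abs_mul, Nat.abs_ofNat]
  linarith

end SmoothAbs

namespace Params

variable {P : Params}

lemma IsCore.smoothAbs {φ : R3 → ℝ} (h : P.IsCore φ) {d : ℝ} (hd : 0 < d) :
    P.IsCore (smoothAbs d φ) where
  contDiff := contDiff_smoothAbs hd h.contDiff
  memLp := by
    refine h.memLp.mono (contDiff_smoothAbs hd h.contDiff).continuous.aestronglyMeasurable
      (ae_of_all _ fun x => ?_)
    rw [Real.norm_eq_abs, Real.norm_eq_abs, abs_of_nonneg (smoothAbs_nonneg x)]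
    exact smoothAbs_le hd x
  memLp_gradient := by
    refine h.memLp_gradient.mono
      (continuous_gradient (contDiff_smoothAbs hd h.contDiff)).aestronglyMeasurable
      (ae_of_all _ fun x => ?_)
    rw [norm_gradient, norm_gradient]
    exact norm_fderiv_smoothAbs_le hd h.contDiff x

lemma gradient_sub_apply {φ χ : R3 → ℝ} (hφ : ContDiff ℝ 1 φ) (hχ : ContDiff ℝ 1 χ) :
    gradient (φ - χ) = gradient φ - gradient χ := by
  ext1 x
  rw [gradient, fderiv_sub (hφ.differentiable one_ne_zero x) (hχ.differentiable one_ne_zero x),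
    map_sub]
  rfl

lemma IsCore.sub {φ χ : R3 → ℝ} (hφ : P.IsCore φ) (hχ : P.IsCore χ) : P.IsCore (φ - χ) where
  contDiff := hφ.contDiff.sub hχ.contDiff
  memLp := hφ.memLp.sub hχ.memLp
  memLp_gradient := by
    rw [gradient_sub_apply hφ.contDiff hχ.contDiff]
    exact hφ.memLp_gradient.sub hχ.memLp_gradient

/-- The capacitary weak type inequality. -/
lemma IsCore.exists_potential {φ : R3 → ℝ} (h : P.IsCore φ) {u : P.formThree.domain}
    (hu : u =ᵐ[P.mThree] φ) (hu' : P.gradLin u =ᵐ[P.mThree] gradient φ) {l : ℝ} (hl : 0 < l) :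
    ∃ e : P.formThree.domain, (∀ᵐ x ∂P.mThree, 0 ≤ (e : Lp ℝ 2 P.mThree) x) ∧
      (∀ᵐ x ∂P.mThree, l < |φ x| → 1 ≤ (e : Lp ℝ 2 P.mThree) x) ∧
      l ^ 2 * P.formThree.energyOne e ≤ 4 * P.formThree.energyOne u := by
  -- With `d = l / 2`, the smoothed absolute value exceeds `l / 2` where `|φ| > l`, so scaling by `2
  -- / l` gives a potential. The constant is `4 = l² (2 / l)²`.
  have hd : 0 < l / 2 := by positivity
  obtain ⟨w, hw, hw'⟩ := (h.smoothAbs hd).exists_domain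
  have hsmul : ((2 / l) • w : P.formThree.domain) =ᵐ[P.mThree]
      fun x => 2 / l * VaryingDim.smoothAbs (l / 2) φ x := by
    filter_upwards [hw, Lp.coeFn_smul (2 / l) (w : Lp ℝ 2 P.mThree)] with x hx hx'
    rw [Submodule.coe_smul, hx', Pi.smul_apply, hx, smul_eq_mul]
  refine ⟨(2 / l) • w, ?_, ?_, ?_⟩
  · filter_upwards [hsmul] with x hx
    rw [hx]
    exact mul_nonneg (by positivity) (smoothAbs_nonneg x)
  · filter_upwards [hsmul] with x hx hlx
    rw [hx, div_mul_eq_mul_div, le_div_iff₀ hl]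
    have := sub_le_smoothAbs (d := l / 2) (φ := φ) x
    linarith
  · have h1 : ‖(w : Lp ℝ 2 P.mThree)‖ ≤ ‖(u : Lp ℝ 2 P.mThree)‖ := by
      refine Lp.norm_le_norm_of_ae_le ?_
      filter_upwards [hw, hu] with x hx hx'
      rw [hx, hx', Real.norm_eq_abs, Real.norm_eq_abs, abs_of_nonneg (smoothAbs_nonneg x)]
      exact smoothAbs_le hd x
    have h2 : ‖P.gradLin w‖ ≤ ‖P.gradLin u‖ := by
      refine Lp.norm_le_norm_of_ae_le ?_
      filter_upwards [hw', hu'] with x hx hx'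
      rw [hx, hx', norm_gradient, norm_gradient]
      exact norm_fderiv_smoothAbs_le hd h.contDiff x
    have h3 : P.formThree.energyOne w ≤ P.formThree.energyOne u := by
      rw [SymmForm.energyOne, SymmForm.energyOne, formThree_self, formThree_self]
      gcongr
    rw [SymmForm.energyOne_smul, ← mul_assoc]
    have h4 : l ^ 2 * (2 / l) ^ 2 = 4 := by
      field_simp
      norm_num
    rw [h4]
    gcongr

/-! ### Evaluation at the origin on all of `𝓕³` -/

variable (P)

/-- The evaluation bound for `C¹` functions, applied to differences of mollifications, makes their
values at the origin Cauchy. The capacitary inequality makes the limit the value of a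
quasi-continuous version. -/
lemma exists_tendsto_mollify_zero (f : P.formThree.domain) :
    ∃ a, IsQuasiValue P.formThree f 0 a ∧
      Tendsto (fun n => mollify n (f : Lp ℝ 2 P.mThree) 0) atTop (𝓝 a) := by
  obtain ⟨C, hC⟩ := P.exists_sq_apply_zero_le
  obtain ⟨v, hv, hv', hlim⟩ := P.exists_tendsto_mollify f
  have hcore := fun n => P.isCore_mollify n f
  have hsub : ∀ m n, (v m - v n : P.formThree.domain) =ᵐ[P.mThree]
      mollify m (f : Lp ℝ 2 P.mThree) - mollify n (f : Lp ℝ 2 P.mThree) := fun m n => by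
    filter_upwards [hv m, hv n, Lp.coeFn_sub (v m : Lp ℝ 2 P.mThree) (v n)] with x h1 h2 h3
    rw [Submodule.coe_sub, h3, Pi.sub_apply, h1, h2, Pi.sub_apply]
  have hsub' : ∀ m n, P.gradLin (v m - v n) =ᵐ[P.mThree]
      gradient (mollify m (f : Lp ℝ 2 P.mThree) - mollify n (f : Lp ℝ 2 P.mThree)) := fun m n => by
    rw [gradient_sub_apply (hcore m).contDiff (hcore n).contDiff, map_sub]
    filter_upwards [hv' m, hv' n, Lp.coeFn_sub (P.gradLin (v m)) (P.gradLin (v n))] with x h1 h2 h3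
    rw [h3, Pi.sub_apply, h1, h2, Pi.sub_apply]
  have hcauchy : CauchySeq fun n => mollify n (f : Lp ℝ 2 P.mThree) 0 := by
    have h1 : CauchySeq fun n => P.formThree.toEnergy (v n) :=
      (P.formThree.tendsto_toEnergy_iff.2 hlim).cauchySeq
    rw [Metric.cauchySeq_iff] at h1 ⊢
    intro ε hε
    obtain ⟨N, hN⟩ := h1 (ε / (Real.sqrt |C| + 1)) (by positivity)
    refine ⟨N, fun m hm n hn => ?_⟩
    have h2 := hN m hm n hn
    rw [dist_eq_norm, ← map_sub, lt_div_iff₀ (by positivity)] at h2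
    have h3 := hC _ _ ((hcore m).sub (hcore n)) (hsub m n) (hsub' m n)
    rw [← SymmForm.norm_toEnergy_sq, Pi.sub_apply] at h3
    rw [Real.dist_eq]
    have h4 : (mollify m (f : Lp ℝ 2 P.mThree) 0 - mollify n (f : Lp ℝ 2 P.mThree) 0) ^ 2
        ≤ (Real.sqrt |C| * ‖P.formThree.toEnergy (v m - v n)‖) ^ 2 := by
      rw [mul_pow, Real.sq_sqrt (abs_nonneg C)]
      refine h3.trans ?_
      gcongr
      exact le_abs_self C
    have h5 := abs_le_of_sq_le_sq h4 (by positivity)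
    refine h5.trans_lt ?_
    have h6 := norm_nonneg (P.formThree.toEnergy (v m - v n))
    linarith
  obtain ⟨a, ha⟩ := cauchySeq_tendsto_of_complete hcauchy
  refine ⟨a, ?_, ha⟩
  refine isQuasiValue_of_tendsto (K := 4) (fun n => (hcore n).contDiff.continuous) hv hlim
    (fun m n l hl => ?_) ha
  exact ((hcore m).sub (hcore n)).exists_potential (hsub m n) (hsub' m n) hl

/-- The bound for `C¹` functions passes to the limit along mollifications. If `e ≥ 1` a.e. near the
origin, its mollifications are eventually at least `1` there, so the limiting value is too. -/
lemma exists_evalConst_three : ∃ C : ℝ,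
    (∀ e : P.formThree.domain, ∀ U ∈ 𝓝 (0 : R3),
      (∀ᵐ x ∂P.mThree, x ∈ U → 1 ≤ (e : Lp ℝ 2 P.mThree) x) → 1 ≤ C * P.formThree.energyOne e) ∧
    ∀ f : P.formThree.domain, ∃ a, IsQuasiValue P.formThree f 0 a ∧
      a ^ 2 ≤ C * P.formThree.energyOne f := by
  obtain ⟨C, hC⟩ := P.exists_sq_apply_zero_le
  have key : ∀ (f : P.formThree.domain) (a : ℝ),
      Tendsto (fun n => mollify n (f : Lp ℝ 2 P.mThree) 0) atTop (𝓝 a) →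
      a ^ 2 ≤ C * P.formThree.energyOne f := fun f a ha => by
    obtain ⟨v, hv, hv', hlim⟩ := P.exists_tendsto_mollify f
    have h1 := ((P.formThree.tendsto_toEnergy_iff.2 hlim).norm.pow 2).const_mul C
    simp_rw [SymmForm.norm_toEnergy_sq] at h1
    exact le_of_tendsto_of_tendsto' (ha.pow 2) h1 fun n =>
      hC _ _ (P.isCore_mollify n f) (hv n) (hv' n)
  refine ⟨C, fun e U hU he => ?_, fun f => ?_⟩
  · obtain ⟨a, -, ha⟩ := P.exists_tendsto_mollify_zero e
    have hle : 1 ≤ a := by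
      refine ge_of_tendsto ha ?_
      obtain ⟨r, hr, hrU⟩ := Metric.mem_nhds_iff.1 hU
      filter_upwards [tendsto_bump_rOut.eventually_lt_const hr] with n hn
      refine one_le_mollify_zero (P.locallyIntegrable_mThree _) ?_
      filter_upwards [P.absolutelyContinuous_mThree.ae_le he] with x hx hxn
      exact hx (hrU (mem_ball_zero_iff.2 (hxn.trans hn)))
    have := key e a ha
    nlinarith
  · obtain ⟨a, ha, ha'⟩ := P.exists_tendsto_mollify_zero f
    exact ⟨a, ha, key f a ha'⟩

end Params

/-! ### Bounded evaluation functionals -/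

section Eval

variable {X : Type*} [MeasurableSpace X] {μ : Measure X} [TopologicalSpace X]

/-- The point `x₀` has positive capacity, and every element of the form domain has a
quasi-continuous version whose value at `x₀` is controlled by `E₁`. -/
structure BoundedEval (E : SymmForm (Lp ℝ 2 μ)) (x₀ : X) (C : ℝ) : Prop where
  one_le : ∀ e : E.domain, ∀ U ∈ 𝓝 x₀, (∀ᵐ x ∂μ, x ∈ U → 1 ≤ (e : Lp ℝ 2 μ) x) →
    1 ≤ C * E.energyOne e
  exists_value : ∀ f : E.domain, ∃ a, IsQuasiValue E f x₀ a ∧ a ^ 2 ≤ C * E.energyOne f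

namespace BoundedEval

variable {E : SymmForm (Lp ℝ 2 μ)} {x₀ : X} {C : ℝ}

lemma unique (h : BoundedEval E x₀ C) {f : Lp ℝ 2 μ} {a b : ℝ} (ha : IsQuasiValue E f x₀ a)
    (hb : IsQuasiValue E f x₀ b) : a = b := by
  have h1 := ha.sub hb
  rw [sub_self] at h1
  exact sub_eq_zero.1 (h1.eq_zero h.one_le)

lemma sq_le (h : BoundedEval E x₀ C) {f : E.domain} {a : ℝ} (ha : IsQuasiValue E f x₀ a) :
    a ^ 2 ≤ C * E.energyOne f := by
  obtain ⟨b, hb, hb'⟩ := h.exists_value f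
  rwa [h.unique ha hb]

/-- Continuity of evaluation with respect to `E₁`; this is what makes the matching condition at the
origin closed. -/
lemma tendsto (h : BoundedEval E x₀ C) {u : ℕ → E.domain} {v : E.domain} {a : ℕ → ℝ} {b : ℝ}
    (hu : Tendsto (fun n => E.energyOne (u n - v)) atTop (𝓝 0))
    (ha : ∀ n, IsQuasiValue E (u n) x₀ (a n)) (hb : IsQuasiValue E v x₀ b) :
    Tendsto a atTop (𝓝 b) := by
  have h1 : ∀ n, (a n - b) ^ 2 ≤ C * E.energyOne (u n - v) := fun n => h.sq_le ((ha n).sub hb)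
  have h2 : Tendsto (fun n => (a n - b) ^ 2) atTop (𝓝 0) :=
    squeeze_zero (fun n => sq_nonneg _) h1 (by simpa using hu.const_mul C)
  have h3 := h2.sqrt
  simp_rw [Real.sqrt_sq_eq_abs, Real.sqrt_zero] at h3
  exact tendsto_iff_norm_sub_tendsto_zero.2 h3

/-- Evaluation of the quasi-continuous version at `x₀`. -/
def eval (h : BoundedEval E x₀ C) : E.domain →ₗ[ℝ] ℝ where
  toFun f := (h.exists_value f).choose
  map_add' f g := h.unique (h.exists_value (f + g)).choose_spec.1
    ((h.exists_value f).choose_spec.1.add (h.exists_value g).choose_spec.1)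
  map_smul' c f := h.unique (h.exists_value (c • f)).choose_spec.1
    ((h.exists_value f).choose_spec.1.const_smul c)

lemma isQuasiValue_eval (h : BoundedEval E x₀ C) (f : E.domain) :
    IsQuasiValue E f x₀ (h.eval f) := (h.exists_value f).choose_spec.1

end BoundedEval

end Eval

lemma inner_eq_mul_integral {X : Type*} [MeasurableSpace X] {μ : Measure X} {h e : Lp ℝ 2 μ} {a : ℝ}
    (he : e =ᵐ[μ] fun _ => a) : inner ℝ h e = a * ∫ x, h x ∂μ := by
  rw [L2.inner_def, ← integral_const_mul]
  refine integral_congr_ae ?_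
  filter_upwards [he] with x hx
  rw [hx]
  simp

namespace Params

variable (P : Params)

lemma boundedEval_plus : BoundedEval P.formPlus 0 P.evalConst :=
  ⟨P.one_le_of_ge_one_near_zero, P.exists_isQuasiValue_plus⟩

lemma exists_boundedEval_three : ∃ C, BoundedEval P.formThree 0 C := by
  obtain ⟨C, h1, h2⟩ := P.exists_evalConst_three
  exact ⟨C, h1, h2⟩

/-! ### Gluing -/

lemma resPlus_ae (f : Lp ℝ 2 P.m) : P.resPlus f =ᵐ[P.mPlus] f ∘ iotaPlus :=
  (P.memLp_comp_iotaPlus (Lp.memLp f)).coeFn_toLp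

lemma resThree_ae (f : Lp ℝ 2 P.m) : P.resThree f =ᵐ[P.mThree] f ∘ iotaThree :=
  (P.memLp_comp_iotaThree (Lp.memLp f)).coeFn_toLp

lemma integral_m {F : Space → ℝ} (hF : Integrable F P.m) : ∫ x, F x ∂P.m
    = P.p * ∫ r, F (iotaPlus r) ∂P.mPlus + ∫ x, F (iotaThree x) ∂P.mThree := by
  have h3 : AEStronglyMeasurable F (P.mPlus.map iotaPlus) :=
    hF.1.mono_ac (P.map_mPlus_le.absolutelyContinuous.trans
      (Measure.AbsolutelyContinuous.rfl.smul_left _))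
  rw [m] at hF
  have h1 := hF.left_of_add_measure
  have h2 := hF.right_of_add_measure
  rw [m, integral_add_measure h1 h2, integral_smul_measure,
    integral_map measurable_iotaPlus.aemeasurable h3,
    integral_map measurable_iotaThree.aemeasurable h2.1, ENNReal.toReal_ofReal P.p_pos.le,
    smul_eq_mul]

lemma inner_m (f g : Lp ℝ 2 P.m) : inner ℝ f g
    = P.p * inner ℝ (P.resPlus f) (P.resPlus g) + inner ℝ (P.resThree f) (P.resThree g) := by
  rw [L2.inner_def, L2.inner_def, L2.inner_def, P.integral_m (L2.integrable_inner f g)]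
  refine congrArg₂ (fun a b => P.p * a + b) (integral_congr_ae ?_) (integral_congr_ae ?_)
  · filter_upwards [P.resPlus_ae f, P.resPlus_ae g] with r hr hr'
    rw [hr, hr']
    rfl
  · filter_upwards [P.resThree_ae f, P.resThree_ae g] with r hr hr'
    rw [hr, hr']
    rfl

lemma norm_sq_m (f : Lp ℝ 2 P.m) :
    ‖f‖ ^ 2 = P.p * ‖P.resPlus f‖ ^ 2 + ‖P.resThree f‖ ^ 2 := by
  simp_rw [← real_inner_self_eq_norm_sq]
  exact P.inner_m f f

lemma eq_zero_of_res_eq_zero {f : Lp ℝ 2 P.m} (h1 : P.resPlus f = 0) (h2 : P.resThree f = 0) :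
    f = 0 := by
  have h := P.norm_sq_m f
  rw [h1, h2] at h
  simpa using h

/-- The function on `E` with given restrictions to the half-line and to `ℝ³`. -/
def glueFun (g : ℝ≥0 → ℝ) (h : R3 → ℝ) (x : Space) : ℝ :=
  if x.1 3 = 0 then h !₂[x.1 0, x.1 1, x.1 2] else g (x.1 3).toNNReal

lemma measurable_glueFun {g : ℝ≥0 → ℝ} {h : R3 → ℝ} (hg : Measurable g) (hh : Measurable h) :
    Measurable (glueFun g h) := by
  have h3 : Measurable fun x : Space => x.1 3 := by fun_prop
  have hc : Continuous fun x : Space => (!₂[x.1 0, x.1 1, x.1 2] : R3) := by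
    refine (PiLp.continuous_toLp 2 _).comp (continuous_pi fun i => ?_)
    fin_cases i <;> simp <;> fun_prop
  exact Measurable.ite (h3 (measurableSet_singleton 0)) (hh.comp hc.measurable)
    (hg.comp h3.real_toNNReal)

lemma glueFun_iotaThree (g : ℝ≥0 → ℝ) (h : R3 → ℝ) : glueFun g h ∘ iotaThree = h := by
  ext x
  have h1 : (!₂[x 0, x 1, x 2] : R3) = x := by
    ext i
    fin_cases i <;> rfl
  simp [glueFun, iotaThree, h1]

/-- The branches share only the origin, where the glued function takes the value from `ℝ³`; that
point is null for `m₊`. -/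
lemma glueFun_iotaPlus (g : ℝ≥0 → ℝ) (h : R3 → ℝ) : glueFun g h ∘ iotaPlus =ᵐ[P.mPlus] g := by
  have h0 : ∀ᵐ r ∂halfLineVolume, r ≠ (0 : ℝ≥0) := by simp [ae_iff]
  filter_upwards [P.mPlus_absolutelyContinuous.ae_le h0] with r hr
  simp [glueFun, iotaPlus, hr]

/-- With `inner_m`, this identifies `L²(E, 𝔪)` with the orthogonal sum of the spaces on the two
branches, the first inner product being scaled by `p`. -/
lemma exists_glue (g : Lp ℝ 2 P.mPlus) (h : Lp ℝ 2 P.mThree) :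
    ∃ f : Lp ℝ 2 P.m, P.resPlus f = g ∧ P.resThree f = h := by
  have hm : Measurable (glueFun g h) := measurable_glueFun (Lp.stronglyMeasurable g).measurable
    (Lp.stronglyMeasurable h).measurable
  have hL : MemLp (glueFun g h) 2 P.m := by
    rw [memLp_two_iff_integrable_sq hm.aestronglyMeasurable, m, integrable_add_measure]
    have hm2 : Measurable fun x => glueFun g h x ^ 2 := hm.pow_const 2
    constructor
    · refine Integrable.smul_measure ?_ ENNReal.ofReal_ne_top
      rw [integrable_map_measure hm2.aestronglyMeasurable measurable_iotaPlus.aemeasurable]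
      refine (Lp.memLp g).integrable_sq.congr ?_
      filter_upwards [P.glueFun_iotaPlus g h] with r hr
      rw [← hr]
      rfl
    · rw [integrable_map_measure hm2.aestronglyMeasurable measurable_iotaThree.aemeasurable]
      refine (Lp.memLp h).integrable_sq.congr (ae_of_all _ fun x => ?_)
      conv_lhs => rw [← glueFun_iotaThree g h]
      rfl
  refine ⟨hL.toLp _, Lp.ext ?_, Lp.ext ?_⟩
  · exact (P.resPlus_ae _).trans ((P.ae_comp_iotaPlus hL.coeFn_toLp).trans (P.glueFun_iotaPlus g h))
  · refine (P.resThree_ae _).trans ((P.ae_comp_iotaThree hL.coeFn_toLp).trans ?_)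
    rw [glueFun_iotaThree]

/-! ### The form on `E` -/

/-- The restriction to the half-line on the form domain. -/
def domPlus : P.formE.domain →ₗ[ℝ] P.formPlus.domain := P.resPlusF

/-- The restriction to `ℝ³` on the form domain. -/
def domThree : P.formE.domain →ₗ[ℝ] P.formThree.domain := P.resThreeF

lemma coe_domPlus (f : P.formE.domain) : (P.domPlus f : Lp ℝ 2 P.mPlus) = P.resPlus f := rfl

lemma coe_domThree (f : P.formE.domain) : (P.domThree f : Lp ℝ 2 P.mThree) = P.resThree f := rfl

lemma formE_apply (f g : P.formE.domain) : P.formE.form f g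
    = P.p * P.formPlus.form (P.domPlus f) (P.domPlus g)
      + P.formThree.form (P.domThree f) (P.domThree g) := rfl

lemma mem_formE_domain {f : Lp ℝ 2 P.m} : f ∈ P.formE.domain ↔
    P.resPlus f ∈ P.formPlus.domain ∧ P.resThree f ∈ P.formThree.domain ∧
      ∃ a : ℝ, IsQuasiValue P.formPlus (P.resPlus f) 0 a ∧
        IsQuasiValue P.formThree (P.resThree f) 0 a := Iff.rfl

lemma energyOne_formE (f : P.formE.domain) : P.formE.energyOne f
    = P.p * P.formPlus.energyOne (P.domPlus f) + P.formThree.energyOne (P.domThree f) := by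
  have h1 : P.formE.form f f + ‖(f : Lp ℝ 2 P.m)‖ ^ 2 = _ :=
    congrArg₂ (· + ·) (P.formE_apply f f) (P.norm_sq_m f)
  have h2 : ∀ p a b c d : ℝ, p * a + b + (p * c + d) = p * (a + c) + (b + d) := fun _ _ _ _ _ => by
    ring
  exact h1.trans (h2 _ _ _ _ _)

lemma exists_glue_domain {g : P.formPlus.domain} {h : P.formThree.domain} {a : ℝ}
    (hg : IsQuasiValue P.formPlus g 0 a) (hh : IsQuasiValue P.formThree h 0 a) :
    ∃ f : P.formE.domain, P.domPlus f = g ∧ P.domThree f = h := by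
  obtain ⟨f, hf1, hf2⟩ := P.exists_glue g h
  refine ⟨⟨f, P.mem_formE_domain.2 ⟨?_, ?_, a, ?_, ?_⟩⟩, Subtype.ext hf1, Subtype.ext hf2⟩
  · rw [hf1]; exact g.2
  · rw [hf2]; exact h.2
  · rwa [hf1]
  · rwa [hf2]

/-- A Cauchy sequence restricts to Cauchy sequences in the two complete energy spaces. Continuity of
evaluation keeps the values at the origin equal in the limit, so the two limits can be glued. -/
instance : CompleteSpace P.formE.EnergySpace := by
  obtain ⟨C, hC⟩ := P.exists_boundedEval_three
  have hp := P.p_pos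
  have hLp : ∀ f, ‖(P.formPlus.toEnergy.toLinearMap ∘ₗ P.domPlus) f‖ ^ 2
      ≤ P.p⁻¹ * P.formE.energyOne f := fun f => by
    have h1 := P.formThree.energyOne_nonneg (P.domThree f)
    rw [LinearMap.comp_apply, LinearEquiv.coe_coe, SymmForm.norm_toEnergy_sq, energyOne_formE,
      mul_add, inv_mul_cancel_left₀ hp.ne']
    exact le_add_of_nonneg_right (by positivity)
  have hL3 : ∀ f, ‖(P.formThree.toEnergy.toLinearMap ∘ₗ P.domThree) f‖ ^ 2
      ≤ 1 * P.formE.energyOne f := fun f => by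
    have h1 := P.formPlus.energyOne_nonneg (P.domPlus f)
    rw [LinearMap.comp_apply, LinearEquiv.coe_coe, SymmForm.norm_toEnergy_sq, energyOne_formE,
      one_mul]
    exact le_add_of_nonneg_left (by positivity)
  refine Metric.complete_of_cauchySeq_tendsto fun w hw => ?_
  obtain ⟨u, rfl⟩ : ∃ u : ℕ → P.formE.domain, w = fun n => P.formE.toEnergy (u n) :=
    ⟨fun n => P.formE.toEnergy.symm (w n), by simp⟩
  obtain ⟨v₁, hv₁⟩ := cauchySeq_tendsto_of_complete
    ((P.formE.boundedMap _ _ hLp).uniformContinuous.comp_cauchySeq hw)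
  obtain ⟨v₂, hv₂⟩ := cauchySeq_tendsto_of_complete
    ((P.formE.boundedMap _ _ hL3).uniformContinuous.comp_cauchySeq hw)
  obtain ⟨v₁, rfl⟩ := P.formPlus.toEnergy.surjective v₁
  obtain ⟨v₂, rfl⟩ := P.formThree.toEnergy.surjective v₂
  have h1 : Tendsto (fun n => P.formPlus.energyOne (P.domPlus (u n) - v₁)) atTop (𝓝 0) :=
    P.formPlus.tendsto_toEnergy_iff.1 hv₁
  have h2 : Tendsto (fun n => P.formThree.energyOne (P.domThree (u n) - v₂)) atTop (𝓝 0) :=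
    P.formThree.tendsto_toEnergy_iff.1 hv₂
  obtain ⟨a, ha, -⟩ := P.boundedEval_plus.exists_value v₁
  obtain ⟨b, hb, -⟩ := hC.exists_value v₂
  choose c hc hc' using fun n => (P.mem_formE_domain.1 (u n).2).2.2
  have hab : a = b := tendsto_nhds_unique (P.boundedEval_plus.tendsto h1 hc ha)
    (hC.tendsto h2 hc' hb)
  subst hab
  obtain ⟨v, rfl, rfl⟩ := P.exists_glue_domain ha hb
  refine ⟨P.formE.toEnergy v, P.formE.tendsto_toEnergy_iff.2 ?_⟩
  simp_rw [energyOne_formE, map_sub]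
  simpa using (h1.const_mul P.p).add h2

/-- A function on one branch that vanishes at the origin can be continued by zero on the other, and
such functions are already dense on each branch. -/
lemma dense_domain_formE : Dense (P.formE.domain : Set (Lp ℝ 2 P.m)) := by
  have hp := P.p_pos
  rw [Submodule.dense_iff_topologicalClosure_eq_top, Submodule.topologicalClosure_eq_top_iff,
    Submodule.eq_bot_iff]
  intro f hf
  have key : ∀ k : P.formE.domain, P.p * inner ℝ (P.resPlus f) (P.domPlus k : Lp ℝ 2 P.mPlus)
      + inner ℝ (P.resThree f) (P.domThree k : Lp ℝ 2 P.mThree) = 0 := fun k => by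
    have h := (Submodule.mem_orthogonal _ _).1 hf k k.2
    rw [real_inner_comm, inner_m] at h
    exact h
  refine P.eq_zero_of_res_eq_zero (P.eq_zero_of_forall_inner_plus fun g hg => ?_)
    (P.eq_zero_of_forall_inner_three fun g hg => ?_)
  · obtain ⟨k, hk1, hk2⟩ := P.exists_glue_domain hg (h := 0) (.zero _ _)
    have h := key k
    rw [hk1, hk2, Submodule.coe_zero, inner_zero_right, add_zero] at h
    exact (mul_eq_zero.1 h).resolve_left hp.ne'
  · obtain ⟨k, hk1, hk2⟩ := P.exists_glue_domain (g := 0) (.zero _ _) hg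
    have h := key k
    rwa [hk1, hk2, Submodule.coe_zero, inner_zero_right, mul_zero, zero_add] at h

/-! ### The operators -/

/-- `(f, h)` belongs to the graph of `𝒢`. -/
def IsG (f h : Lp ℝ 2 P.m) : Prop := ∃ hf : f ∈ P.formE.domain,
  (∀ g, P.formPlus.form (P.domPlus ⟨f, hf⟩) g = -inner ℝ (P.resPlus h) (g : Lp ℝ 2 P.mPlus)) ∧
  ∀ g, P.formThree.form (P.domThree ⟨f, hf⟩) g = -inner ℝ (P.resThree h) (g : Lp ℝ 2 P.mThree)

variable {P}

lemma mem_opG_submodule_iff {f h : Lp ℝ 2 P.m} :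
    (f, h) ∈ P.formE.domain.comap (LinearMap.fst ℝ _ _) ⊓
      P.opPlus.graph.comap (P.resPlus.prodMap P.resPlus) ⊓
      P.opThree.graph.comap (P.resThree.prodMap P.resThree) ↔ P.IsG f h := by
  rw [opPlus, opThree, SymmForm.graph_generator P.dense_domain_plus,
    SymmForm.graph_generator P.dense_domain_three]
  constructor
  · rintro ⟨⟨hf, _, h1⟩, _, h2⟩
    exact ⟨hf, h1, h2⟩
  · rintro ⟨hf, h1, h2⟩
    exact ⟨⟨hf, (P.domPlus ⟨f, hf⟩).2, h1⟩, (P.domThree ⟨f, hf⟩).2, h2⟩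

lemma IsG.form_eq {f h : Lp ℝ 2 P.m} (hG : P.IsG f h) : ∃ hf : f ∈ P.formE.domain,
    ∀ g : P.formE.domain, P.formE.form ⟨f, hf⟩ g = -inner ℝ h (g : Lp ℝ 2 P.m) := by
  obtain ⟨hf, h1, h2⟩ := hG
  refine ⟨hf, fun g => ?_⟩
  rw [formE_apply, h1, h2, inner_m, coe_domPlus, coe_domThree]
  ring

lemma graph_opA : P.opA.graph = P.formE.generatorGraph :=
  SymmForm.graph_generator P.dense_domain_formE

/-- The relation defining `𝒢` is contained in the graph of `𝒜`, hence is single-valued. -/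
lemma mem_graph_opG_iff {f h : Lp ℝ 2 P.m} : (f, h) ∈ P.opG.graph ↔ P.IsG f h := by
  rw [opG, Submodule.toLinearPMap_graph_eq, mem_opG_submodule_iff]
  rintro ⟨f, h⟩ hx (rfl : f = 0)
  obtain ⟨hf, hfg⟩ := (mem_opG_submodule_iff.1 hx).form_eq
  have h1 : ((0 : Lp ℝ 2 P.m), h) ∈ P.opA.graph := by
    rw [graph_opA]
    exact ⟨hf, hfg⟩
  exact P.opA.graph_fst_eq_zero_snd h1 rfl

lemma mem_domain_opG_iff {f : Lp ℝ 2 P.m} : f ∈ P.opG.domain ↔ ∃ h, P.IsG f h := by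
  simp_rw [LinearPMap.mem_domain_iff, mem_graph_opG_iff]

variable (P)

lemma opG_le_opA : P.opG ≤ P.opA := by
  refine LinearPMap.le_of_le_graph ?_
  rintro ⟨f, h⟩ hfh
  rw [graph_opA]
  exact (mem_graph_opG_iff.1 hfh).form_eq

lemma isSelfAdjoint_opA : IsSelfAdjoint P.opA :=
  SymmForm.isSelfAdjoint_generator P.dense_domain_formE

variable {P}

lemma IsG.opA_eq {f h : Lp ℝ 2 P.m} (hG : P.IsG f h) :
    ∃ hf : f ∈ P.opA.domain, P.opA ⟨f, hf⟩ = h := by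
  obtain ⟨hf, hfg⟩ := hG.form_eq
  exact SymmForm.exists_generator_eq P.dense_domain_formE hf hfg

/-! ### The operator `𝒢` is not self-adjoint -/

variable (P)

lemma not_isSelfAdjoint_opG : ¬ IsSelfAdjoint P.opG := by
  intro hsa
  obtain ⟨C, hC⟩ := P.exists_boundedEval_three
  have hle := P.opG_le_opA
  -- A self-adjoint operator has no proper symmetric extension: `𝒜` is symmetric and extends `𝒢`, so
  -- it lies below the adjoint of `𝒢`, which is `𝒢` itself.
  have hAG : P.opA ≤ P.opG := by
    have h1 : P.opA ≤ P.opG.adjoint := by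
      refine LinearPMap.IsFormalAdjoint.le_adjoint hsa.dense_domain fun x y => ?_
      have h2 : P.opG x = P.opA ⟨x, hle.1 x.2⟩ := hle.2 rfl
      rw [h2]
      exact SymmForm.inner_generator_comm P.dense_domain_formE ⟨x, hle.1 x.2⟩ y
    rwa [LinearPMap.isSelfAdjoint_def.1 hsa] at h1
  -- The representer of evaluation at the origin: it is orthogonal in `𝓔⁺₁` to everything that
  -- vanishes there.
  obtain ⟨v, hv⟩ := P.formPlus.exists_form_add_inner_eq P.boundedEval_plus.eval P.evalConst
    fun u => P.boundedEval_plus.sq_le (P.boundedEval_plus.isQuasiValue_eval u)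
  obtain ⟨h, hh1, hh2⟩ := P.exists_glue v 0
  obtain ⟨f, hf⟩ := SymmForm.exists_sub_generator_eq P.dense_domain_formE h
  obtain ⟨k, hk⟩ := mem_domain_opG_iff.1 (hAG.1 f.2)
  obtain ⟨hfA, hfk⟩ := hk.opA_eq
  have hkh : k = f - h := by
    rw [← hfk, ← hf]
    exact (sub_sub_cancel _ _).symm
  obtain ⟨hfE, h1, h2⟩ := hk
  rw [hkh, map_sub, hh1] at h1
  rw [hkh, map_sub, hh2, sub_zero] at h2
  -- On `ℝ³` the equation is `(1 - 𝒜³) f = 0`; testing it with `f` itself gives `𝓔³(f, f) = -‖f‖²`.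
  have h3 : P.resThree f = 0 := by
    have h4 := h2 (P.domThree ⟨f, hfE⟩)
    have h5 := P.formThree.nonneg' (P.domThree ⟨f, hfE⟩)
    rw [h4, coe_domThree, real_inner_self_eq_norm_sq] at h5
    have h6 : ‖P.resThree f‖ ^ 2 = 0 := le_antisymm (by linarith) (sq_nonneg _)
    simpa using h6
  obtain ⟨-, -, a, ha1, ha2⟩ := P.mem_formE_domain.1 hfE
  rw [h3] at ha2
  obtain rfl : a = 0 := ha2.eq_zero hC.one_le
  have h4 : P.boundedEval_plus.eval (P.domPlus ⟨f, hfE⟩) = 0 :=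
    P.boundedEval_plus.unique (P.boundedEval_plus.isQuasiValue_eval _) ha1
  -- Since `f(0) = 0`, the representer satisfies `𝓔⁺₁(v, f) = 0`, while `(1 - 𝒜⁺) f = v` on the
  -- half-line makes the same quantity equal to `‖v‖²`.
  have h5 := hv (P.domPlus ⟨f, hfE⟩)
  rw [h4, P.formPlus.symm', h1 v, coe_domPlus, inner_sub_left, real_inner_self_eq_norm_sq,
    real_inner_comm] at h5
  have h6 : ‖(v : Lp ℝ 2 P.mPlus)‖ ^ 2 = 0 := by linarith
  have h7 : v = 0 := Subtype.ext (by simpa using h6)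
  obtain ⟨g, hg⟩ := P.exists_isQuasiValue_one_plus
  have h8 := hv g
  rw [P.boundedEval_plus.unique (P.boundedEval_plus.isQuasiValue_eval g) hg, h7] at h8
  simp at h8

/-! ### The domain of `𝒢` for finite measures -/

lemma form_glue_eq {f h : Lp ℝ 2 P.m} {hf : f ∈ P.formE.domain}
    (hfg : ∀ g : P.formE.domain, P.formE.form ⟨f, hf⟩ g = -inner ℝ h (g : Lp ℝ 2 P.m))
    {g : P.formPlus.domain} {e : P.formThree.domain} {a : ℝ}
    (hg : IsQuasiValue P.formPlus g 0 a) (he : IsQuasiValue P.formThree e 0 a) :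
    P.p * P.formPlus.form (P.domPlus ⟨f, hf⟩) g + P.formThree.form (P.domThree ⟨f, hf⟩) e
      = -(P.p * inner ℝ (P.resPlus h) (g : Lp ℝ 2 P.mPlus)
        + inner ℝ (P.resThree h) (e : Lp ℝ 2 P.mThree)) := by
  obtain ⟨k, rfl, rfl⟩ := P.exists_glue_domain hg he
  exact (hfg k).trans (congrArg Neg.neg (P.inner_m h k))

/-- A test function on one branch is continued by a constant on the other. The constant has zero
energy, and its pairing with `h` is a multiple of a vanishing integral, so only the identity on the
first branch remains. -/
lemma isG_of_integral_eq_zero (hρ : Integrable P.ρ halfLineVolume) (hγ : 0 < P.γ)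
    {f h : Lp ℝ 2 P.m} {hf : f ∈ P.formE.domain}
    (hfg : ∀ g : P.formE.domain, P.formE.form ⟨f, hf⟩ g = -inner ℝ h (g : Lp ℝ 2 P.m))
    (h1 : ∫ r, P.resPlus h r ∂P.mPlus = 0) (h2 : ∫ x, P.resThree h x ∂P.mThree = 0) :
    P.IsG f h := by
  obtain ⟨C, hC⟩ := P.exists_boundedEval_three
  refine ⟨hf, fun g => ?_, fun g => ?_⟩
  · obtain ⟨a, ha, -⟩ := P.boundedEval_plus.exists_value g
    obtain ⟨e, he, hea, he0⟩ := P.exists_const_three hγ a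
    have h3 := P.form_glue_eq hfg ha hea
    rw [he0, inner_eq_mul_integral he, h2, mul_zero, add_zero, add_zero, ← mul_neg] at h3
    exact mul_left_cancel₀ P.p_pos.ne' h3
  · obtain ⟨a, ha, -⟩ := hC.exists_value g
    obtain ⟨e, he, hea, he0⟩ := P.exists_const_plus hρ a
    have h3 := P.form_glue_eq hfg hea ha
    rw [he0, inner_eq_mul_integral he, h1, mul_zero, zero_add, mul_zero, mul_zero, zero_add] at h3
    exact h3

lemma mem_domain_opG_iff_integral (hρ : Integrable P.ρ halfLineVolume) (hγ : 0 < P.γ)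
    (f : Lp ℝ 2 P.m) : f ∈ P.opG.domain ↔ ∃ hf : f ∈ P.opA.domain,
      ∫ r, P.resPlus (P.opA ⟨f, hf⟩) r ∂P.mPlus = 0 ∧
      ∫ x, P.resThree (P.opA ⟨f, hf⟩) x ∂P.mThree = 0 := by
  constructor
  · intro hf
    obtain ⟨h, hG⟩ := mem_domain_opG_iff.1 hf
    obtain ⟨hfA, hfh⟩ := hG.opA_eq
    refine ⟨hfA, ?_⟩
    rw [hfh]
    obtain ⟨hfE, h1, h2⟩ := hG
    -- On each branch separately, testing with the constant `1` gives that the integral of `h` is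
    -- zero.
    obtain ⟨e, he, -, he0⟩ := P.exists_const_plus hρ 1
    obtain ⟨e', he', -, he0'⟩ := P.exists_const_three hγ 1
    have h3 := h1 e
    have h4 := h2 e'
    rw [he0, inner_eq_mul_integral he] at h3
    rw [he0', inner_eq_mul_integral he'] at h4
    constructor <;> linarith
  · rintro ⟨hf, hi1, hi2⟩
    obtain ⟨hfE, hfg⟩ := SymmForm.form_eq_neg_inner_generator P.dense_domain_formE ⟨f, hf⟩
    exact mem_domain_opG_iff.2 ⟨_, P.isG_of_integral_eq_zero hρ hγ hfg hi1 hi2⟩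

end Params

end VaryingDim

end

theorem proposition3p6 (P : VaryingDim.Params) :
    (P.opG ≤ P.opA ∧ IsSelfAdjoint P.opA ∧ ¬ IsSelfAdjoint P.opG) ∧
    (Integrable P.ρ VaryingDim.halfLineVolume → 0 < P.γ → ∀ f : Lp ℝ 2 P.m,
      f ∈ P.opG.domain ↔ ∃ hf : f ∈ P.opA.domain,
        ∫ r, P.resPlus (P.opA ⟨f, hf⟩) r ∂P.mPlus = 0 ∧
        ∫ x, P.resThree (P.opA ⟨f, hf⟩) x ∂P.mThree = 0) :=
  ⟨⟨P.opG_le_opA, P.isSelfAdjoint_opA, P.not_isSelfAdjoint_opG⟩,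
    fun hρ hγ f => P.mem_domain_opG_iff_integral hρ hγ f⟩
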